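/- Let $k$ be a field of characteristic $p\ge 3$ and let $r$ be a positive integer. Superspaces are $\mathbb{Z}/2$-graded, and all tensor products of superalgebras carry the usual signs. Let $\mathbb{P}_r=k[u_0,\dots,u_{r-1},v]/(u_0^p,\dots,u_{r-2}^p,\;u_{r-1}^p+v^2)$, with the $u_i$ even and $v$ odd. Put $\gamma_\ell=\prod_i u_i^{\ell_i}/\ell_i!$ for $0\le\ell<p^r$ with base-$p$ digits $\ell_i$. Then $\mathbb{P}_r$ is a Hopf superalgebra with $v$ primitive, $\Delta(\gamma_\ell)=\sum_{i+j=\ell}\gamma_i\otimes\gamma_j$ for $0\le\ell<p^r$, and counit $u_i,v\mapsto 0$. Write $\mathbb{P}_1=k[u,v]/(u^p+v^2)$ and let $\iota:\mathbb{P}_1\to\mathbb{P}_r$ be the superalgebra map with $\iota(u)=u_{r-1}$, $\iota(v)=v$. For a finite $k$-supergroup scheme $G$, with finite-dimensional supercommutative coordinate Hopf superalgebra $k[G]$ and group algebra $kG=k[G]^{\#}$ (the dual Hopf superalgebra), let $V_r(G)=\operatorname{Spec}k[V_r(G)]$ be the affine $k$-scheme representing the functor that sends a commutative (purely even) $k$-algebra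 $A$ to the set of homomorphisms $\mathbb{P}_r\otimes_k A\to kG\otimes_k A$ of Hopf superalgebras over $A$. For a prime $\mathfrak{s}\in V_r(G)$ with residue field $k(\mathfrak{s})$, let $\nu_{\mathfrak{s}}:\mathbb{P}_r\otimes k(\mathfrak{s})\to kG\otimes k(\mathfrak{s})$ be the specialization at $\mathfrak{s}$ of the universal homomorphism. For a $kG$-supermodule $M$, regard $M\otimes_k k(\mathfrak{s})$ as a $\mathbb{P}_1\otimes_k k(\mathfrak{s})$-supermodule through $\nu_{\mathfrak{s}}\circ(\iota\otimes 1)$ and set \[ V_r(G)_M=\{\mathfrak{s}\in V_r(G) : \operatorname{pd}_{\mathbb{P}_1\otimes k(\mathfrak{s})}(M\otimes_k k(\mathfrak{s}))=\infty\}, \] where $\operatorname{pd}$ is the projective dimension in the category of supermodules and even homomorphisms. The ring $k[V_r(G)]$ is graded by $\mathbb{Z}+\mathbb{Z}\cdot\frac{p^r}{2}$ as follows. Let $B=k[x,y]/(x^{p^r}-y^2)$. The pairs $(\mu,a)$ with $\mu^2=a^{p^r}$ act on $V_r(G)$ on the right by $\rho\mapsto\rho\circ\phi_{\mu,a}$,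 where $\phi_{\mu,a}(v)=\mu v$ and $\phi_{\mu,a}(u_i)=a^{p^i}u_i$. An element $z$ is homogeneous of degree $i$ (respectively $i+\frac{p^r}{2}$) if the corresponding coaction $k[V_r(G)]\to k[V_r(G)]\otimes B$ sends $z$ to $z\otimes x^i$ (respectively $z\otimes x^iy$). A closed subset of $V_r(G)$ is conical if it is the zero locus of a homogeneous ideal. **Proposition.** Let $G$ be a finite $k$-supergroup scheme and let $M$ be a $kG$-supermodule. 1. If $M$ is finite-dimensional, then $V_r(G)_M$ is a Zariski closed conical subset of $V_r(G)$. 2. If $f:H\to G$ is a homomorphism of finite $k$-supergroup schemes, and $M$ is also considered as a $kH$-supermodule by pullback along $f$, then the induced morphism $f_*:V_r(H)\to V_r(G)$ (composition with $kH\to kG$) satisfies $f_*^{-1}(V_r(G)_M)=V_r(H)_M$. 3. If moreover $f$ is a closed embedding, then $f_*$ is a closed embedding, and $f_*(V_r(H)_M)=f_*(V_r(H))\cap V_r(G)_M$. -/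

import Mathlib

open scoped TensorProduct

universe u

noncomputable section

set_option linter.unusedSectionVars false

namespace SuperSupport

section Sign
variable {k : Type u} [Field k] {A B : Type u} [Ring A] [Algebra k A] [Ring B] [Algebra k B]

/-- The Koszul sign operator `a ⊗ b ↦ (-1)^(|a||b|) a ⊗ b`, that is, the identity minus twice the
projection onto the (odd, odd) component. -/
def koszulSign (𝒜 : ZMod 2 → Submodule k A) (ℬ : ZMod 2 → Submodule k B)
    [GradedAlgebra 𝒜] [GradedAlgebra ℬ] : A ⊗[k] B →ₗ[k] A ⊗[k] B :=
  LinearMap.id - (2 : k) • TensorProduct.map (GradedAlgebra.proj 𝒜 1) (GradedAlgebra.proj ℬ 1)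

/-- The parity-`i` part of the tensor product of two superspaces. -/
def tensorParity (𝒜 : ZMod 2 → Submodule k A) (ℬ : ZMod 2 → Submodule k B) (i : ZMod 2) :
    Submodule k (A ⊗[k] B) :=
  Submodule.span k {t | ∃ j l : ZMod 2, j + l = i ∧ ∃ a ∈ 𝒜 j, ∃ b ∈ ℬ l, t = a ⊗ₜ[k] b}

end Sign

/-- A finite `k`-supergroup scheme, given by its coordinate algebra: a finite-dimensional
supercommutative Hopf superalgebra over `k`. -/
structure FiniteSupergroupScheme (k : Type u) [Field k] where
  /-- the coordinate algebra `k[G]` -/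
  coord : Type u
  [ring : Ring coord]
  [algebra : Algebra k coord]
  [coalgebra : Coalgebra k coord]
  [finite : Module.Finite k coord]
  /-- the even and the odd part of `k[G]` -/
  parity : ZMod 2 → Submodule k coord
  [graded : GradedAlgebra parity]
  supercomm : ∀ (i j : ZMod 2) (a b : coord), a ∈ parity i → b ∈ parity j →
    a * b = ((-1 : ℤˣ) ^ (i * j)) • (b * a)
  comul_parity : ∀ (i : ZMod 2) (a : coord), a ∈ parity i →
    Coalgebra.comul (R := k) a ∈ tensorParity parity parity i
  counit_odd : ∀ a : coord, a ∈ parity 1 → Coalgebra.counit (R := k) a = 0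
  comul_one : Coalgebra.comul (R := k) (1 : coord) = 1
  /-- the coproduct is multiplicative for the signed product of the super tensor product -/
  comul_mul : ∀ a b : coord,
    GradedTensorProduct.of k parity parity (Coalgebra.comul (R := k) (a * b)) =
      GradedTensorProduct.of k parity parity (Coalgebra.comul (R := k) a) *
        GradedTensorProduct.of k parity parity (Coalgebra.comul (R := k) b)
  counit_one : Coalgebra.counit (R := k) (1 : coord) = 1
  counit_mul : ∀ a b : coord, Coalgebra.counit (R := k) (a * b) =
    Coalgebra.counit (R := k) a * Coalgebra.counit (R := k) b
  antipode : coord →ₗ[k] coord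
  mul_antipode_rTensor_comul : LinearMap.mul' k coord ∘ₗ antipode.rTensor coord ∘ₗ
    Coalgebra.comul = Algebra.linearMap k coord ∘ₗ Coalgebra.counit
  mul_antipode_lTensor_comul : LinearMap.mul' k coord ∘ₗ antipode.lTensor coord ∘ₗ
    Coalgebra.comul = Algebra.linearMap k coord ∘ₗ Coalgebra.counit

namespace FiniteSupergroupScheme

attribute [instance] ring algebra coalgebra finite graded

variable {k : Type u} [Field k]

/-- The Koszul sign operator on `k[G] ⊗ k[G]`. -/
abbrev sign (G : FiniteSupergroupScheme k) : G.coord ⊗[k] G.coord →ₗ[k] G.coord ⊗[k] G.coord :=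
  koszulSign G.parity G.parity

/-- The group algebra `kG`, the linear dual of the coordinate algebra `k[G]`. -/
def GroupAlgebra (G : FiniteSupergroupScheme k) : Type u := Module.Dual k G.coord

namespace GroupAlgebra
variable (G : FiniteSupergroupScheme k)

instance : AddCommGroup G.GroupAlgebra := inferInstanceAs (AddCommGroup (Module.Dual k G.coord))
instance : Module k G.GroupAlgebra := inferInstanceAs (Module k (Module.Dual k G.coord))
instance : Module.Finite k G.GroupAlgebra :=
  inferInstanceAs (Module.Finite k (Module.Dual k G.coord))

variable {G}

/-- An element of `kG` as a linear functional on `k[G]`. -/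
def toDual : G.GroupAlgebra ≃ₗ[k] Module.Dual k G.coord := LinearEquiv.refl k _

/-- Multiplication in `kG` is dual to the coproduct, with the Koszul sign:
`(x y)(a) = ∑ (-1)^(|a₁||a₂|) x(a₁) y(a₂)`. -/
instance : Mul G.GroupAlgebra where
  mul x y := toDual.symm
    (TensorProduct.dualDistrib k G.coord G.coord (toDual x ⊗ₜ[k] toDual y) ∘ₗ G.sign ∘ₗ
      Coalgebra.comul)

/-- The unit of `kG` is the counit of `k[G]`. -/
instance : One G.GroupAlgebra where
  one := toDual.symm Coalgebra.counit

section Ring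

/-- A functional, viewed in the (unsigned) convolution ring. -/
def conv (x : G.GroupAlgebra) : WithConv (G.coord →ₗ[k] k) := WithConv.toConv x

/-- The odd part of a functional. -/
def oddPart (x : WithConv (G.coord →ₗ[k] k)) : WithConv (G.coord →ₗ[k] k) :=
  WithConv.toConv (x.ofConv ∘ₗ GradedAlgebra.proj G.parity 1)

theorem conv_injective : Function.Injective (conv (G := G)) :=
  fun _ _ h => WithConv.toConv_injective h

theorem conv_mul (x y : G.GroupAlgebra) :
    conv (x * y) = conv x * conv y - 2 * (oddPart (conv x) * oddPart (conv y)) := by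
  rw [two_mul, ← two_smul k (oddPart (conv x) * oddPart (conv y))]
  ext a
  change (TensorProduct.dualDistrib k G.coord G.coord (toDual x ⊗ₜ[k] toDual y))
    (G.sign (Coalgebra.comul a)) =
    LinearMap.mul' k k (TensorProduct.map (toDual x) (toDual y) (Coalgebra.comul a)) -
    (2 : k) • LinearMap.mul' k k (TensorProduct.map (toDual x ∘ₗ GradedAlgebra.proj G.parity 1)
      (toDual y ∘ₗ GradedAlgebra.proj G.parity 1) (Coalgebra.comul a))
  induction (Coalgebra.comul (R := k) a) with
  | zero => simp
  | tmul b c => simp [sign, koszulSign]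
  | add s t hs ht =>
    simp only [map_add, hs, ht, smul_add]
    abel

theorem proj_of_mem {i j : ZMod 2} {a : G.coord} (ha : a ∈ G.parity i) :
    GradedAlgebra.proj G.parity j a = if i = j then a else 0 := by
  split_ifs with h
  · subst h
    simpa using DirectSum.decompose_of_mem_same G.parity ha
  · simpa using DirectSum.decompose_of_mem_ne G.parity ha h

/-- The projection of `k[G] ⊗ k[G]` onto its odd part. -/
def oddOp (G : FiniteSupergroupScheme k) : G.coord ⊗[k] G.coord →ₗ[k] G.coord ⊗[k] G.coord :=
  TensorProduct.map (GradedAlgebra.proj G.parity 1) LinearMap.id +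
    TensorProduct.map LinearMap.id (GradedAlgebra.proj G.parity 1) -
    (2 : k) • TensorProduct.map (GradedAlgebra.proj G.parity 1) (GradedAlgebra.proj G.parity 1)

theorem coprod_odd (a : G.coord) :
    Coalgebra.comul (R := k) (GradedAlgebra.proj G.parity 1 a) =
      (oddOp G) (Coalgebra.comul (R := k) a) := by
  have key : ∀ (i : ZMod 2) (b : G.coord), b ∈ G.parity i →
      Coalgebra.comul (R := k) (GradedAlgebra.proj G.parity 1 b) =
      (oddOp G) (Coalgebra.comul (R := k) b) := by
    intro i b hb
    rw [proj_of_mem hb, apply_ite (Coalgebra.comul (R := k) (A := G.coord)), map_zero]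
    have := G.comul_parity i b hb
    generalize Coalgebra.comul (R := k) b = t at this ⊢
    induction this using Submodule.span_induction with
    | zero => simp
    | mem t ht =>
      obtain ⟨j, l, rfl, c, hc, d, hd, rfl⟩ := ht
      simp only [oddOp, LinearMap.sub_apply, LinearMap.add_apply, LinearMap.smul_apply,
        TensorProduct.map_tmul, proj_of_mem hc, proj_of_mem hd, LinearMap.id_apply]
      have h01 : ¬ (0 : ZMod 2) = 1 := by decide
      have h11 : (1 : ZMod 2) + 1 = 0 := by decide
      have hz : ∀ x : ZMod 2, x = 0 ∨ x = 1 := by decide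
      rcases hz j with rfl | rfl <;> rcases hz l with rfl | rfl <;> simp [two_smul, h01, h11]
    | add s t _ _ hs ht =>
      rw [map_add, ← hs, ← ht]
      split_ifs <;> simp
    | smul c t _ ht =>
      rw [map_smul, ← ht]
      split_ifs <;> simp
  induction a using DirectSum.Decomposition.inductionOn G.parity with
  | zero => simp
  | homogeneous b => exact key _ _ b.2
  | add b c hb hc => rw [map_add, map_add, map_add, map_add, hb, hc]

theorem oddPart_oddPart (x : WithConv (G.coord →ₗ[k] k)) : oddPart (oddPart x) = oddPart x := by
  ext a
  change x.ofConv (GradedAlgebra.proj G.parity 1 (GradedAlgebra.proj G.parity 1 a)) =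
    x.ofConv (GradedAlgebra.proj G.parity 1 a)
  rw [proj_of_mem (i := 1) (a := GradedAlgebra.proj G.parity 1 a) (SetLike.coe_mem _), if_pos rfl]

theorem oddPart_sub (x y : WithConv (G.coord →ₗ[k] k)) :
    oddPart (x - y) = oddPart x - oddPart y := rfl

theorem oddPart_add (x y : WithConv (G.coord →ₗ[k] k)) :
    oddPart (x + y) = oddPart x + oddPart y := rfl

theorem oddPart_mul (x y : WithConv (G.coord →ₗ[k] k)) :
    oddPart (x * y) = oddPart x * y + x * oddPart y - 2 * (oddPart x * oddPart y) := by
  rw [two_mul, ← two_smul k (oddPart x * oddPart y)]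
  ext a
  change LinearMap.mul' k k (TensorProduct.map x.ofConv y.ofConv
      (Coalgebra.comul (R := k) (GradedAlgebra.proj G.parity 1 a))) =
    LinearMap.mul' k k (TensorProduct.map (x.ofConv ∘ₗ GradedAlgebra.proj G.parity 1) y.ofConv
      (Coalgebra.comul a)) +
    LinearMap.mul' k k (TensorProduct.map x.ofConv (y.ofConv ∘ₗ GradedAlgebra.proj G.parity 1)
      (Coalgebra.comul a)) -
    (2 : k) • LinearMap.mul' k k (TensorProduct.map (x.ofConv ∘ₗ GradedAlgebra.proj G.parity 1)
      (y.ofConv ∘ₗ GradedAlgebra.proj G.parity 1) (Coalgebra.comul a))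
  rw [coprod_odd]
  induction (Coalgebra.comul (R := k) a) with
  | zero => simp
  | tmul b c => simp [oddOp]
  | add s t hs ht =>
    simp only [map_add, hs, ht, smul_add]
    abel

theorem conv_one : conv (1 : G.GroupAlgebra) = 1 := rfl

theorem oddPart_one : oddPart (1 : WithConv (G.coord →ₗ[k] k)) = 0 := by
  ext a
  exact G.counit_odd _ (SetLike.coe_mem _)

theorem conv_add (x y : G.GroupAlgebra) : conv (x + y) = conv x + conv y := rfl

theorem conv_smul (c : k) (x : G.GroupAlgebra) : conv (c • x) = c • conv x := rfl

theorem oddPart_smul (c : k) (x : WithConv (G.coord →ₗ[k] k)) :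
    oddPart (c • x) = c • oddPart x := rfl

theorem oddPart_zero : oddPart (0 : WithConv (G.coord →ₗ[k] k)) = 0 := rfl

theorem conv_zero : conv (0 : G.GroupAlgebra) = 0 := rfl

instance : Ring G.GroupAlgebra :=
  { (inferInstance : AddCommGroup G.GroupAlgebra),
    (inferInstance : Mul G.GroupAlgebra),
    (inferInstance : One G.GroupAlgebra) with
    left_distrib := fun x y z => conv_injective <| by
      simp only [conv_mul, conv_add, oddPart_add]; noncomm_ring
    right_distrib := fun x y z => conv_injective <| by
      simp only [conv_mul, conv_add, oddPart_add]; noncomm_ring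
    zero_mul := fun x => conv_injective <| by
      simp [conv_mul, conv_zero, oddPart_zero]
    mul_zero := fun x => conv_injective <| by
      simp [conv_mul, conv_zero, oddPart_zero]
    one_mul := fun x => conv_injective <| by
      simp [conv_mul, conv_one, oddPart_one]
    mul_one := fun x => conv_injective <| by
      simp [conv_mul, conv_one, oddPart_one]
    mul_assoc := fun x y z => conv_injective <| by
      simp only [conv_mul, two_mul, oddPart_sub, oddPart_add, oddPart_mul, oddPart_oddPart,
        add_mul, mul_add, sub_mul, mul_sub, mul_assoc]
      abel }

instance : Algebra k G.GroupAlgebra := Algebra.ofModule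
  (fun c x y => conv_injective <| by
    simp only [conv_mul, conv_smul, oddPart_smul, smul_mul_assoc, mul_smul_comm, smul_sub])
  (fun c x y => conv_injective <| by
    simp only [conv_mul, conv_smul, oddPart_smul, mul_smul_comm, smul_sub])

end Ring

/-- The coproduct of `kG` is dual to the multiplication of `k[G]`, with the Koszul sign:
if `Δ x = ∑ x₁ ⊗ x₂` then `x(a b) = ∑ (-1)^(|a||b|) x₁(a) x₂(b)`. The counit is `x ↦ x(1)`. -/
instance : CoalgebraStruct k G.GroupAlgebra where
  comul := TensorProduct.map toDual.symm.toLinearMap toDual.symm.toLinearMap ∘ₗ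
    (TensorProduct.dualDistribEquiv k G.coord G.coord).symm.toLinearMap ∘ₗ
    (LinearMap.mul' k G.coord ∘ₗ G.sign).dualMap ∘ₗ toDual.toLinearMap
  counit := Module.Dual.eval k G.coord 1 ∘ₗ toDual.toLinearMap

variable (G) in
/-- A functional on `k[G]` has parity `i` if it vanishes on elements of the other parity. -/
def parity (i : ZMod 2) : Submodule k G.GroupAlgebra :=
  (G.parity (i + 1)).dualAnnihilator.comap toDual.toLinearMap

end GroupAlgebra
end FiniteSupergroupScheme

section HopfHom

variable {k : Type u} [Field k]

/-- For `k`-superalgebras `X`, `Y` with coproduct and counit, and a (purely even) commutative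
`k`-algebra `A`: the homomorphisms `A ⊗ X → A ⊗ Y` of Hopf superalgebras over `A`, that is, the
parity-preserving `A`-algebra maps that respect coproduct and counit (and hence the antipode). -/
structure HopfHom (A : Type u) [CommRing A] [Algebra k A] {X Y : Type u}
    [Ring X] [Algebra k X] [CoalgebraStruct k X] [Ring Y] [Algebra k Y] [CoalgebraStruct k Y]
    (𝒳 : ZMod 2 → Submodule k X) (𝒴 : ZMod 2 → Submodule k Y) where
  toBialgHom : A ⊗[k] X →ₐc[A] A ⊗[k] Y
  map_parity : ∀ (i : ZMod 2) (x : A ⊗[k] X), x ∈ (𝒳 i).baseChange A →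
    toBialgHom x ∈ (𝒴 i).baseChange A

namespace HopfHom

section Base

variable {A : Type u} [CommRing A] [Algebra k A] {X Y : Type u} [Ring X] [Algebra k X]
  [Ring Y] [Algebra k Y]

/-- The `A`-algebra map `a ⊗ x ↦ a w(x)`. -/
def extendScalars (w : X →ₐ[k] A ⊗[k] Y) : A ⊗[k] X →ₐ[A] A ⊗[k] Y :=
  Algebra.TensorProduct.lift (Algebra.ofId A (A ⊗[k] Y)) w
    (fun a x => by rw [Algebra.ofId_apply]; exact Algebra.commute_algebraMap_left a (w x))

theorem extendScalars_tmul (w : X →ₐ[k] A ⊗[k] Y) (a : A) (x : X) :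
    extendScalars w (a ⊗ₜ x) = a • w x := by
  rw [extendScalars, Algebra.TensorProduct.lift_tmul, Algebra.ofId_apply, Algebra.smul_def]

variable (A Y) in
/-- `(a ⊗ y) ⊗ (b ⊗ z) ↦ a b ⊗ (y ⊗ z)`. -/
def flat : (A ⊗[k] Y) ⊗[k] (A ⊗[k] Y) →ₗ[k] A ⊗[k] (Y ⊗[k] Y) :=
  TensorProduct.map (LinearMap.mul' k A) LinearMap.id ∘ₗ
    (TensorProduct.tensorTensorTensorComm k A Y A Y).toLinearMap

theorem flat_tmul (a b : A) (y z : Y) :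
    flat A Y ((a ⊗ₜ y) ⊗ₜ (b ⊗ₜ z)) = (a * b) ⊗ₜ[k] (y ⊗ₜ[k] z) := rfl

variable (A Y) in
/-- `a ⊗ (y ⊗ z) ↦ (a ⊗ y) ⊗ (1 ⊗ z)`. -/
def distrib : A ⊗[k] (Y ⊗[k] Y) ≃ₗ[A] (A ⊗[k] Y) ⊗[A] (A ⊗[k] Y) :=
  TensorProduct.AlgebraTensorModule.distribBaseChange k A Y Y

theorem distrib_tmul (a : A) (y z : Y) :
    distrib A Y (a ⊗ₜ (y ⊗ₜ z)) = (a ⊗ₜ[k] y) ⊗ₜ[A] ((1 : A) ⊗ₜ[k] z) := rfl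

theorem distrib_flat (s t : A ⊗[k] Y) : distrib A Y (flat A Y (s ⊗ₜ t)) = s ⊗ₜ[A] t := by
  induction s with
  | zero => simp
  | add s₁ s₂ h₁ h₂ => simp only [TensorProduct.add_tmul, map_add, h₁, h₂]
  | tmul a y =>
    induction t with
    | zero => simp
    | add s₁ s₂ h₁ h₂ => simp only [TensorProduct.tmul_add, map_add, h₁, h₂]
    | tmul b z =>
      rw [flat_tmul, distrib_tmul, mul_comm, ← smul_eq_mul, ← TensorProduct.smul_tmul',
        TensorProduct.smul_tmul, TensorProduct.smul_tmul', smul_eq_mul, mul_one]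

theorem map_distrib (w : X →ₐ[k] A ⊗[k] Y) (t : X ⊗[k] X) :
    TensorProduct.map (extendScalars w).toLinearMap (extendScalars w).toLinearMap
      (distrib A X (1 ⊗ₜ t)) =
    distrib A Y (flat A Y (TensorProduct.map w.toLinearMap w.toLinearMap t)) := by
  induction t with
  | zero => simp
  | add s t hs ht => simp only [TensorProduct.tmul_add, map_add, hs, ht]
  | tmul x y =>
    rw [distrib_tmul, TensorProduct.map_tmul, TensorProduct.map_tmul, distrib_flat]
    simp only [AlgHom.toLinearMap_apply, extendScalars_tmul, one_smul]

theorem extendScalars_parity {𝒳 : ZMod 2 → Submodule k X} {𝒴 : ZMod 2 → Submodule k Y}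
    (w : X →ₐ[k] A ⊗[k] Y)
    (hpar : ∀ (i : ZMod 2) (x : X), x ∈ 𝒳 i → w x ∈ (𝒴 i).baseChange A)
    (i : ZMod 2) (x : A ⊗[k] X) (hx : x ∈ (𝒳 i).baseChange A) :
    extendScalars w x ∈ (𝒴 i).baseChange A := by
  rw [Submodule.baseChange_eq_span] at hx
  induction hx using Submodule.span_induction with
  | zero => simp
  | add s t _ _ hs ht => rw [map_add]; exact add_mem hs ht
  | smul a s _ hs => rw [map_smul]; exact Submodule.smul_mem _ _ hs
  | mem x hx =>
    obtain ⟨y, hy, rfl⟩ := hx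
    change extendScalars w ((1 : A) ⊗ₜ y) ∈ _
    rw [extendScalars_tmul, one_smul]
    exact hpar i y hy

end Base

variable {A B : Type u} [CommRing A] [Algebra k A] [CommRing B] [Algebra k B]
  {X Y Z : Type u} [Ring X] [Algebra k X] [CoalgebraStruct k X]
  [Ring Y] [Algebra k Y] [CoalgebraStruct k Y] [Ring Z] [Algebra k Z] [CoalgebraStruct k Z]
  {𝒳 : ZMod 2 → Submodule k X} {𝒴 : ZMod 2 → Submodule k Y} {𝒵 : ZMod 2 → Submodule k Z}

/-- The `A`-algebra map underlying a homomorphism of Hopf superalgebras. -/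
def toAlgHom (ρ : HopfHom A 𝒳 𝒴) : A ⊗[k] X →ₐ[A] A ⊗[k] Y :=
  AlgHomClass.toAlgHom ρ.toBialgHom

/-- The restriction of a homomorphism to `X`. -/
def restr (ρ : HopfHom A 𝒳 𝒴) : X →ₐ[k] A ⊗[k] Y :=
  (ρ.toAlgHom.restrictScalars k).comp Algebra.TensorProduct.includeRight

theorem restr_apply (ρ : HopfHom A 𝒳 𝒴) (x : X) : ρ.restr x = ρ.toBialgHom (1 ⊗ₜ x) := rfl

theorem tmul_apply (ρ : HopfHom A 𝒳 𝒴) (a : A) (x : X) :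
    ρ.toBialgHom (a ⊗ₜ x) = a • ρ.restr x := by
  rw [restr_apply, ← map_smul, TensorProduct.smul_tmul', smul_eq_mul, mul_one]

theorem ext_restr {ρ σ : HopfHom A 𝒳 𝒴} (h : ∀ x, ρ.restr x = σ.restr x) : ρ = σ := by
  have : ρ.toBialgHom = σ.toBialgHom := by
    ext z
    induction z with
    | zero => simp
    | tmul a x => rw [tmul_apply, tmul_apply, h]
    | add s t hs ht => rw [map_add, map_add, hs, ht]
  cases ρ; cases σ; simp_all

theorem comul_eq (z : A ⊗[k] Y) :
    Coalgebra.comul (R := A) z =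
      distrib A Y ((Coalgebra.comul (R := k) (A := Y)).lTensor A z) := by
  induction z with
  | zero => simp
  | add s t hs ht => simp only [map_add, hs, ht]
  | tmul a y =>
    rw [TensorProduct.comul_tmul, LinearMap.lTensor_tmul]
    induction (Coalgebra.comul (R := k) y) with
    | zero => simp
    | add s t hs ht => simp only [TensorProduct.tmul_add, map_add, hs, ht]
    | tmul b c =>
      rw [distrib_tmul, CommSemiring.comul_apply]
      change ((1 : A) ⊗ₜ[k] b) ⊗ₜ[A] (a ⊗ₜ[k] c) = _
      have : a ⊗ₜ[k] c = a • ((1 : A) ⊗ₜ[k] c) := by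
        rw [TensorProduct.smul_tmul', smul_eq_mul, mul_one]
      rw [this, ← TensorProduct.smul_tmul, TensorProduct.smul_tmul', smul_eq_mul, mul_one]

theorem counit_eq (z : A ⊗[k] Y) :
    Coalgebra.counit (R := A) z =
      TensorProduct.rid k A ((Coalgebra.counit (R := k) (A := Y)).lTensor A z) := by
  induction z with
  | zero => simp
  | add s t hs ht => simp only [map_add, hs, ht]
  | tmul a y => simp

/-- A homomorphism is determined by a `k`-algebra map `X → A ⊗ Y` with the appropriate
properties. -/
def ofAlgHom (w : X →ₐ[k] A ⊗[k] Y)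
    (hpar : ∀ (i : ZMod 2) (x : X), x ∈ 𝒳 i → w x ∈ (𝒴 i).baseChange A)
    (hcounit : ∀ x, TensorProduct.rid k A ((Coalgebra.counit (R := k) (A := Y)).lTensor A (w x)) =
      algebraMap k A (Coalgebra.counit (R := k) x))
    (hcomul : ∀ x, (Coalgebra.comul (R := k) (A := Y)).lTensor A (w x) =
      flat A Y (TensorProduct.map w.toLinearMap w.toLinearMap (Coalgebra.comul (R := k) x))) :
    HopfHom A 𝒳 𝒴 where
  toBialgHom :=
    { extendScalars w with
      map_smul' := map_smul (extendScalars w)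
      counit_comp := by
        refine TensorProduct.AlgebraTensorModule.curry_injective (LinearMap.ext_ring
          (LinearMap.ext fun x => ?_))
        change Coalgebra.counit (R := A) (extendScalars w (1 ⊗ₜ x)) =
          Coalgebra.counit (R := A) ((1 : A) ⊗ₜ[k] x)
        rw [extendScalars_tmul, one_smul, counit_eq, hcounit, counit_eq, LinearMap.lTensor_tmul,
          TensorProduct.rid_tmul, Algebra.algebraMap_eq_smul_one]
      map_comp_comul := by
        refine TensorProduct.AlgebraTensorModule.curry_injective (LinearMap.ext_ring
          (LinearMap.ext fun x => ?_))
        change TensorProduct.map (extendScalars w).toLinearMap (extendScalars w).toLinearMap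
          (Coalgebra.comul (R := A) ((1 : A) ⊗ₜ[k] x)) =
          Coalgebra.comul (R := A) (extendScalars w (1 ⊗ₜ x))
        rw [extendScalars_tmul, one_smul, comul_eq, comul_eq, hcomul, LinearMap.lTensor_tmul,
          map_distrib] }
  map_parity := fun i x hx => by
    change extendScalars w x ∈ _
    exact extendScalars_parity w hpar i x hx

theorem ofAlgHom_restr (w : X →ₐ[k] A ⊗[k] Y) (h₁ h₂ h₃) (x : X) :
    (ofAlgHom (𝒳 := 𝒳) (𝒴 := 𝒴) w h₁ h₂ h₃).restr x = w x := by
  change extendScalars w (1 ⊗ₜ x) = w x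
  rw [extendScalars_tmul, one_smul]

theorem toBialgHom_apply (ρ : HopfHom A 𝒳 𝒴) (z : A ⊗[k] X) :
    ρ.toBialgHom z = extendScalars ρ.restr z := by
  induction z with
  | zero => simp
  | tmul a x => rw [tmul_apply, extendScalars_tmul]
  | add s t hs ht => rw [map_add, map_add, hs, ht]

theorem restr_parity (ρ : HopfHom A 𝒳 𝒴) (i : ZMod 2) (x : X) (hx : x ∈ 𝒳 i) :
    ρ.restr x ∈ (𝒴 i).baseChange A :=
  ρ.map_parity i _ (Submodule.tmul_mem_baseChange_of_mem 1 hx)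

theorem restr_counit (ρ : HopfHom A 𝒳 𝒴) (x : X) :
    TensorProduct.rid k A ((Coalgebra.counit (R := k) (A := Y)).lTensor A (ρ.restr x)) =
      algebraMap k A (Coalgebra.counit (R := k) x) := by
  rw [← counit_eq, restr_apply]
  have := CoalgHomClass.counit_comp_apply ρ.toBialgHom ((1 : A) ⊗ₜ[k] x)
  rw [this, counit_eq, LinearMap.lTensor_tmul, TensorProduct.rid_tmul,
    Algebra.algebraMap_eq_smul_one]

theorem restr_comul (ρ : HopfHom A 𝒳 𝒴) (x : X) :
    (Coalgebra.comul (R := k) (A := Y)).lTensor A (ρ.restr x) =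
      flat A Y (TensorProduct.map ρ.restr.toLinearMap ρ.restr.toLinearMap
        (Coalgebra.comul (R := k) x)) := by
  apply (distrib A Y).injective
  rw [← comul_eq, restr_apply, ← map_distrib]
  have := CoalgHomClass.map_comp_comul_apply ρ.toBialgHom ((1 : A) ⊗ₜ[k] x)
  rw [← this, comul_eq, LinearMap.lTensor_tmul]
  have h : (ρ.toBialgHom : A ⊗[k] X →ₗ[A] A ⊗[k] Y) = (extendScalars ρ.restr).toLinearMap :=
    LinearMap.ext (toBialgHom_apply ρ)
  exact congrArg (fun g => TensorProduct.map g g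
    (distrib A X ((1 : A) ⊗ₜ[k] Coalgebra.comul (R := k) x))) h

/-- Composition. -/
def comp (σ : HopfHom A 𝒴 𝒵) (ρ : HopfHom A 𝒳 𝒴) : HopfHom A 𝒳 𝒵 where
  toBialgHom := σ.toBialgHom.comp ρ.toBialgHom
  map_parity := fun i x hx => σ.map_parity i _ (ρ.map_parity i x hx)

/-- The homomorphism over `A` obtained from a homomorphism over `k` by extension of scalars. -/
def ofBialgHom (f : X →ₐc[k] Y) (hf : ∀ (i : ZMod 2) (x : X), x ∈ 𝒳 i → f x ∈ 𝒴 i) :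
    HopfHom A 𝒳 𝒴 :=
  ofAlgHom (Algebra.TensorProduct.includeRight.comp (f : X →ₐ[k] Y))
    (fun i x hx => Submodule.tmul_mem_baseChange_of_mem 1 (hf i x hx))
    (fun x => by
      change TensorProduct.rid k A ((1 : A) ⊗ₜ[k] Coalgebra.counit (R := k) (f x)) = _
      rw [CoalgHomClass.counit_comp_apply, TensorProduct.rid_tmul,
        Algebra.algebraMap_eq_smul_one])
    (fun x => by
      change (1 : A) ⊗ₜ[k] Coalgebra.comul (R := k) (f x) = _
      rw [← CoalgHomClass.map_comp_comul_apply]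
      induction (Coalgebra.comul (R := k) x) with
      | zero => simp
      | add s t hs ht => simp only [map_add, TensorProduct.tmul_add, hs, ht]
      | tmul a b =>
        rw [TensorProduct.map_tmul, TensorProduct.map_tmul]
        change _ = flat A Y (((1 : A) ⊗ₜ[k] f a) ⊗ₜ[k] ((1 : A) ⊗ₜ[k] f b))
        rw [flat_tmul, mul_one]
        rfl)

section Push

/-- Extension of scalars along `φ : A → B`. -/
def push (φ : A →ₐ[k] B) (N : Type u) [AddCommGroup N] [Module k N] : A ⊗[k] N →ₗ[k] B ⊗[k] N :=
  φ.toLinearMap.rTensor N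

theorem push_tmul (φ : A →ₐ[k] B) {N : Type u} [AddCommGroup N] [Module k N] (a : A) (n : N) :
    push φ N (a ⊗ₜ n) = φ a ⊗ₜ n := rfl

theorem push_lTensor (φ : A →ₐ[k] B) {N N' : Type u} [AddCommGroup N] [Module k N]
    [AddCommGroup N'] [Module k N'] (f : N →ₗ[k] N') (z : A ⊗[k] N) :
    push φ N' (f.lTensor A z) = f.lTensor B (push φ N z) := by
  induction z with
  | zero => simp
  | add s t hs ht => simp only [map_add, hs, ht]
  | tmul a y => rfl

theorem push_rid (φ : A →ₐ[k] B) (z : A ⊗[k] k) :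
    φ (TensorProduct.rid k A z) = TensorProduct.rid k B (push φ k z) := by
  induction z with
  | zero => simp
  | add s t hs ht => simp only [map_add, hs, ht]
  | tmul a y => simp [push_tmul]

theorem push_mul (φ : A →ₐ[k] B) (s t : A ⊗[k] Y) :
    push φ Y (s * t) = push φ Y s * push φ Y t :=
  map_mul (Algebra.TensorProduct.map φ (AlgHom.id k Y)) s t

theorem push_one (φ : A →ₐ[k] B) : push φ Y 1 = 1 :=
  map_one (Algebra.TensorProduct.map φ (AlgHom.id k Y))

theorem push_flat (φ : A →ₐ[k] B) (s t : A ⊗[k] Y) :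
    push φ (Y ⊗[k] Y) (flat A Y (s ⊗ₜ t)) = flat B Y (push φ Y s ⊗ₜ push φ Y t) := by
  induction s with
  | zero => simp
  | add s₁ s₂ h₁ h₂ => simp only [TensorProduct.add_tmul, map_add, h₁, h₂]
  | tmul a y =>
    induction t with
    | zero => simp
    | add s₁ s₂ h₁ h₂ => simp only [TensorProduct.tmul_add, map_add, h₁, h₂]
    | tmul b z => simp only [flat_tmul, push_tmul, map_mul]

theorem push_flat_map (φ : A →ₐ[k] B) (v : X →ₗ[k] A ⊗[k] Y) (w : X →ₗ[k] B ⊗[k] Y)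
    (h : ∀ x, push φ Y (v x) = w x) (t : X ⊗[k] X) :
    push φ (Y ⊗[k] Y) (flat A Y (TensorProduct.map v v t)) =
      flat B Y (TensorProduct.map w w t) := by
  induction t with
  | zero => simp
  | add s t hs ht => simp only [map_add, hs, ht]
  | tmul a b => simp only [TensorProduct.map_tmul, push_flat, h]

theorem mem_baseChange_iff (N : Submodule k Y) (z : A ⊗[k] Y) :
    z ∈ N.baseChange A ↔ N.mkQ.lTensor A z = 0 := by
  rw [← LinearMap.mem_ker, lTensor_mkQ]
  rfl

theorem push_mem_baseChange (φ : A →ₐ[k] B) (N : Submodule k Y) (z : A ⊗[k] Y)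
    (hz : z ∈ N.baseChange A) : push φ Y z ∈ N.baseChange B := by
  rw [mem_baseChange_iff] at hz ⊢
  rw [← push_lTensor, hz, map_zero]

end Push

/-- Base change of a homomorphism along `φ : A → B`. -/
def baseChange (φ : A →ₐ[k] B) (ρ : HopfHom A 𝒳 𝒴) : HopfHom B 𝒳 𝒴 :=
  ofAlgHom ((Algebra.TensorProduct.map φ (AlgHom.id k Y)).comp ρ.restr)
    (fun i x hx => push_mem_baseChange φ _ _ (ρ.restr_parity i x hx))
    (fun x => by
      change TensorProduct.rid k B ((Coalgebra.counit (R := k)).lTensor B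
        (push φ Y (ρ.restr x))) = _
      rw [← push_lTensor, ← push_rid, ρ.restr_counit, AlgHom.commutes])
    (fun x => by
      change (Coalgebra.comul (R := k)).lTensor B (push φ Y (ρ.restr x)) = _
      rw [← push_lTensor, ρ.restr_comul]
      exact push_flat_map φ _ _ (fun _ => rfl) _)

theorem baseChange_restr (φ : A →ₐ[k] B) (ρ : HopfHom A 𝒳 𝒴) (x : X) :
    (ρ.baseChange φ).restr x = push φ Y (ρ.restr x) :=
  ofAlgHom_restr _ _ _ _ x

/-! ### The representing algebra -/

section Universal

/-- The coefficient of an element of `A ⊗ Y` at a functional on `Y`. -/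
def coeff (f : Module.Dual k Y) : A ⊗[k] Y →ₗ[k] A :=
  (TensorProduct.rid k A).toLinearMap ∘ₗ f.lTensor A

variable (𝒳 𝒴)

/-- The value at the point `ρ` of a polynomial in the matrix coefficients `(x, f)`, where the
matrix coefficient `(x, f)` takes the value `f(ρ(x))`. -/
def evalPoly (ρ : HopfHom A 𝒳 𝒴) : MvPolynomial (X × Module.Dual k Y) k →ₐ[k] A :=
  MvPolynomial.aeval fun c => coeff c.2 (ρ.restr c.1)

/-- The ideal of all polynomials in the matrix coefficients that vanish at every homomorphism,
over every commutative `k`-algebra. -/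
def relations : Ideal (MvPolynomial (X × Module.Dual k Y) k) where
  carrier := {t | ∀ (A : Type u) [CommRing A] [Algebra k A] (ρ : HopfHom A 𝒳 𝒴),
    evalPoly 𝒳 𝒴 ρ t = 0}
  zero_mem' := fun A _ _ ρ => map_zero _
  add_mem' := fun {s t} hs ht A _ _ ρ => by rw [map_add, hs A ρ, ht A ρ, add_zero]
  smul_mem' := fun c t ht A _ _ ρ => by rw [smul_eq_mul, map_mul, ht A ρ, mul_zero]

/-- The commutative `k`-algebra representing the functor `A ↦ HopfHom A 𝒳 𝒴`
(see `existsUnique_baseChange_universal`). -/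
abbrev RepAlg : Type u := MvPolynomial (X × Module.Dual k Y) k ⧸ relations 𝒳 𝒴

variable {𝒳 𝒴}

/-- The algebra map `RepAlg → A` corresponding to a homomorphism over `A`. -/
def classify (ρ : HopfHom A 𝒳 𝒴) : RepAlg 𝒳 𝒴 →ₐ[k] A :=
  Ideal.Quotient.liftₐ (relations 𝒳 𝒴) (evalPoly 𝒳 𝒴 ρ) (fun _ ht => ht A ρ)

theorem classify_mk (ρ : HopfHom A 𝒳 𝒴) (t : MvPolynomial (X × Module.Dual k Y) k) :
    classify ρ (Ideal.Quotient.mk _ t) = evalPoly 𝒳 𝒴 ρ t := rfl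

theorem rep_separated (z : RepAlg 𝒳 𝒴)
    (h : ∀ (A : Type u) [CommRing A] [Algebra k A] (ρ : HopfHom A 𝒳 𝒴), classify ρ z = 0) :
    z = 0 := by
  obtain ⟨t, rfl⟩ := Ideal.Quotient.mk_surjective z
  rw [Ideal.Quotient.eq_zero_iff_mem]
  intro A _ _ ρ
  exact h A ρ

theorem rep_tensor_separated {N : Type u} [AddCommGroup N] [Module k N] (z z' : RepAlg 𝒳 𝒴 ⊗[k] N)
    (h : ∀ (A : Type u) [CommRing A] [Algebra k A] (ρ : HopfHom A 𝒳 𝒴),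
      push (classify ρ) N z = push (classify ρ) N z') : z = z' := by
  classical
  have key : ∀ (A : Type u) [CommRing A] [Algebra k A] (φ : RepAlg 𝒳 𝒴 →ₐ[k] A)
      (z : RepAlg 𝒳 𝒴 ⊗[k] N) (i),
      φ (TensorProduct.equivFinsuppOfBasisRight (Module.Basis.ofVectorSpace k N) z i) =
        TensorProduct.equivFinsuppOfBasisRight (Module.Basis.ofVectorSpace k N) (push φ N z) i := by
    intro A _ _ φ z i
    induction z with
    | zero => simp
    | add s t hs ht => simp only [map_add, Finsupp.add_apply, hs, ht]
    | tmul a n => simp [push_tmul]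
  rw [← sub_eq_zero]
  apply (TensorProduct.equivFinsuppOfBasisRight (M := RepAlg 𝒳 𝒴)
    (Module.Basis.ofVectorSpace k N)).injective
  ext i
  rw [map_zero, Finsupp.zero_apply]
  refine rep_separated _ fun A _ _ ρ => ?_
  rw [key, map_sub, h, sub_self, map_zero, Finsupp.zero_apply]

variable [Module.Finite k Y]

theorem sum_coeff (z : A ⊗[k] Y) :
    ∑ j, coeff ((Module.finBasis k Y).coord j) z ⊗ₜ[k] Module.finBasis k Y j = z := by
  induction z with
  | zero => simp
  | add s t hs ht =>
    simp only [map_add, TensorProduct.add_tmul, Finset.sum_add_distrib, hs, ht]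
  | tmul a y =>
    simp only [coeff, LinearMap.comp_apply, LinearMap.lTensor_tmul, LinearEquiv.coe_coe,
      TensorProduct.rid_tmul, TensorProduct.smul_tmul, ← TensorProduct.tmul_sum,
      Module.Basis.coord_apply, Module.Basis.sum_repr]

/-- The universal homomorphism, on an element of `X`. -/
def universalFun (x : X) : RepAlg 𝒳 𝒴 ⊗[k] Y :=
  ∑ j, (Ideal.Quotient.mk (relations 𝒳 𝒴)
    (MvPolynomial.X (x, (Module.finBasis k Y).coord j))) ⊗ₜ[k] Module.finBasis k Y j

theorem push_universalFun (ρ : HopfHom A 𝒳 𝒴) (x : X) :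
    push (classify ρ) Y (universalFun x) = ρ.restr x := by
  rw [universalFun, map_sum]
  simp only [push_tmul, classify_mk, evalPoly, MvPolynomial.aeval_X]
  exact sum_coeff _

variable (𝒳 𝒴) in
/-- The universal homomorphism as an algebra map on `X`. -/
def universalAlgHom : X →ₐ[k] RepAlg 𝒳 𝒴 ⊗[k] Y :=
  AlgHom.ofLinearMap
    { toFun := universalFun
      map_add' := fun x y => rep_tensor_separated _ _ fun A _ _ ρ => by
        rw [map_add, push_universalFun, push_universalFun, push_universalFun, map_add]
      map_smul' := fun c x => rep_tensor_separated _ _ fun A _ _ ρ => by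
        rw [RingHom.id_apply, map_smul, push_universalFun, push_universalFun, map_smul] }
    (rep_tensor_separated _ _ fun A _ _ ρ => by
      change push (classify ρ) Y (universalFun 1) = _
      rw [push_universalFun, push_one, map_one])
    (fun x y => rep_tensor_separated _ _ fun A _ _ ρ => by
      change push (classify ρ) Y (universalFun (x * y)) =
        push (classify ρ) Y (universalFun x * universalFun y)
      rw [push_mul, push_universalFun, push_universalFun, push_universalFun, map_mul])

theorem push_universalAlgHom (ρ : HopfHom A 𝒳 𝒴) (x : X) :
    push (classify ρ) Y (universalAlgHom 𝒳 𝒴 x) = ρ.restr x := push_universalFun ρ x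

variable (𝒳 𝒴) in
/-- The universal homomorphism of Hopf superalgebras. -/
def universal : HopfHom (RepAlg 𝒳 𝒴) 𝒳 𝒴 :=
  ofAlgHom (universalAlgHom 𝒳 𝒴)
    (fun i x hx => by
      rw [mem_baseChange_iff]
      refine rep_tensor_separated _ _ fun A _ _ ρ => ?_
      rw [push_lTensor, push_universalAlgHom, map_zero, ← mem_baseChange_iff]
      exact ρ.restr_parity i x hx)
    (fun x => by
      rw [← sub_eq_zero]
      refine rep_separated _ fun A _ _ ρ => ?_
      rw [map_sub, push_rid, push_lTensor, push_universalAlgHom, ρ.restr_counit,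
        AlgHom.commutes, sub_self])
    (fun x => rep_tensor_separated _ _ fun A _ _ ρ => by
      rw [push_lTensor, push_universalAlgHom, ρ.restr_comul]
      exact (push_flat_map (classify ρ) _ _ (push_universalAlgHom ρ) _).symm)

theorem universal_baseChange_classify (ρ : HopfHom A 𝒳 𝒴) :
    (universal 𝒳 𝒴).baseChange (classify ρ) = ρ := ext_restr fun x => by
  rw [baseChange_restr, universal, ofAlgHom_restr, push_universalAlgHom]

/-- The universal property: every homomorphism over `A` is the base change of the universal one
along a unique algebra map. -/
theorem existsUnique_baseChange_universal (ρ : HopfHom A 𝒳 𝒴) :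
    ∃! φ : RepAlg 𝒳 𝒴 →ₐ[k] A, (universal 𝒳 𝒴).baseChange φ = ρ := by
  refine ⟨classify ρ, universal_baseChange_classify ρ, fun φ hφ => ?_⟩
  have hc : ∀ (x : X) (f : Module.Dual k Y),
      coeff f ((universal 𝒳 𝒴).restr x) = Ideal.Quotient.mk _ (MvPolynomial.X (x, f)) := by
    intro x f
    rw [← sub_eq_zero]
    refine rep_separated _ fun A _ _ σ => ?_
    rw [map_sub, classify_mk, evalPoly, MvPolynomial.aeval_X, coeff, LinearMap.comp_apply,
      LinearEquiv.coe_coe, push_rid, push_lTensor, universal, ofAlgHom_restr,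
      push_universalAlgHom]
    exact sub_self _
  apply Ideal.Quotient.algHom_ext
  apply MvPolynomial.algHom_ext
  rintro ⟨x, f⟩
  change φ (Ideal.Quotient.mk _ (MvPolynomial.X (x, f))) = evalPoly 𝒳 𝒴 ρ _
  rw [← hc, evalPoly, MvPolynomial.aeval_X, coeff, LinearMap.comp_apply, LinearEquiv.coe_coe,
    push_rid, push_lTensor, ← baseChange_restr, hφ]
  rfl

end Universal

end HopfHom
end HopfHom

/-! ### The Hopf superalgebra `ℙ_r` -/

section Pr

/-- Evaluation of a polynomial at pairwise commuting elements of an algebra. -/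
def aevalComm {k : Type u} [Field k] {σ T : Type*} [Ring T] [Algebra k T] (x : σ → T)
    (h : ∀ i j, x i * x j = x j * x i) : MvPolynomial σ k →ₐ[k] T :=
  have : IsMulCommutative (Algebra.adjoin k (Set.range x)) :=
    Algebra.isMulCommutative_adjoin k (by
      rintro _ ⟨i, rfl⟩ _ ⟨j, rfl⟩
      exact h i j)
  letI : CommRing (Algebra.adjoin k (Set.range x)) :=
    { (inferInstance : Ring (Algebra.adjoin k (Set.range x))) with
      mul_comm := fun a b => this.is_comm.comm a b }
  (Algebra.adjoin k (Set.range x)).val.comp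
    (MvPolynomial.aeval fun i => (⟨x i, Algebra.subset_adjoin ⟨i, rfl⟩⟩ :
      Algebra.adjoin k (Set.range x)))

theorem aevalComm_X {k : Type u} [Field k] {σ T : Type*} [Ring T] [Algebra k T] (x : σ → T)
    (h : ∀ i j, x i * x j = x j * x i) (i : σ) : aevalComm (k := k) x h (MvPolynomial.X i) = x i := by
  have : IsMulCommutative (Algebra.adjoin k (Set.range x)) :=
    Algebra.isMulCommutative_adjoin k (by
      rintro _ ⟨i, rfl⟩ _ ⟨j, rfl⟩
      exact h i j)
  let _ : CommRing (Algebra.adjoin k (Set.range x)) :=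
    { (inferInstance : Ring (Algebra.adjoin k (Set.range x))) with
      mul_comm := fun a b => this.is_comm.comm a b }
  change ((MvPolynomial.aeval (R := k) (fun i => (⟨x i, Algebra.subset_adjoin ⟨i, rfl⟩⟩ :
      Algebra.adjoin k (Set.range x))) (MvPolynomial.X i) : Algebra.adjoin k (Set.range x)) : T) = _
  rw [MvPolynomial.aeval_X]

variable (k : Type u) [Field k] (p r : ℕ)

/-- The defining relations `u_i ^ p = 0` for `i < r - 1` and `u_{r-1} ^ p + v ^ 2 = 0`; here `u_i`
is the variable `some i` and `v` is the variable `none`. -/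
def PrRelations : Set (MvPolynomial (Option (Fin r)) k) :=
  {f | ∃ i : Fin r, (i.1 + 1 < r ∧ f = MvPolynomial.X (some i) ^ p) ∨
    (i.1 + 1 = r ∧ f = MvPolynomial.X (some i) ^ p + MvPolynomial.X none ^ 2)}

/-- `ℙ_r = k[u_0, …, u_{r-1}, v] / (u_0 ^ p, …, u_{r-2} ^ p, u_{r-1} ^ p + v ^ 2)`. -/
def Pr : Type u := MvPolynomial (Option (Fin r)) k ⧸ Ideal.span (PrRelations k p r)

namespace Pr

instance : CommRing (Pr k p r) :=
  inferInstanceAs (CommRing (MvPolynomial (Option (Fin r)) k ⧸ Ideal.span (PrRelations k p r)))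
instance : Algebra k (Pr k p r) :=
  inferInstanceAs (Algebra k (MvPolynomial (Option (Fin r)) k ⧸ Ideal.span (PrRelations k p r)))

/-- The quotient map from the polynomial ring. -/
def mk : MvPolynomial (Option (Fin r)) k →ₐ[k] Pr k p r :=
  Ideal.Quotient.mkₐ k (Ideal.span (PrRelations k p r))

theorem mk_surjective : Function.Surjective (mk k p r) := Ideal.Quotient.mk_surjective

variable {r} in
/-- The even generator `u_i`. -/
def u (i : Fin r) : Pr k p r := mk k p r (MvPolynomial.X (some i))

/-- The odd generator `v`. -/
def v : Pr k p r := mk k p r (MvPolynomial.X none)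

theorem mk_rel {f : MvPolynomial (Option (Fin r)) k} (hf : f ∈ PrRelations k p r) :
    mk k p r f = 0 :=
  Ideal.Quotient.eq_zero_iff_mem.mpr (Ideal.subset_span hf)

variable {k p r}

theorem u_pow (i : Fin r) (hi : i.1 + 1 < r) : u k p i ^ p = 0 := by
  rw [u, ← map_pow]
  exact mk_rel k p r ⟨i, Or.inl ⟨hi, rfl⟩⟩

theorem u_pow_last (i : Fin r) (hi : i.1 + 1 = r) : u k p i ^ p + v k p r ^ 2 = 0 := by
  rw [u, v, ← map_pow, ← map_pow, ← map_add]
  exact mk_rel k p r ⟨i, Or.inr ⟨hi, rfl⟩⟩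

/-- The universal property of `ℙ_r`. -/
def lift {T : Type*} [Ring T] [Algebra k T] (x : Option (Fin r) → T)
    (hc : ∀ i j, x i * x j = x j * x i)
    (h₁ : ∀ i : Fin r, i.1 + 1 < r → x (some i) ^ p = 0)
    (h₂ : ∀ i : Fin r, i.1 + 1 = r → x (some i) ^ p + x none ^ 2 = 0) : Pr k p r →ₐ[k] T :=
  Ideal.Quotient.liftₐ (Ideal.span (PrRelations k p r)) (aevalComm x hc) (by
    intro f hf
    rw [← RingHom.mem_ker]
    refine (Ideal.span_le (I := RingHom.ker (aevalComm x hc))).mpr ?_ hf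
    rintro f ⟨i, ⟨hi, rfl⟩ | ⟨hi, rfl⟩⟩
    · simp [RingHom.mem_ker, aevalComm_X, h₁ i hi]
    · simp [RingHom.mem_ker, aevalComm_X, h₂ i hi])

theorem lift_u {T : Type*} [Ring T] [Algebra k T] (x : Option (Fin r) → T) (hc h₁ h₂)
    (i : Fin r) : lift (k := k) (p := p) x hc h₁ h₂ (u k p i) = x (some i) :=
  aevalComm_X x hc (some i)

theorem lift_v {T : Type*} [Ring T] [Algebra k T] (x : Option (Fin r) → T) (hc h₁ h₂) :
    lift (k := k) (p := p) x hc h₁ h₂ (v k p r) = x none :=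
  aevalComm_X x hc none

/-- A property of elements of `ℙ_r` can be checked on monomials, up to linear combination. -/
theorem induction {motive : Pr k p r → Prop} (one : motive 1)
    (mul_u : ∀ x (i : Fin r), motive x → motive (x * u k p i))
    (mul_v : ∀ x, motive x → motive (x * v k p r))
    (add : ∀ x y, motive x → motive y → motive (x + y))
    (smul : ∀ (c : k) x, motive x → motive (c • x)) (x : Pr k p r) : motive x := by
  obtain ⟨f, rfl⟩ := mk_surjective k p r x
  induction f using MvPolynomial.induction_on with
  | C a =>
    have : mk k p r (MvPolynomial.C a) = a • 1 := by
      rw [← MvPolynomial.algebraMap_eq, AlgHom.commutes, Algebra.algebraMap_eq_smul_one]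
    rw [this]
    exact smul _ _ one
  | add f g hf hg => rw [map_add]; exact add _ _ hf hg
  | mul_X f i hf =>
    rw [map_mul]
    cases i with
    | none => exact mul_v _ hf
    | some i => exact mul_u _ i hf

theorem algHom_ext {T : Type*} [Ring T] [Algebra k T] {f g : Pr k p r →ₐ[k] T}
    (hu : ∀ i, f (u k p i) = g (u k p i)) (hv : f (v k p r) = g (v k p r)) : f = g := by
  ext x
  induction x using induction with
  | one => simp
  | mul_u x i h => rw [map_mul, map_mul, h, hu]
  | mul_v x h => rw [map_mul, map_mul, h, hv]
  | add x y hx hy => rw [map_add, map_add, hx, hy]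
  | smul c x hx => rw [map_smul, map_smul, hx]

variable (k p r)

/-- The `ℤ/2`-grading on `ℙ_r`: the `u_i` are even and `v` is odd. -/
def parity (ε : ZMod 2) : Submodule k (Pr k p r) :=
  Submodule.span k {x | ∃ d : Option (Fin r) →₀ ℕ, ((d none : ℕ) : ZMod 2) = ε ∧
    x = mk k p r (MvPolynomial.monomial d 1)}

theorem u_mem (i : Fin r) : u k p i ∈ parity k p r 0 :=
  Submodule.subset_span ⟨Finsupp.single (some i) 1, by simp, rfl⟩

theorem v_mem : v k p r ∈ parity k p r 1 :=
  Submodule.subset_span ⟨Finsupp.single none 1, by simp, rfl⟩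

instance : SetLike.GradedMonoid (parity k p r) where
  one_mem := Submodule.subset_span ⟨0, by simp, by
    rw [MvPolynomial.monomial_zero', map_one, map_one]⟩
  mul_mem := by
    intro i j x y hx hy
    induction hx using Submodule.span_induction with
    | zero => rw [zero_mul]; exact zero_mem _
    | add s t _ _ hs ht => rw [add_mul]; exact add_mem hs ht
    | smul a s _ hs => rw [smul_mul_assoc]; exact Submodule.smul_mem _ _ hs
    | mem x hx =>
      induction hy using Submodule.span_induction with
      | zero => rw [mul_zero]; exact zero_mem _
      | add s t _ _ hs ht => rw [mul_add]; exact add_mem hs ht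
      | smul a s _ hs => rw [mul_smul_comm]; exact Submodule.smul_mem _ _ hs
      | mem y hy =>
        obtain ⟨d, hd, rfl⟩ := hx
        obtain ⟨e, he, rfl⟩ := hy
        refine Submodule.subset_span ⟨d + e, by rw [← hd, ← he]; simp, ?_⟩
        rw [← map_mul, MvPolynomial.monomial_mul, one_mul]

theorem of_eq {i j : ZMod 2} (x : parity k p r i) (y : parity k p r j) (hij : i = j)
    (hxy : (x : Pr k p r) = y) :
    DirectSum.of (fun i => parity k p r i) i x = DirectSum.of (fun i => parity k p r i) j y := by
  subst hij
  rw [Subtype.ext hxy]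

theorem of_pow {i j : ZMod 2} (x : parity k p r i) (n : ℕ) (h : (x : Pr k p r) ^ n ∈ parity k p r j)
    (hij : n • i = j) : DirectSum.of (fun i => parity k p r i) i x ^ n =
      DirectSum.of (fun i => parity k p r i) j ⟨_, h⟩ := by
  rw [DirectSum.ofPow]
  exact of_eq k p r _ _ hij rfl

/-- The map decomposing an element of `ℙ_r` into its even and odd part. -/
def decomposeHom : Pr k p r →ₐ[k] DirectSum (ZMod 2) fun i => parity k p r i :=
  lift (fun c => match c with
    | some i => DirectSum.of (fun i => parity k p r i) 0 ⟨u k p i, u_mem k p r i⟩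
    | none => DirectSum.of (fun i => parity k p r i) 1 ⟨v k p r, v_mem k p r⟩)
    (fun i j => mul_comm _ _)
    (fun i hi => by
      rw [DirectSum.ofPow, of_eq k p r (j := 0) _ 0 (by simp) (u_pow i hi), map_zero])
    (fun i hi => by
      have h0 : u k p i ^ p ∈ parity k p r 0 := by
        simpa using SetLike.pow_mem_graded p (u_mem k p r i)
      have h1 : v k p r ^ 2 ∈ parity k p r 0 := by
        have := SetLike.pow_mem_graded 2 (v_mem k p r)
        rwa [show (2 • (1 : ZMod 2)) = 0 by decide] at this
      refine (congrArg₂ (· + ·) (of_pow k p r _ p h0 (by simp)) (of_pow k p r _ 2 h1 (by decide))).trans ?_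
      change DirectSum.of (fun i => parity k p r i) 0 ⟨_, h0⟩ +
        DirectSum.of (fun i => parity k p r i) 0 ⟨_, h1⟩ = 0
      rw [← map_add]
      refine Eq.trans (congrArg _ (Subtype.ext ?_)) (map_zero _)
      exact u_pow_last i hi)

theorem decomposeHom_monomial (d : Option (Fin r) →₀ ℕ) :
    decomposeHom k p r (mk k p r (MvPolynomial.monomial d 1)) =
      DirectSum.of (fun i => parity k p r i) ((d none : ℕ) : ZMod 2)
        ⟨mk k p r (MvPolynomial.monomial d 1), Submodule.subset_span ⟨d, rfl, rfl⟩⟩ := by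
  induction d using Finsupp.induction_linear with
  | zero =>
    have : mk k p r (MvPolynomial.monomial 0 1) = 1 := by
      rw [MvPolynomial.monomial_zero', map_one, map_one]
    refine (congrArg _ this).trans ((map_one _).trans ?_)
    exact of_eq k p r _ _ (by simp) this.symm
  | add d e hd he =>
    have : mk k p r (MvPolynomial.monomial (d + e) 1) =
        mk k p r (MvPolynomial.monomial d 1) * mk k p r (MvPolynomial.monomial e 1) := by
      rw [← map_mul, MvPolynomial.monomial_mul, one_mul]
    refine (congrArg _ this).trans ?_
    rw [map_mul, hd, he, DirectSum.of_mul_of]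
    exact of_eq k p r _ _ (by simp) this.symm
  | single c n =>
    have : mk k p r (MvPolynomial.monomial (Finsupp.single c n) 1) =
        mk k p r (MvPolynomial.X c) ^ n := by
      rw [← map_pow, MvPolynomial.X_pow_eq_monomial]
    refine (congrArg _ this).trans ?_
    rw [map_pow]
    cases c with
    | none =>
      have h : decomposeHom k p r (mk k p r (MvPolynomial.X none)) = _ := lift_v _ _ _ _
      rw [h, DirectSum.ofPow]
      exact of_eq k p r _ _ (by simp) this.symm
    | some i =>
      have h : decomposeHom k p r (mk k p r (MvPolynomial.X (some i))) = _ := lift_u _ _ _ _ i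
      rw [h, DirectSum.ofPow]
      exact of_eq k p r _ _ (by simp) this.symm

instance : GradedAlgebra (parity k p r) :=
  GradedAlgebra.ofAlgHom (parity k p r) (decomposeHom k p r)
    (by
      apply algHom_ext
      · intro i
        rw [AlgHom.comp_apply, decomposeHom, lift_u]
        simp
      · rw [AlgHom.comp_apply, decomposeHom, lift_v]
        simp)
    (by
      rintro i ⟨x, hx⟩
      have hlin : ∀ x ∈ parity k p r i, ∃ h : x ∈ parity k p r i,
          decomposeHom k p r x = DirectSum.lof k _ (fun i => parity k p r i) i ⟨x, h⟩ := by
        intro x hx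
        induction hx using Submodule.span_induction with
        | zero => exact ⟨zero_mem _, by rw [map_zero]; exact (map_zero _).symm⟩
        | add s t _ _ hs ht =>
          obtain ⟨hs, hs'⟩ := hs
          obtain ⟨ht, ht'⟩ := ht
          exact ⟨add_mem hs ht, by rw [map_add, hs', ht', ← map_add]; rfl⟩
        | smul a s _ hs =>
          obtain ⟨hs, hs'⟩ := hs
          exact ⟨Submodule.smul_mem _ _ hs, by rw [map_smul, hs', ← map_smul]; rfl⟩
        | mem x hx =>
          obtain ⟨d, hd, rfl⟩ := hx
          exact ⟨Submodule.subset_span ⟨d, hd, rfl⟩, by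
            rw [decomposeHom_monomial]
            exact of_eq k p r _ _ hd rfl⟩
      exact (hlin x hx).choose_spec)


/-! ### The coproduct of `ℙ_r` -/

section Hopf

variable {k : Type u} [Field k] {p r : ℕ}

variable (k p r) in
/-- The elements `γ_ℓ = ∏ u_i ^ ℓ_i / ℓ_i !`, where `ℓ = ∑ ℓ_i p ^ i` with `0 ≤ ℓ_i < p`,
for `0 ≤ ℓ < p ^ r`. -/
def γ (l : ℕ) : Pr k p r :=
  ∏ i : Fin r, ((Nat.factorial (l / p ^ i.1 % p) : ℕ) : k)⁻¹ • u k p i ^ (l / p ^ i.1 % p)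

theorem γ_mem (l : ℕ) : γ k p r l ∈ parity k p r 0 := by
  rw [γ]
  refine Finset.prod_induction _ (· ∈ parity k p r 0) (fun a b ha hb => ?_) ?_ fun i _ => ?_
  · simpa using SetLike.mul_mem_graded ha hb
  · exact SetLike.one_mem_graded _
  · refine Submodule.smul_mem _ _ ?_
    simpa using SetLike.pow_mem_graded (l / p ^ i.1 % p) (u_mem k p r i)

theorem γ_zero : γ k p r 0 = 1 := by
  rw [γ]
  exact Finset.prod_eq_one fun i _ => by simp

theorem γ_pow_self (hp : 1 < p) (i : Fin r) : γ k p r (p ^ i.1) = u k p i := by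
  rw [γ, Finset.prod_eq_single i]
  · rw [Nat.div_self (by positivity), Nat.mod_eq_of_lt hp]
    simp
  · intro j _ hj
    have hj' : j.1 ≠ i.1 := fun h => hj (Fin.ext h)
    have : p ^ i.1 / p ^ j.1 % p = 0 := by
      rcases lt_or_gt_of_ne hj' with h | h
      · rw [Nat.pow_div h.le (by omega)]
        exact Nat.mod_eq_zero_of_dvd (dvd_pow_self p (by omega))
      · rw [Nat.div_eq_of_lt (Nat.pow_lt_pow_right hp h), Nat.zero_mod]
    rw [this]
    simp
  · simp

theorem γ_pow_p (hp : 1 < p) (l : ℕ) (h0 : l ≠ 0) (hl : l < p ^ (r - 1)) : γ k p r l ^ p = 0 := by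
  have h1 : Nat.log p l < r - 1 := Nat.log_lt_of_lt_pow h0 hl
  rw [γ, ← Finset.prod_pow]
  refine Finset.prod_eq_zero (Finset.mem_univ (⟨Nat.log p l, by omega⟩ : Fin r)) ?_
  have h2 : l / p ^ Nat.log p l % p ≠ 0 := by
    have h3 : l / p ^ Nat.log p l < p := by
      rw [Nat.div_lt_iff_lt_mul (by positivity), mul_comm, ← pow_succ]
      exact Nat.lt_pow_succ_log_self hp l
    rw [Nat.mod_eq_of_lt h3]
    exact (Nat.div_pos (Nat.pow_log_le_self p h0) (by positivity)).ne'
  rw [smul_pow, ← pow_mul, mul_comm, pow_mul, u_pow _ (show _ + 1 < r by simp; omega),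
    zero_pow h2, smul_zero]

variable (k p r) in
/-- The super tensor product `ℙ_r ⊗ ℙ_r`, with its signed multiplication. -/
abbrev Sq : Type u := parity k p r ᵍ⊗[k] parity k p r

theorem tmul_mul_of_even (a b x y : Pr k p r) (hb : b ∈ parity k p r 0) :
    (a ᵍ⊗ₜ[k] b * x ᵍ⊗ₜ[k] y : Sq k p r) = (a * x) ᵍ⊗ₜ[k] (b * y) := by
  induction x using DirectSum.Decomposition.inductionOn (parity k p r) with
  | zero => simp [GradedTensorProduct.tmul]
  | add s t hs ht =>
    simp only [GradedTensorProduct.tmul, TensorProduct.add_tmul, mul_add, map_add] at *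
    rw [hs, ht]
  | homogeneous x =>
    exact GradedTensorProduct.tmul_zero_coe_mul_coe_tmul _ _ a ⟨b, hb⟩ x y

theorem mul_tmul_of_even (a b x y : Pr k p r) (ha : a ∈ parity k p r 0) :
    (x ᵍ⊗ₜ[k] y * a ᵍ⊗ₜ[k] b : Sq k p r) = (x * a) ᵍ⊗ₜ[k] (y * b) := by
  induction y using DirectSum.Decomposition.inductionOn (parity k p r) with
  | zero => simp [GradedTensorProduct.tmul]
  | add s t hs ht =>
    simp only [GradedTensorProduct.tmul, TensorProduct.tmul_add, add_mul, map_add] at *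
    rw [hs, ht]
  | homogeneous y =>
    exact GradedTensorProduct.tmul_coe_mul_zero_coe_tmul _ _ x y ⟨a, ha⟩ b

theorem commute_even (a b : Pr k p r) (ha : a ∈ parity k p r 0) (hb : b ∈ parity k p r 0) (t : Sq k p r) :
    Commute (a ᵍ⊗ₜ[k] b : Sq k p r) t := by
  have : ∀ t : Pr k p r ⊗[k] Pr k p r,
      Commute (a ᵍ⊗ₜ[k] b : Sq k p r) (GradedTensorProduct.of k (parity k p r) (parity k p r) t) := by
    intro t
    induction t with
    | zero => simp
    | add s t hs ht => rw [map_add]; exact hs.add_right ht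
    | tmul x y =>
      rw [Commute, SemiconjBy, tmul_mul_of_even a b x y hb, mul_tmul_of_even a b x y ha,
        mul_comm a, mul_comm b]
  exact this t

theorem tmul_pow_of_even (a b : Pr k p r) (ha : a ∈ parity k p r 0) (_hb : b ∈ parity k p r 0)
    (n : ℕ) : (a ᵍ⊗ₜ[k] b : Sq k p r) ^ n = (a ^ n) ᵍ⊗ₜ[k] (b ^ n) := by
  induction n with
  | zero => simp only [pow_zero]; rfl
  | succ n ih => rw [pow_succ, ih, mul_tmul_of_even _ _ _ _ ha, pow_succ, pow_succ]

theorem sum_pow_of_commute {S ι : Type*} [Ring S] (hp : p.Prime) (hS : (p : S) = 0)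
    (s : Finset ι) (f : ι → S) (hf : ∀ i j, Commute (f i) (f j)) :
    (∑ i ∈ s, f i) ^ p = ∑ i ∈ s, f i ^ p := by
  classical
  induction s using Finset.induction_on with
  | empty => simp [hp.ne_zero]
  | insert i s hi ih =>
    rw [Finset.sum_insert hi, Finset.sum_insert hi, ← ih]
    obtain ⟨c, hc⟩ := (Commute.sum_right s f (f i) fun j _ => hf i j).exists_add_pow_prime_eq hp
    rw [hc, hS]
    simp

/-- The coproduct of the generators: `Δ(u_i) = ∑_{a + b = p ^ i} γ_a ⊗ γ_b`, `Δ(v) = v ⊗ 1 + 1 ⊗ v`. -/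
def comulGen : Option (Fin r) → Sq k p r
  | some i => ∑ c ∈ Finset.HasAntidiagonal.antidiagonal (p ^ i.1), γ k p r c.1 ᵍ⊗ₜ[k] γ k p r c.2
  | none => v k p r ᵍ⊗ₜ[k] 1 + 1 ᵍ⊗ₜ[k] v k p r

theorem commute_comulGen_some (i : Fin r) (t : Sq k p r) : Commute (comulGen (k := k) (p := p) (some i)) t :=
  Commute.sum_left _ _ _ fun _ _ => commute_even _ _ (γ_mem _) (γ_mem _) t

theorem comulGen_comm (c d : Option (Fin r)) :
    comulGen (k := k) (p := p) c * comulGen d = comulGen d * comulGen c := by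
  cases c with
  | some i => exact commute_comulGen_some i _
  | none =>
    cases d with
    | some i => exact (commute_comulGen_some i _).symm
    | none => rfl

theorem comulGen_some_pow [Fact p.Prime] [CharP k p] (i : Fin r) :
    comulGen (k := k) (p := p) (some i) ^ p =
      ∑ c ∈ Finset.HasAntidiagonal.antidiagonal (p ^ i.1), (γ k p r c.1 ^ p) ᵍ⊗ₜ[k] (γ k p r c.2 ^ p) := by
  have hS : ((p : ℕ) : Sq k p r) = 0 := by
    rw [← map_natCast (algebraMap k (Sq k p r)), CharP.cast_eq_zero, map_zero]
  rw [comulGen, sum_pow_of_commute Fact.out hS _ _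
    fun c d => commute_even _ _ (γ_mem _) (γ_mem _) _]
  exact Finset.sum_congr rfl fun c _ => tmul_pow_of_even _ _ (γ_mem _) (γ_mem _) p

theorem comulGen_pow [Fact p.Prime] [CharP k p] (i : Fin r) (hi : i.1 + 1 < r) :
    comulGen (k := k) (p := p) (some i) ^ p = 0 := by
  have hp : 1 < p := (Fact.out : p.Prime).one_lt
  have hlt : p ^ i.1 < p ^ (r - 1) := Nat.pow_lt_pow_right hp (by omega)
  have hpos : 0 < p ^ i.1 := by positivity
  rw [comulGen_some_pow]
  refine Finset.sum_eq_zero fun c hc => ?_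
  rw [Finset.HasAntidiagonal.mem_antidiagonal] at hc
  by_cases h : c.1 = 0
  · rw [γ_pow_p hp c.2 (by omega) (by omega)]
    simp [GradedTensorProduct.tmul]
  · rw [γ_pow_p hp c.1 h (by omega)]
    simp [GradedTensorProduct.tmul]

theorem comulGen_none_sq : comulGen (k := k) (p := p) (r := r) none ^ 2 =
    (v k p r ^ 2) ᵍ⊗ₜ[k] 1 + 1 ᵍ⊗ₜ[k] (v k p r ^ 2) := by
  have h1 : (1 : Pr k p r) ∈ parity k p r 0 := SetLike.one_mem_graded _
  have h : (1 ᵍ⊗ₜ[k] v k p r * v k p r ᵍ⊗ₜ[k] 1 : Sq k p r) = - (v k p r ᵍ⊗ₜ[k] v k p r) := by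
    have := GradedTensorProduct.tmul_coe_mul_coe_tmul (R := k) (parity k p r) (parity k p r)
      1 ⟨v k p r, v_mem k p r⟩ ⟨v k p r, v_mem k p r⟩ 1
    rw [one_mul, one_mul, mul_one] at this
    refine this.trans ?_
    rw [uzpow_one, Units.neg_smul, one_smul]
  rw [comulGen, pow_two, mul_add, add_mul, add_mul, h, mul_tmul_of_even _ _ _ _ h1,
    tmul_mul_of_even _ _ _ _ h1, mul_tmul_of_even _ _ _ _ h1, pow_two]
  simp

theorem comulGen_pow_last [Fact p.Prime] [CharP k p] (i : Fin r) (hi : i.1 + 1 = r) :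
    comulGen (k := k) (p := p) (some i) ^ p + comulGen none ^ 2 = 0 := by
  have hp : 1 < p := (Fact.out : p.Prime).one_lt
  have hpos : 0 < p ^ i.1 := by positivity
  have hi' : i.1 = r - 1 := by omega
  have huv : u k p i ^ p = - v k p r ^ 2 := eq_neg_of_add_eq_zero_left (u_pow_last i hi)
  rw [comulGen_some_pow, comulGen_none_sq,
    Finset.sum_eq_add_of_mem (p ^ i.1, 0) (0, p ^ i.1) (by simp) (by simp) (by simp; omega)]
  · rw [γ_zero, γ_pow_self hp, huv, one_pow]
    simp only [GradedTensorProduct.tmul, TensorProduct.neg_tmul, TensorProduct.tmul_neg, map_neg]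
    abel
  · intro c hc hne
    rw [Finset.HasAntidiagonal.mem_antidiagonal] at hc
    have h0 : c.1 ≠ 0 := fun h => hne.2 (Prod.ext h (by simpa [h] using hc))
    have h0' : c.2 ≠ 0 := fun h => hne.1 (Prod.ext (by simpa [h] using hc) h)
    rw [γ_pow_p hp c.1 h0 (by rw [← hi']; omega)]
    simp [GradedTensorProduct.tmul]

variable (k p r) in
/-- The counit, with `u_i ↦ 0` and `v ↦ 0`. -/
def counitAlgHom [Fact p.Prime] : Pr k p r →ₐ[k] k :=
  lift (fun _ => 0) (fun _ _ => rfl) (fun _ _ => zero_pow (Fact.out : p.Prime).ne_zero)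
    (fun _ _ => by rw [zero_pow (Fact.out : p.Prime).ne_zero, zero_pow two_ne_zero, add_zero])

variable [Fact p.Prime] [CharP k p]

variable (k p r) in
/-- The coproduct, a homomorphism to the super tensor product with its signed multiplication. -/
def comulAlgHom : Pr k p r →ₐ[k] Sq k p r :=
  lift comulGen comulGen_comm comulGen_pow comulGen_pow_last

instance : CoalgebraStruct k (Pr k p r) where
  comul := (GradedTensorProduct.of k (parity k p r) (parity k p r)).symm.toLinearMap ∘ₗ
    (comulAlgHom k p r).toLinearMap
  counit := (counitAlgHom k p r).toLinearMap

end Hopf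

variable (k : Type u) [Field k] (p r : ℕ) in
/-- The map `ι : ℙ_1 → ℙ_r` with `u ↦ u_{r-1}` and `v ↦ v`. -/
def ι [NeZero r] : Pr k p 1 →ₐ[k] Pr k p r :=
  lift (fun c => match c with
    | some _ => u k p (⟨r - 1, Nat.sub_lt (Nat.pos_of_ne_zero (NeZero.ne r)) one_pos⟩)
    | none => v k p r)
    (fun _ _ => mul_comm _ _)
    (fun i hi => absurd i.2 (by omega))
    (fun i hi => u_pow_last _ (Nat.succ_pred_eq_of_ne_zero (NeZero.ne r)))

/-! ### The scaling maps -/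

section Scale

variable {k : Type u} [Field k] {p r : ℕ} {C : Type u} [CommRing C] [Algebra k C]

/-- The algebra map `φ_{μ, a}` with `v ↦ μ v` and `u_i ↦ a ^ (p ^ i) u_i`. -/
def scaleAlgHom (μ a : C) (h : a ^ p ^ r = μ ^ 2) : Pr k p r →ₐ[k] C ⊗[k] Pr k p r :=
  lift (fun c => match c with
    | some i => (a ^ p ^ i.1) ⊗ₜ u k p i
    | none => μ ⊗ₜ v k p r)
    (fun _ _ => mul_comm _ _)
    (fun i hi => by
      rw [Algebra.TensorProduct.tmul_pow, u_pow i hi, TensorProduct.tmul_zero])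
    (fun i hi => by
      rw [Algebra.TensorProduct.tmul_pow, Algebra.TensorProduct.tmul_pow, ← pow_mul, ← pow_succ,
        hi, h, ← TensorProduct.tmul_add, u_pow_last i hi, TensorProduct.tmul_zero])

theorem scaleAlgHom_u (μ a : C) (h : a ^ p ^ r = μ ^ 2) (i : Fin r) :
    scaleAlgHom (k := k) μ a h (u k p i) = (a ^ p ^ i.1) ⊗ₜ u k p i :=
  lift_u _ _ _ _ i

theorem scaleAlgHom_v (μ a : C) (h : a ^ p ^ r = μ ^ 2) :
    scaleAlgHom (k := k) μ a h (v k p r) = μ ⊗ₜ v k p r :=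
  lift_v _ _ _ _

theorem sum_digits (p r l : ℕ) (hl : l < p ^ r) :
    ∑ i : Fin r, p ^ i.1 * (l / p ^ i.1 % p) = l := by
  rw [Fin.sum_univ_eq_sum_range (fun i => p ^ i * (l / p ^ i % p))]
  have : ∀ n, ∑ i ∈ Finset.range n, p ^ i * (l / p ^ i % p) = l % p ^ n := by
    intro n
    induction n with
    | zero => simp [Nat.mod_one]
    | succ n ih => rw [Finset.sum_range_succ, ih, Nat.mod_pow_succ]
  rw [this, Nat.mod_eq_of_lt hl]

theorem scaleAlgHom_γ (μ a : C) (h : a ^ p ^ r = μ ^ 2) (l : ℕ) (hl : l < p ^ r) :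
    scaleAlgHom (k := k) μ a h (γ k p r l) = (a ^ l) ⊗ₜ γ k p r l := by
  have key : ∀ (s : Finset (Fin r)) (f : Fin r → C) (g : Fin r → Pr k p r),
      ∏ i ∈ s, (f i) ⊗ₜ[k] (g i) = (∏ i ∈ s, f i) ⊗ₜ[k] (∏ i ∈ s, g i) := by
    classical
    intro s f g
    induction s using Finset.induction_on with
    | empty => rfl
    | insert i s hi ih =>
      rw [Finset.prod_insert hi, Finset.prod_insert hi, Finset.prod_insert hi, ih,
        Algebra.TensorProduct.tmul_mul_tmul]
  conv_rhs => rw [← sum_digits p r l hl, ← Finset.prod_pow_eq_pow_sum]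
  rw [sum_digits p r l hl, γ, ← key, map_prod]
  refine Finset.prod_congr rfl fun i _ => ?_
  rw [map_smul, map_pow, scaleAlgHom_u, Algebra.TensorProduct.tmul_pow, ← pow_mul,
    TensorProduct.tmul_smul]

theorem scaleAlgHom_parity (μ a : C) (h : a ^ p ^ r = μ ^ 2) (i : ZMod 2) (x : Pr k p r)
    (hx : x ∈ parity k p r i) : scaleAlgHom μ a h x ∈ (parity k p r i).baseChange C := by
  have key : ∀ d : Option (Fin r) →₀ ℕ, ∃ c : C,
      scaleAlgHom μ a h (mk k p r (MvPolynomial.monomial d 1)) =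
        c ⊗ₜ mk k p r (MvPolynomial.monomial d 1) := by
    intro d
    induction d using Finsupp.induction_linear with
    | zero =>
      have : mk k p r (MvPolynomial.monomial 0 1) = 1 := by
        rw [MvPolynomial.monomial_zero', map_one, map_one]
      exact ⟨1, by rw [this, map_one]; rfl⟩
    | add d e hd he =>
      have : mk k p r (MvPolynomial.monomial (d + e) 1) =
          mk k p r (MvPolynomial.monomial d 1) * mk k p r (MvPolynomial.monomial e 1) := by
        rw [← map_mul, MvPolynomial.monomial_mul, one_mul]
      obtain ⟨b, hb⟩ := hd
      obtain ⟨c, hc⟩ := he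
      exact ⟨b * c, by rw [this, map_mul, hb, hc, Algebra.TensorProduct.tmul_mul_tmul]⟩
    | single c n =>
      have : mk k p r (MvPolynomial.monomial (Finsupp.single c n) 1) =
          mk k p r (MvPolynomial.X c) ^ n := by
        rw [← map_pow, MvPolynomial.X_pow_eq_monomial]
      rw [this, map_pow]
      cases c with
      | none =>
        refine ⟨μ ^ n, ?_⟩
        have h : scaleAlgHom μ a h (mk k p r (MvPolynomial.X none)) = _ := scaleAlgHom_v _ _ _
        rw [h, Algebra.TensorProduct.tmul_pow]
        rfl
      | some i =>
        refine ⟨(a ^ p ^ i.1) ^ n, ?_⟩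
        have h : scaleAlgHom μ a h (mk k p r (MvPolynomial.X (some i))) = _ :=
          scaleAlgHom_u _ _ _ i
        rw [h, Algebra.TensorProduct.tmul_pow]
        rfl
  induction hx using Submodule.span_induction with
  | zero => simp
  | add s t _ _ hs ht => rw [map_add]; exact add_mem hs ht
  | smul c s _ hs => rw [map_smul]; exact Submodule.smul_of_tower_mem _ c hs
  | mem x hx =>
    obtain ⟨d, hd, rfl⟩ := hx
    obtain ⟨c, hc⟩ := key d
    rw [hc]
    exact Submodule.tmul_mem_baseChange_of_mem c (Submodule.subset_span ⟨d, hd, rfl⟩)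

/-- `φ_{μ, a}` followed by `x ↦ x ⊗ 1`. -/
def scaleLeft (μ a : C) (h : a ^ p ^ r = μ ^ 2) : Pr k p r →ₐ[k] C ⊗[k] Sq k p r :=
  (Algebra.TensorProduct.map (AlgHom.id k C)
    (GradedTensorProduct.includeLeft (parity k p r) (parity k p r))).comp (scaleAlgHom μ a h)

/-- `φ_{μ, a}` followed by `x ↦ 1 ⊗ x`. -/
def scaleRight (μ a : C) (h : a ^ p ^ r = μ ^ 2) : Pr k p r →ₐ[k] C ⊗[k] Sq k p r :=
  (Algebra.TensorProduct.map (AlgHom.id k C)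
    (GradedTensorProduct.includeRight (parity k p r) (parity k p r))).comp (scaleAlgHom μ a h)

@[elab_as_elim]
theorem baseChange_induction {Y : Type u} [AddCommGroup Y] [Module k Y] (N : Submodule k Y)
    {P : C ⊗[k] Y → Prop} (tmul : ∀ (c : C) (y : Y), y ∈ N → P (c ⊗ₜ y))
    (add : ∀ s t, P s → P t → P (s + t)) (z : C ⊗[k] Y) (hz : z ∈ N.baseChange C) : P z := by
  obtain ⟨w, rfl⟩ : ∃ w : C ⊗[k] N, N.subtype.lTensor C w = z := hz
  induction w with
  | zero => rw [map_zero, ← TensorProduct.tmul_zero Y (0 : C)]; exact tmul _ _ (zero_mem _)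
  | add s t hs ht => rw [map_add]; exact add _ _ hs ht
  | tmul c y => exact tmul c y y.2

theorem scale_anticomm (i j : ZMod 2) (s t : C ⊗[k] Pr k p r)
    (hs : s ∈ (parity k p r i).baseChange C) (ht : t ∈ (parity k p r j).baseChange C) :
    Algebra.TensorProduct.map (AlgHom.id k C)
        (GradedTensorProduct.includeLeft (parity k p r) (parity k p r)) s *
      Algebra.TensorProduct.map (AlgHom.id k C)
        (GradedTensorProduct.includeRight (parity k p r) (parity k p r)) t =
    (-1 : ℤˣ) ^ (j * i) • (Algebra.TensorProduct.map (AlgHom.id k C)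
        (GradedTensorProduct.includeRight (parity k p r) (parity k p r)) t *
      Algebra.TensorProduct.map (AlgHom.id k C)
        (GradedTensorProduct.includeLeft (parity k p r) (parity k p r)) s) := by
  refine baseChange_induction _ (fun c x hx => ?_) (fun s s' hs hs' => ?_) s hs
  swap
  · rw [map_add, add_mul, mul_add, smul_add, hs, hs']
  refine baseChange_induction _ (fun d y hy => ?_) (fun t t' ht ht' => ?_) t ht
  swap
  · rw [map_add, add_mul, mul_add, smul_add, ht, ht']
  have h1 := GradedTensorProduct.tmul_coe_mul_coe_tmul (R := k) (parity k p r) (parity k p r)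
    1 ⟨y, hy⟩ ⟨x, hx⟩ 1
  have h2 := GradedTensorProduct.tmul_one_mul_one_tmul (R := k) (parity k p r) (parity k p r)
    x y
  change (c ⊗ₜ[k] (x ᵍ⊗ₜ[k] (1 : Pr k p r) : Sq k p r)) *
      (d ⊗ₜ[k] ((1 : Pr k p r) ᵍ⊗ₜ[k] y : Sq k p r)) =
    (-1 : ℤˣ) ^ (j * i) • ((d ⊗ₜ[k] ((1 : Pr k p r) ᵍ⊗ₜ[k] y : Sq k p r)) *
      (c ⊗ₜ[k] (x ᵍ⊗ₜ[k] (1 : Pr k p r) : Sq k p r)))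
  rw [Algebra.TensorProduct.tmul_mul_tmul, Algebra.TensorProduct.tmul_mul_tmul, h2]
  rw [one_mul, mul_one] at h1
  rw [h1, mul_comm d c]
  rcases Int.units_eq_one_or ((-1 : ℤˣ) ^ (j * i)) with h | h <;> rw [h] <;>
    simp [Units.neg_smul, TensorProduct.tmul_neg]

/-- The map `x ⊗ y ↦ φ(x) ⊗ φ(y)`. -/
def scaleSq (μ a : C) (h : a ^ p ^ r = μ ^ 2) : Sq k p r →ₐ[k] C ⊗[k] Sq k p r :=
  GradedTensorProduct.lift (parity k p r) (parity k p r) (scaleLeft μ a h) (scaleRight μ a h)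
    (fun i j x y => scale_anticomm i j _ _ (scaleAlgHom_parity (k := k) μ a h i x x.2)
      (scaleAlgHom_parity (k := k) μ a h j y y.2))

theorem scaleSq_tmul (μ a : C) (h : a ^ p ^ r = μ ^ 2) (x y : Pr k p r) (c d : C)
    (hx : scaleAlgHom μ a h x = c ⊗ₜ x) (hy : scaleAlgHom μ a h y = d ⊗ₜ y) :
    scaleSq μ a h (x ᵍ⊗ₜ[k] y : Sq k p r) = (c * d) ⊗ₜ[k] (x ᵍ⊗ₜ[k] y : Sq k p r) := by
  change scaleLeft μ a h x * scaleRight μ a h y = _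
  rw [scaleLeft, scaleRight, AlgHom.comp_apply,
    AlgHom.comp_apply, hx, hy]
  change (c ⊗ₜ[k] (x ᵍ⊗ₜ[k] (1 : Pr k p r) : Sq k p r)) *
          (d ⊗ₜ[k] ((1 : Pr k p r) ᵍ⊗ₜ[k] y : Sq k p r)) = _
  rw [Algebra.TensorProduct.tmul_mul_tmul, GradedTensorProduct.tmul_one_mul_one_tmul]

theorem scaleSq_of (μ a : C) (h : a ^ p ^ r = μ ^ 2) (t : Pr k p r ⊗[k] Pr k p r) :
    scaleSq μ a h (GradedTensorProduct.of k (parity k p r) (parity k p r) t) =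
      (GradedTensorProduct.of k (parity k p r) (parity k p r)).toLinearMap.lTensor C
        (HopfHom.flat C (Pr k p r) (TensorProduct.map (scaleAlgHom μ a h).toLinearMap
          (scaleAlgHom μ a h).toLinearMap t)) := by
  induction t with
  | zero => simp
  | add s t hs ht => simp only [map_add, hs, ht]
  | tmul x y =>
    refine (GradedTensorProduct.lift_tmul (parity k p r) (parity k p r) (scaleLeft μ a h)
      (scaleRight μ a h) _ x y).trans ?_
    rw [TensorProduct.map_tmul, scaleLeft, scaleRight, AlgHom.comp_apply,
      AlgHom.comp_apply, AlgHom.toLinearMap_apply, AlgHom.toLinearMap_apply]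
    generalize scaleAlgHom μ a h x = s
    generalize scaleAlgHom μ a h y = t
    induction s with
    | zero => simp
    | add s s' hs hs' => simp only [map_add, add_mul, TensorProduct.add_tmul, hs, hs']
    | tmul c x =>
      induction t with
      | zero => simp
      | add s s' hs hs' => simp only [map_add, mul_add, TensorProduct.tmul_add, hs, hs']
      | tmul d y =>
        change (c ⊗ₜ[k] (x ᵍ⊗ₜ[k] (1 : Pr k p r) : Sq k p r)) *
          (d ⊗ₜ[k] ((1 : Pr k p r) ᵍ⊗ₜ[k] y : Sq k p r)) = (c * d) ⊗ₜ[k] (x ᵍ⊗ₜ[k] y : Sq k p r)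
        rw [Algebra.TensorProduct.tmul_mul_tmul, GradedTensorProduct.tmul_one_mul_one_tmul]

variable [Fact p.Prime] [CharP k p]

theorem scale_comulAlgHom (μ a : C) (h : a ^ p ^ r = μ ^ 2) :
    (Algebra.TensorProduct.map (AlgHom.id k C) (comulAlgHom k p r)).comp (scaleAlgHom μ a h) =
      (scaleSq μ a h).comp (comulAlgHom k p r) := by
  have hp : 1 < p := (Fact.out : p.Prime).one_lt
  have hu : ∀ i : Fin r, comulAlgHom k p r (u k p i) = comulGen (some i) := lift_u _ _ _ _
  have hv : comulAlgHom k p r (v k p r) = comulGen none := lift_v _ _ _ _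
  apply algHom_ext
  · intro i
    rw [AlgHom.comp_apply, AlgHom.comp_apply, scaleAlgHom_u, hu, Algebra.TensorProduct.map_tmul,
      hu, comulGen, map_sum, TensorProduct.tmul_sum]
    refine Finset.sum_congr rfl fun c hc => ?_
    rw [Finset.HasAntidiagonal.mem_antidiagonal] at hc
    have hi : p ^ i.1 < p ^ r := Nat.pow_lt_pow_right hp i.2
    rw [scaleSq_tmul μ a h _ _ _ _ (scaleAlgHom_γ μ a h c.1 (by omega))
      (scaleAlgHom_γ μ a h c.2 (by omega)), ← pow_add, hc]
    rfl
  · rw [AlgHom.comp_apply, AlgHom.comp_apply, scaleAlgHom_v, hv, Algebra.TensorProduct.map_tmul,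
      hv, comulGen, map_add, TensorProduct.tmul_add,
      scaleSq_tmul μ a h _ _ _ 1 (scaleAlgHom_v μ a h) (map_one _),
      scaleSq_tmul μ a h _ _ 1 _ (map_one _) (scaleAlgHom_v μ a h), one_mul, mul_one]
    rfl

/-- The endomorphism `φ_{μ, a}` of the Hopf superalgebra `C ⊗ ℙ_r`, for `a ^ (p ^ r) = μ ^ 2`,
with `v ↦ μ v` and `u_i ↦ a ^ (p ^ i) u_i`. -/
def scale (μ a : C) (h : a ^ p ^ r = μ ^ 2) : HopfHom C (parity k p r) (parity k p r) :=
  HopfHom.ofAlgHom (scaleAlgHom μ a h) (scaleAlgHom_parity μ a h)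
    (fun x => by
      have : ((Algebra.TensorProduct.rid k k C).toAlgHom.comp
          (Algebra.TensorProduct.map (AlgHom.id k C) (counitAlgHom k p r))).comp
          (scaleAlgHom μ a h) = (Algebra.ofId k C).comp (counitAlgHom k p r) := by
        have hu : ∀ i : Fin r, counitAlgHom k p r (u k p i) = 0 := lift_u _ _ _ _
        have hv : counitAlgHom k p r (v k p r) = 0 := lift_v _ _ _ _
        apply algHom_ext
        · intro i
          simp [scaleAlgHom_u, hu]
        · simp [scaleAlgHom_v, hv]
      exact DFunLike.congr_fun this x)
    (fun x => by
      have h1 := DFunLike.congr_fun (scale_comulAlgHom (k := k) μ a h) x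
      have h2 := scaleSq_of μ a h (Coalgebra.comul (R := k) x)
      have hinj : Function.Injective ((GradedTensorProduct.of k (parity k p r)
        (parity k p r)).toLinearMap.lTensor C) :=
        ((GradedTensorProduct.of k (parity k p r) (parity k p r)).lTensor C).injective
      exact hinj (Eq.trans (by
        rw [← LinearMap.comp_apply, ← LinearMap.lTensor_comp]; rfl) (h1.trans h2)))

end Scale

theorem ι_mem {k : Type u} [Field k] {p r : ℕ} [NeZero r] (i : ZMod 2) (x : Pr k p 1)
    (hx : x ∈ parity k p 1 i) : ι k p r x ∈ parity k p r i := by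
  have key : ∀ d : Option (Fin 1) →₀ ℕ,
      ι k p r (mk k p 1 (MvPolynomial.monomial d 1)) ∈ parity k p r ((d none : ℕ) : ZMod 2) := by
    intro d
    induction d using Finsupp.induction_linear with
    | zero =>
      have : mk k p 1 (MvPolynomial.monomial 0 1) = 1 := by
        rw [MvPolynomial.monomial_zero', map_one, map_one]
      rw [this, map_one]
      exact SetLike.one_mem_graded (parity k p r)
    | add d e hd he =>
      have : mk k p 1 (MvPolynomial.monomial (d + e) 1) =
          mk k p 1 (MvPolynomial.monomial d 1) * mk k p 1 (MvPolynomial.monomial e 1) := by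
        rw [← map_mul, MvPolynomial.monomial_mul, one_mul]
      rw [this, map_mul, Finsupp.add_apply, Nat.cast_add]
      exact SetLike.mul_mem_graded hd he
    | single c n =>
      have : mk k p 1 (MvPolynomial.monomial (Finsupp.single c n) 1) =
          mk k p 1 (MvPolynomial.X c) ^ n := by
        rw [← map_pow, MvPolynomial.X_pow_eq_monomial]
      rw [this, map_pow]
      cases c with
      | none =>
        have h : ι k p r (mk k p 1 (MvPolynomial.X none)) = v k p r := lift_v _ _ _ _
        rw [h]
        simpa using SetLike.pow_mem_graded n (v_mem k p r)
      | some i =>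
        have h : ι k p r (mk k p 1 (MvPolynomial.X (some i))) = _ := lift_u _ _ _ _ i
        rw [h]
        simpa using SetLike.pow_mem_graded n (u_mem k p r _)
  induction hx using Submodule.span_induction with
  | zero => rw [map_zero]; exact zero_mem _
  | add s t _ _ hs ht => rw [map_add]; exact add_mem hs ht
  | smul c s _ hs => rw [map_smul]; exact Submodule.smul_mem _ c hs
  | mem x hx =>
    obtain ⟨d, rfl, rfl⟩ := hx
    exact key d

end Pr
end Pr

/-! ### Supermodules and projective dimension -/

section Modules

/-- A supermodule over a `K`-superalgebra `S` (with even and odd part `𝒮 0` and `𝒮 1`): a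
superspace `V` with an even action of `S`. -/
structure SuperModule (K : Type u) [Field K] {S : Type u} [Ring S] [Algebra K S]
    (𝒮 : ZMod 2 → Submodule K S) where
  V : Type u
  [addCommGroup : AddCommGroup V]
  [module : Module K V]
  /-- the even and the odd part of `V` -/
  grade : ZMod 2 → Submodule K V
  isCompl : IsCompl (grade 0) (grade 1)
  act : S →ₐ[K] Module.End K V
  act_mem : ∀ (i j : ZMod 2) (s : S) (x : V), s ∈ 𝒮 i → x ∈ grade j → act s x ∈ grade (i + j)

namespace SuperModule

attribute [instance] addCommGroup module

variable {K : Type u} [Field K] {S S' : Type u} [Ring S] [Algebra K S] [Ring S'] [Algebra K S']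
  {𝒮 : ZMod 2 → Submodule K S} {𝒮' : ZMod 2 → Submodule K S'}

/-- The even homomorphisms of supermodules. -/
structure Hom (M N : SuperModule K 𝒮) where
  toLinearMap : M.V →ₗ[K] N.V
  map_grade : ∀ (i : ZMod 2) (x : M.V), x ∈ M.grade i → toLinearMap x ∈ N.grade i
  map_act : ∀ (s : S) (x : M.V), toLinearMap (M.act s x) = N.act s (toLinearMap x)

/-- `P` is a projective object of the category of supermodules and even homomorphisms. -/
def IsProjective (P : SuperModule K 𝒮) : Prop :=
  ∀ (M N : SuperModule K 𝒮) (g : Hom M N) (h : Hom P N), Function.Surjective g.toLinearMap →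
    ∃ l : Hom P M, ∀ x, g.toLinearMap (l.toLinearMap x) = h.toLinearMap x

/-- `ProjDimLE n M` says that `M` has a projective resolution `0 → P_n → ⋯ → P_0 → M → 0` of
length at most `n` in the category of supermodules and even homomorphisms. -/
def ProjDimLE : ℕ → SuperModule K 𝒮 → Prop
  | 0, M => M.IsProjective
  | n + 1, M => ∃ (N P : SuperModule K 𝒮) (i : Hom N P) (q : Hom P M),
      P.IsProjective ∧ Function.Injective i.toLinearMap ∧
      Function.Exact i.toLinearMap q.toLinearMap ∧ Function.Surjective q.toLinearMap ∧
      ProjDimLE n N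

/-- The projective dimension of `M` in the category of supermodules and even homomorphisms. -/
def projDim (M : SuperModule K 𝒮) : ℕ∞ := ⨅ (n : ℕ) (_ : ProjDimLE n M), (n : ℕ∞)

/-- The pullback of a supermodule along an even homomorphism of superalgebras. -/
def restrict (φ : S →ₐ[K] S') (hφ : ∀ (i : ZMod 2) (s : S), s ∈ 𝒮 i → φ s ∈ 𝒮' i)
    (M : SuperModule K 𝒮') : SuperModule K 𝒮 where
  V := M.V
  grade := M.grade
  isCompl := M.isCompl
  act := M.act.comp φ
  act_mem := fun i j s x hs hx => M.act_mem i j (φ s) x (hφ i s hs) hx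

theorem isCompl_baseChange (L : Type u) [Field L] [Algebra K L] {V : Type u} [AddCommGroup V]
    [Module K V] (N N' : Submodule K V) (h : IsCompl N N') :
    IsCompl (N.baseChange L) (N'.baseChange L) := by
  constructor
  · rw [Submodule.disjoint_def]
    intro z hz hz'
    let π : V →ₗ[K] V := N.subtype ∘ₗ Submodule.projectionOnto N N' h
    have h1 : π.lTensor L z = z := by
      refine Pr.baseChange_induction (P := fun z => π.lTensor L z = z) N (fun c y hy => ?_)
        (fun s t hs ht => by rw [map_add, hs, ht]) z hz
      rw [LinearMap.lTensor_tmul]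
      congr 1
      exact congrArg Subtype.val (Submodule.projectionOnto_apply_left h ⟨y, hy⟩)
    have h2 : π.lTensor L z = 0 := by
      refine Pr.baseChange_induction (P := fun z => π.lTensor L z = 0) N' (fun c y hy => ?_)
        (fun s t hs ht => by rw [map_add, hs, ht, add_zero]) z hz'
      rw [LinearMap.lTensor_tmul]
      have : π y = 0 :=
        congrArg Subtype.val ((Submodule.projectionOnto_apply_eq_zero_iff h).mpr hy)
      rw [this, TensorProduct.tmul_zero]
    rw [← h1, h2]
  · rw [codisjoint_iff, eq_top_iff]
    intro z _
    induction z with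
    | zero => exact zero_mem _
    | add s t hs ht => exact add_mem (hs trivial) (ht trivial)
    | tmul c x =>
      have hx : x ∈ N ⊔ N' := by rw [h.sup_eq_top]; trivial
      obtain ⟨y, hy, y', hy', rfl⟩ := Submodule.mem_sup.mp hx
      rw [TensorProduct.tmul_add]
      exact Submodule.add_mem_sup (Submodule.tmul_mem_baseChange_of_mem c hy)
        (Submodule.tmul_mem_baseChange_of_mem c hy')

/-- The action of `L ⊗ S` on `L ⊗ M`, with `(a ⊗ s) (b ⊗ x) = a b ⊗ s x`. -/
def baseChangeAct (L : Type u) [Field L] [Algebra K L] (M : SuperModule K 𝒮) :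
    L ⊗[K] S →ₐ[L] Module.End L (L ⊗[K] M.V) :=
  Algebra.TensorProduct.lift (Algebra.ofId L _) ((Module.End.baseChangeHom K L M.V).comp M.act)
    (fun a s => by rw [Algebra.ofId_apply]; exact Algebra.commute_algebraMap_left a _)

theorem baseChangeAct_tmul (L : Type u) [Field L] [Algebra K L] (M : SuperModule K 𝒮)
    (a b : L) (s : S) (x : M.V) :
    M.baseChangeAct L (a ⊗ₜ s) (b ⊗ₜ x) = (a * b) ⊗ₜ M.act s x := by
  rw [baseChangeAct, Algebra.TensorProduct.lift_tmul, Module.End.mul_apply, Algebra.ofId_apply,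
    Module.algebraMap_end_apply, ← smul_eq_mul, ← TensorProduct.smul_tmul']
  rfl

/-- The extension of scalars of a supermodule along a field extension. -/
def baseChange (L : Type u) [Field L] [Algebra K L] (M : SuperModule K 𝒮) :
    SuperModule L (fun i => (𝒮 i).baseChange L) where
  V := L ⊗[K] M.V
  grade := fun i => (M.grade i).baseChange L
  isCompl := isCompl_baseChange L _ _ M.isCompl
  act := M.baseChangeAct L
  act_mem := fun i j t z ht hz => by
    refine Pr.baseChange_induction
      (P := fun t => M.baseChangeAct L t z ∈ (M.grade (i + j)).baseChange L) (𝒮 i)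
      (fun a s hs => ?_) (fun s t hs ht => ?_) t ht
    · refine Pr.baseChange_induction
        (P := fun z => M.baseChangeAct L (a ⊗ₜ s) z ∈ (M.grade (i + j)).baseChange L) (M.grade j)
        (fun b x hx => ?_) (fun s t hs ht => ?_) z hz
      · rw [baseChangeAct_tmul]
        exact Submodule.tmul_mem_baseChange_of_mem _ (M.act_mem i j s x hs hx)
      · rw [map_add]
        exact add_mem hs ht
    · rw [map_add, LinearMap.add_apply]
      exact add_mem hs ht

end SuperModule
end Modules

/-! ### Homomorphisms of finite supergroup schemes -/

namespace FiniteSupergroupScheme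

variable {k : Type u} [Field k]

/-- A homomorphism `H → G` of finite supergroup schemes, given by its comorphism `k[G] → k[H]`. -/
structure Hom (H G : FiniteSupergroupScheme k) where
  comorphism : G.coord →ₐc[k] H.coord
  map_parity : ∀ (i : ZMod 2) (a : G.coord), a ∈ G.parity i → comorphism a ∈ H.parity i

namespace Hom

variable {H G : FiniteSupergroupScheme k} (f : Hom H G)

/-- A closed embedding is a homomorphism whose comorphism is surjective. -/
def IsClosedEmbedding : Prop := Function.Surjective f.comorphism

open SuperSupport.FiniteSupergroupScheme.GroupAlgebra

/-- The map of group algebras as a linear map. -/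
def groupAlgebraLinear : H.GroupAlgebra →ₗ[k] G.GroupAlgebra :=
  toDual.symm.toLinearMap ∘ₗ (f.comorphism : G.coord →ₗ[k] H.coord).dualMap ∘ₗ toDual.toLinearMap

theorem proj_comorphism (a : G.coord) :
    GradedAlgebra.proj H.parity 1 (f.comorphism a) =
      f.comorphism (GradedAlgebra.proj G.parity 1 a) := by
  induction a using DirectSum.Decomposition.inductionOn G.parity with
  | zero => simp
  | homogeneous b =>
    rw [proj_of_mem (f.map_parity _ _ b.2), proj_of_mem b.2]
    split_ifs <;> simp
  | add b c hb hc => simp only [map_add, hb, hc]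

theorem sign_comorphism (t : G.coord ⊗[k] G.coord) :
    H.sign (TensorProduct.map (f.comorphism : G.coord →ₗ[k] H.coord)
      (f.comorphism : G.coord →ₗ[k] H.coord) t) =
    TensorProduct.map (f.comorphism : G.coord →ₗ[k] H.coord)
      (f.comorphism : G.coord →ₗ[k] H.coord) (G.sign t) := by
  induction t with
  | zero => simp
  | add s t hs ht => simp only [map_add, hs, ht]
  | tmul a b =>
    have h := f.proj_comorphism
    simp [koszulSign, h]

theorem groupAlgebraLinear_mul (x y : H.GroupAlgebra) :
    f.groupAlgebraLinear (x * y) = f.groupAlgebraLinear x * f.groupAlgebraLinear y := by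
  apply toDual.injective
  ext a
  change TensorProduct.dualDistrib k H.coord H.coord (toDual x ⊗ₜ[k] toDual y)
      (H.sign (Coalgebra.comul (f.comorphism a))) =
    TensorProduct.dualDistrib k G.coord G.coord
      ((toDual x ∘ₗ (f.comorphism : G.coord →ₗ[k] H.coord)) ⊗ₜ[k]
        (toDual y ∘ₗ (f.comorphism : G.coord →ₗ[k] H.coord))) (G.sign (Coalgebra.comul a))
  rw [← CoalgHomClass.map_comp_comul_apply f.comorphism a]
  refine (congrArg _ (f.sign_comorphism _)).trans ?_
  generalize G.sign (Coalgebra.comul a) = t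
  induction t with
  | zero => simp
  | add s t hs ht => simp only [map_add, hs, ht]
  | tmul b c => rfl

theorem groupAlgebraLinear_one : f.groupAlgebraLinear 1 = 1 := by
  apply toDual.injective
  ext a
  exact CoalgHomClass.counit_comp_apply f.comorphism a

theorem pairing_comul (x : G.GroupAlgebra) :
    TensorProduct.dualDistrib k G.coord G.coord (TensorProduct.map toDual.toLinearMap
      toDual.toLinearMap (Coalgebra.comul (R := k) x)) =
      toDual x ∘ₗ LinearMap.mul' k G.coord ∘ₗ G.sign := by
  have : TensorProduct.map toDual.toLinearMap toDual.toLinearMap (Coalgebra.comul (R := k) x) =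
      (TensorProduct.dualDistribEquiv k G.coord G.coord).symm
        (toDual x ∘ₗ LinearMap.mul' k G.coord ∘ₗ G.sign) := by
    change TensorProduct.map toDual.toLinearMap toDual.toLinearMap
      (TensorProduct.map toDual.symm.toLinearMap toDual.symm.toLinearMap _) = _
    rw [← LinearMap.comp_apply, ← TensorProduct.map_comp]
    simp only [LinearEquiv.comp_symm, TensorProduct.map_id, LinearMap.id_apply]
    rfl
  rw [this]
  exact (TensorProduct.dualDistribEquiv k G.coord G.coord).apply_symm_apply _

theorem pairing_injective : Function.Injective (fun t : G.GroupAlgebra ⊗[k] G.GroupAlgebra =>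
    TensorProduct.dualDistrib k G.coord G.coord (TensorProduct.map toDual.toLinearMap
      toDual.toLinearMap t)) :=
  (TensorProduct.dualDistribEquiv k G.coord G.coord).injective.comp
    (TensorProduct.congr toDual toDual).injective

theorem pairing_map (t : H.GroupAlgebra ⊗[k] H.GroupAlgebra) :
    TensorProduct.dualDistrib k G.coord G.coord (TensorProduct.map toDual.toLinearMap
      toDual.toLinearMap (TensorProduct.map f.groupAlgebraLinear f.groupAlgebraLinear t)) =
    TensorProduct.dualDistrib k H.coord H.coord (TensorProduct.map toDual.toLinearMap
      toDual.toLinearMap t) ∘ₗ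
      TensorProduct.map (f.comorphism : G.coord →ₗ[k] H.coord)
        (f.comorphism : G.coord →ₗ[k] H.coord) := by
  induction t with
  | zero => simp
  | add s t hs ht => simp only [map_add, hs, ht, LinearMap.add_comp]
  | tmul x y => exact TensorProduct.ext' fun a b => rfl

theorem comul_groupAlgebraLinear (x : H.GroupAlgebra) :
    TensorProduct.map f.groupAlgebraLinear f.groupAlgebraLinear (Coalgebra.comul (R := k) x) =
      Coalgebra.comul (R := k) (f.groupAlgebraLinear x) := by
  apply pairing_injective
  change TensorProduct.dualDistrib k G.coord G.coord (TensorProduct.map toDual.toLinearMap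
      toDual.toLinearMap _) = TensorProduct.dualDistrib k G.coord G.coord
      (TensorProduct.map toDual.toLinearMap toDual.toLinearMap _)
  rw [pairing_map, pairing_comul, pairing_comul]
  ext1
  ext a b
  change toDual x (LinearMap.mul' k H.coord (H.sign (TensorProduct.map
    (f.comorphism : G.coord →ₗ[k] H.coord) (f.comorphism : G.coord →ₗ[k] H.coord) (a ⊗ₜ b)))) =
    toDual x (f.comorphism (LinearMap.mul' k G.coord (G.sign (a ⊗ₜ b))))
  rw [sign_comorphism]
  generalize G.sign (a ⊗ₜ b) = t
  congr 1
  induction t with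
  | zero => simp
  | add s t hs ht => simp only [map_add, hs, ht]
  | tmul b c => simp

/-- The homomorphism `kH → kG` of Hopf superalgebras induced by `f`. -/
def groupAlgebra : H.GroupAlgebra →ₐc[k] G.GroupAlgebra :=
  { AlgHom.ofLinearMap f.groupAlgebraLinear f.groupAlgebraLinear_one f.groupAlgebraLinear_mul with
    map_smul' := map_smul f.groupAlgebraLinear
    counit_comp := by
      ext x
      exact congrArg (toDual x) (map_one f.comorphism)
    map_comp_comul := LinearMap.ext f.comul_groupAlgebraLinear }

theorem groupAlgebra_parity (i : ZMod 2) (x : H.GroupAlgebra)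
    (hx : x ∈ GroupAlgebra.parity H i) : f.groupAlgebra x ∈ GroupAlgebra.parity G i := by
  rw [GroupAlgebra.parity, Submodule.mem_comap, Submodule.mem_dualAnnihilator] at hx ⊢
  exact fun a ha => hx _ (f.map_parity _ _ ha)

end Hom
end FiniteSupergroupScheme

/-! ### The scheme `V_r(G)` and the support of a supermodule -/

section Support

variable {k : Type u} [Field k] (p : ℕ) [Fact p.Prime] [CharP k p] (r : ℕ)

/-- The coordinate algebra `k[V_r(G)]`, which represents the functor sending a commutative
`k`-algebra `A` to the set of Hopf superalgebra homomorphisms `A ⊗ ℙ_r → A ⊗ kG` over `A`. -/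
abbrev CoordVr (G : FiniteSupergroupScheme k) : Type u :=
  HopfHom.RepAlg (Pr.parity k p r) (FiniteSupergroupScheme.GroupAlgebra.parity G)

/-- The scheme `V_r(G)`, as the prime spectrum of `k[V_r(G)]`. -/
abbrev Vr (G : FiniteSupergroupScheme k) : Type u := PrimeSpectrum (CoordVr p r G)

/-- The universal homomorphism `u_G`. -/
abbrev univHom (G : FiniteSupergroupScheme k) :
    HopfHom (CoordVr p r G) (Pr.parity k p r) (FiniteSupergroupScheme.GroupAlgebra.parity G) :=
  HopfHom.universal _ _

/-- The algebra map `k[V_r(G)] → k[V_r(H)]` induced by `f : H → G`: on `A`-points it is composition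
with `kH → kG`. -/
def pushforwardComorphism {H G : FiniteSupergroupScheme k} (f : H.Hom G) :
    CoordVr p r G →ₐ[k] CoordVr p r H :=
  HopfHom.classify
    ((HopfHom.ofBialgHom f.groupAlgebra f.groupAlgebra_parity).comp (univHom p r H))

/-- The morphism `f_* : V_r(H) → V_r(G)` induced by `f : H → G`. -/
def pushforward {H G : FiniteSupergroupScheme k} (f : H.Hom G) : Vr p r H → Vr p r G :=
  PrimeSpectrum.comap (pushforwardComorphism p r f).toRingHom

variable (k) in
/-- The coordinate algebra `B = k[x, y] / (x ^ (p ^ r) - y ^ 2)` of the monoid scheme of pairs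
`(μ, a)` with `a ^ (p ^ r) = μ ^ 2`. -/
abbrev ScaleAlg : Type u :=
  MvPolynomial (Fin 2) k ⧸
    Ideal.span {(MvPolynomial.X 0 ^ p ^ r - MvPolynomial.X 1 ^ 2 : MvPolynomial (Fin 2) k)}

variable (k) in
/-- The coordinate `x` of `B`. -/
def scaleX : ScaleAlg k p r := Ideal.Quotient.mk _ (MvPolynomial.X 0)

variable (k) in
/-- The coordinate `y` of `B`. -/
def scaleY : ScaleAlg k p r := Ideal.Quotient.mk _ (MvPolynomial.X 1)

theorem scaleX_pow : scaleX k p r ^ p ^ r = scaleY k p r ^ 2 := by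
  rw [scaleX, scaleY, ← map_pow, ← map_pow, Ideal.Quotient.eq]
  exact Ideal.subset_span rfl

/-- The comorphism `k[V_r(G)] → k[V_r(G)] ⊗ B` of the right action `(ρ, (μ, a)) ↦ ρ ∘ φ_{μ, a}`
on `V_r(G)`. -/
def coaction (G : FiniteSupergroupScheme k) :
    CoordVr p r G →ₐ[k] CoordVr p r G ⊗[k] ScaleAlg k p r :=
  HopfHom.classify
    (((univHom p r G).baseChange Algebra.TensorProduct.includeLeft).comp
      (Pr.scale (C := CoordVr p r G ⊗[k] ScaleAlg k p r)
        (1 ⊗ₜ[k] scaleY k p r) (1 ⊗ₜ[k] scaleX k p r)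
        (by rw [Algebra.TensorProduct.tmul_pow, Algebra.TensorProduct.tmul_pow, one_pow, one_pow,
          scaleX_pow])))

/-- The homogeneous elements of `k[V_r(G)]` for the grading by `ℤ + ℤ (p ^ r / 2)`: those with
coaction `z ↦ z ⊗ x ^ i` (of degree `i`) or `z ↦ z ⊗ x ^ i y` (of degree `i + p ^ r / 2`). -/
def IsHomogeneousElem (G : FiniteSupergroupScheme k) (z : CoordVr p r G) : Prop :=
  ∃ i : ℕ, coaction p r G z = z ⊗ₜ[k] (scaleX k p r ^ i) ∨
    coaction p r G z = z ⊗ₜ[k] (scaleX k p r ^ i * scaleY k p r)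

/-- An ideal of `k[V_r(G)]` is homogeneous if it is generated by homogeneous elements. -/
def IsHomogeneousIdeal (G : FiniteSupergroupScheme k) (J : Ideal (CoordVr p r G)) : Prop :=
  J = Ideal.span {z | z ∈ J ∧ IsHomogeneousElem p r G z}

/-- A closed subset of `V_r(G)` is conical if it is defined by a homogeneous ideal. -/
def IsConical (G : FiniteSupergroupScheme k) (X : Set (Vr p r G)) : Prop :=
  ∃ J : Ideal (CoordVr p r G), IsHomogeneousIdeal p r G J ∧ X = PrimeSpectrum.zeroLocus J

/-- A `kG`-supermodule. -/
abbrev FiniteSupergroupScheme.Supermodule (G : FiniteSupergroupScheme k) : Type (u + 1) :=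
  SuperModule k (FiniteSupergroupScheme.GroupAlgebra.parity G)

/-- A `kG`-supermodule considered as a `kH`-supermodule by pullback along `f : H → G`. -/
abbrev FiniteSupergroupScheme.Hom.pullback {H G : FiniteSupergroupScheme k} (f : H.Hom G)
    (M : G.Supermodule) : H.Supermodule :=
  M.restrict (f.groupAlgebra : H.GroupAlgebra →ₐ[k] G.GroupAlgebra) f.groupAlgebra_parity

/-- The homomorphism `ν_s` over the residue field `k(s)` corresponding to a point `s`. -/
def residueHom (G : FiniteSupergroupScheme k) (s : Vr p r G) :
    HopfHom s.asIdeal.ResidueField (Pr.parity k p r) (FiniteSupergroupScheme.GroupAlgebra.parity G) :=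
  (univHom p r G).baseChange (IsScalarTower.toAlgHom k (CoordVr p r G) s.asIdeal.ResidueField)

/-- The even homomorphism `ν_s ∘ (1 ⊗ ι) : k(s) ⊗ ℙ_1 → k(s) ⊗ kG` of superalgebras. -/
def fiberHom [NeZero r] (G : FiniteSupergroupScheme k) (s : Vr p r G) :
    s.asIdeal.ResidueField ⊗[k] Pr k p 1 →ₐ[s.asIdeal.ResidueField]
      s.asIdeal.ResidueField ⊗[k] G.GroupAlgebra :=
  (residueHom p r G s).toAlgHom.comp
    (Algebra.TensorProduct.map (AlgHom.id s.asIdeal.ResidueField s.asIdeal.ResidueField)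
      (Pr.ι k p r))

theorem fiberHom_parity [NeZero r] (G : FiniteSupergroupScheme k) (s : Vr p r G) (i : ZMod 2)
    (x : s.asIdeal.ResidueField ⊗[k] Pr k p 1)
    (hx : x ∈ (Pr.parity k p 1 i).baseChange s.asIdeal.ResidueField) :
    fiberHom p r G s x ∈ (FiniteSupergroupScheme.GroupAlgebra.parity G i).baseChange s.asIdeal.ResidueField := by
  refine (residueHom p r G s).map_parity i _ ?_
  refine Pr.baseChange_induction (P := fun x => Algebra.TensorProduct.map
    (AlgHom.id s.asIdeal.ResidueField s.asIdeal.ResidueField) (Pr.ι k p r) x ∈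
      (Pr.parity k p r i).baseChange s.asIdeal.ResidueField) (Pr.parity k p 1 i)
    (fun c y hy => ?_) (fun a b ha hb => ?_) x hx
  · exact Submodule.tmul_mem_baseChange_of_mem c (Pr.ι_mem i y hy)
  · rw [map_add]; exact add_mem ha hb

/-- The supermodule `k(s) ⊗ M` over `k(s) ⊗ ℙ_1`. -/
def fiber [NeZero r] (G : FiniteSupergroupScheme k) (M : G.Supermodule) (s : Vr p r G) :
    SuperModule s.asIdeal.ResidueField
      (fun i => (Pr.parity k p 1 i).baseChange s.asIdeal.ResidueField) :=
  (M.baseChange s.asIdeal.ResidueField).restrict (fiberHom p r G s) (fiberHom_parity p r G s)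

/-- The support `V_r(G)_M` of a `kG`-supermodule `M`: the set of all points `s` of `V_r(G)` such
that `k(s) ⊗ M` has infinite projective dimension over `k(s) ⊗ ℙ_1`. -/
def support [NeZero r] (G : FiniteSupergroupScheme k) (M : G.Supermodule) : Set (Vr p r G) :=
  {s | (fiber p r G M s).projDim = ⊤}

end Support

end SuperSupport

end

open SuperSupport

/-!
The proof replaces projective dimension by the exactness of an explicit differential. A supermodule
`N` over `L ⊗ ℙ_1 = L[u, v] / (u ^ p + v ^ 2)` is a vector space with commuting operators `U`, `V`
such that `U ^ p + V ^ 2 = 0`, and with a parity involution that commutes with `U` and anticommutes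
with `V`. The endomorphism `d (x, y) = (V x - U ^ (p - 1) y, -U x - V y)` of `N × N` squares to zero
(`mfDiff`), and `SuperModule.projDim_eq_top_iff` says that `N` has infinite projective dimension if
and only if `d` is not exact; this holds for `N` of any dimension.

To see this, view a supermodule over the hypersurface as a module over `L[t]`, where `t` acts by
`U`, with an operator `w` such that `w ^ 2 = -t ^ p`. If it is free over `L[t]`, it is projective as
soon as `w` has an `L[t]`-linear contraction, that is, an `h` with `w h + h w = 1`: a lift of a
homomorphism over `L[t]` is made `v`-linear as `w l h + l h w`, and even by an average over the
parity involutions (`SuperModule.isProjective_of_contraction`). Every `N` has a cover `N[t] × N[t]`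
that is projective in this way, and the kernel of the cover is again `N[t] × N[t]`, with an operator
`w` that is `d` modulo `t` (`exists_kernelV_const`). If `d` is exact, it has a contraction, because
`L` is a field; this contraction lifts to one of `w` modulo `t`, and then to one on the nose by a
geometric series and the oddness of `p` (`exists_contraction_of_contraction_mod`), so that `N` has
projective dimension at most one. Conversely, a projective supermodule is a retract of its cover and
inherits a contraction, which makes `d` exact, and exactness passes to quotients along short exact
sequences by the long exact sequence of homology.

The three parts of the theorem follow. For finite-dimensional `M` of dimension `n`, exactness of `d`
at a point `s` means that `d` has rank at least `n`, so the support is the zero locus of the minors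
of size `n` of a matrix over `k[V_r(G)]` (`support_eq_zeroLocus`). The entries of the matrix are
matrix coefficients of the universal homomorphism at `u_{r-1}` and `v`, which have degrees
`p ^ (r - 1)` and `p ^ r / 2`; the entries of `d` then have degrees of the form `a_i + b_j`, so that
the minors are homogeneous (`isWeighted_univMatrix`, `IsWeighted.det`). Exactness does not change
under the field extension from `k(f_*(s))` to `k(s)`, which gives the second part
(`fiber_diff_exact_iff`). For a closed embedding `kH → kG` is injective, so every functional on `kH`
extends to `kG`, and the generators of `k[V_r(H)]` lie in the image of `k[V_r(G)]`
(`pushforwardComorphism_surjective`).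
-/

noncomputable section

namespace SuperSupport

/-! ### Contractions -/

/-- Let `w ^ 2 = -t ^ p`, where `t` is left regular and commutes with `w`, `h` and `g`. A
contraction `h` of `w` modulo `t` can be corrected to a contraction on the nose: the geometric
series for `(1 + t g)⁻¹` gives one modulo `t ^ p = -w ^ 2`, and the error `w ^ 2 g ^ p` is
contracted by `w g ^ p / 2`. -/
theorem exists_contraction_of_contraction_mod {L A : Type*} [Field L] [Ring A] [Algebra L A]
    (h2 : (2 : L) ≠ 0) {p : ℕ} (hp : Odd p) {t w h g : A} (htw : Commute t w) (hth : Commute t h)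
    (htg : Commute t g) (hreg : ∀ a b : A, t * a = t * b → a = b) (hw : w * w = -t ^ p)
    (hc : w * h + h * w = 1 + t * g) : ∃ h' : A, Commute t h' ∧ w * h' + h' * w = 1 := by
  have hwh : w * w * h = h * (w * w) := by
    rw [hw]
    exact ((hth.pow_left p).neg_left).eq
  have hTw : Commute (t * g) w := by
    have h1 : t * g = w * h + h * w - 1 := by rw [hc]; abel
    rw [h1, Commute, SemiconjBy, sub_mul, mul_sub, add_mul, mul_add, ← mul_assoc w w h, hwh,
      mul_assoc h w w, one_mul, mul_one, mul_assoc w h w]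
    abel
  have hgw : Commute g w := hreg _ _ <| by
    rw [← mul_assoc, hTw.eq, ← mul_assoc, ← mul_assoc, htw.eq]
  set T' : A := ∑ i ∈ Finset.range p, (-(t * g)) ^ i with hT'
  have hT'w : Commute T' w := Commute.sum_left _ _ _ fun i _ => (hTw.neg_left).pow_left i
  have hT't : Commute t T' :=
    Commute.sum_right _ _ _ fun i _ =>
      (((Commute.refl t).mul_right htg).neg_right).pow_right i
  have hTT' : (1 + t * g) * T' = 1 + t ^ p * g ^ p := by
    have := mul_neg_geom_sum (-(t * g)) p
    rw [sub_neg_eq_add, hp.neg_pow, sub_neg_eq_add, htg.mul_pow] at this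
    exact this
  refine ⟨h * T' + (2⁻¹ : L) • (w * g ^ p),
    (hth.mul_right hT't).add_right ((htw.mul_right (htg.pow_right p)).smul_right _), ?_⟩
  have e1 : w * (h * T') + h * T' * w = 1 + t ^ p * g ^ p := by
    rw [mul_assoc h, hT'w.eq, ← mul_assoc, ← mul_assoc, ← add_mul, hc, hTT']
  have e2 : w * (w * g ^ p) + w * g ^ p * w = (2 : L) • -(t ^ p * g ^ p) := by
    rw [mul_assoc w (g ^ p), (hgw.pow_left p).eq, ← mul_assoc, hw, neg_mul, two_smul]
  rw [mul_add, add_mul, mul_smul_comm, smul_mul_assoc, add_add_add_comm, e1, ← smul_add, e2,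
    smul_smul, inv_mul_cancel₀ h2, one_smul]
  abel

/-- Over a field, an exact differential is contractible. -/
theorem exists_contraction_of_exact {L N : Type*} [Field L] [AddCommGroup N] [Module L N]
    (d : Module.End L N) (hd : Function.Exact d d) : ∃ h : Module.End L N, d * h + h * d = 1 := by
  obtain ⟨s₀, hs₀⟩ := d.rangeRestrict.exists_rightInverse_of_surjective d.range_rangeRestrict
  obtain ⟨s, hs⟩ := LinearMap.exists_extend s₀
  have hds : ∀ y, d y = 0 → d (s y) = y := fun y hy => by
    obtain ⟨x, rfl⟩ := (hd y).mp hy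
    have h1 : s (d x) = s₀ ⟨d x, ⟨x, rfl⟩⟩ := DFunLike.congr_fun hs ⟨d x, ⟨x, rfl⟩⟩
    rw [h1]
    exact congrArg Subtype.val (DFunLike.congr_fun hs₀ ⟨d x, ⟨x, rfl⟩⟩)
  have hdd : ∀ x, d (d x) = 0 := fun x => (hd (d x)).mpr ⟨x, rfl⟩
  refine ⟨s - s * s * d, LinearMap.ext fun x => ?_⟩
  have h1 : d (s (x - s (d x))) = x - s (d x) := hds _ (by rw [map_sub, hds _ (hdd x), sub_self])
  rw [map_sub, map_sub] at h1
  simp only [LinearMap.add_apply, Module.End.mul_apply, LinearMap.sub_apply, Module.End.one_apply,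
    map_sub, hdd, map_zero, sub_zero, h1, sub_add_cancel]

/-! ### The differential of the matrix factorization -/

section Diff

variable {L N : Type*} [Field L] [AddCommGroup N] [Module L N]

/-- The endomorphism `(x, y) ↦ (V x - U ^ (p - 1) y, -U x - V y)` of `N × N`. It comes from the
matrix factorization of `u ^ p + v ^ 2` attached to the residue field of `k[u, v] / (u ^ p + v ^ 2)`
at the origin, and squares to zero when `U` and `V` commute and `U ^ p + V ^ 2 = 0`. -/
def mfDiff (p : ℕ) (U V : Module.End L N) : Module.End L (N × N) :=
  LinearMap.prod (V ∘ₗ LinearMap.fst L N N - (U ^ (p - 1)) ∘ₗ LinearMap.snd L N N)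
    (-(U ∘ₗ LinearMap.fst L N N) - V ∘ₗ LinearMap.snd L N N)

theorem mfDiff_apply (p : ℕ) (U V : Module.End L N) (z : N × N) :
    mfDiff p U V z = (V z.1 - (U ^ (p - 1)) z.2, -U z.1 - V z.2) := rfl

variable {p : ℕ} {U V : Module.End L N}

theorem mfDiff_mfDiff (hp : p ≠ 0) (hUV : Commute U V) (hrel : U ^ p + V * V = 0) (z : N × N) :
    mfDiff p U V (mfDiff p U V z) = 0 := by
  have hUV' : ∀ x, U (V x) = V (U x) := fun x => DFunLike.congr_fun hUV.eq x
  have hUV'' : ∀ x, (U ^ (p - 1)) (V x) = V ((U ^ (p - 1)) x) :=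
    fun x => DFunLike.congr_fun (hUV.pow_left (p - 1)).eq x
  have h1 : ∀ x, (U ^ (p - 1)) (U x) + V (V x) = 0 := fun x => by
    have := DFunLike.congr_fun hrel x
    rwa [← Nat.sub_add_cancel (Nat.pos_of_ne_zero hp), pow_succ] at this
  have h2 : ∀ x, U ((U ^ (p - 1)) x) + V (V x) = 0 := fun x => by
    have := DFunLike.congr_fun hrel x
    rwa [← Nat.sub_add_cancel (Nat.pos_of_ne_zero hp), pow_succ'] at this
  rw [mfDiff_apply, mfDiff_apply, Prod.mk_eq_zero]
  simp only [map_sub, map_neg, hUV', hUV'']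
  constructor
  · rw [← h1 z.1]; abel
  · rw [← h2 z.2]; abel

theorem mfDiff_exact_of_contraction (hp : p ≠ 0) (hUV : Commute U V) (hrel : U ^ p + V * V = 0)
    {h : Module.End L N} (hUh : Commute U h) (hc : V * h + h * V = 1) :
    Function.Exact (mfDiff p U V) (mfDiff p U V) := by
  intro z
  constructor
  · intro hz
    rw [mfDiff_apply, Prod.mk_eq_zero] at hz
    have e1 : V z.1 = (U ^ (p - 1)) z.2 := sub_eq_zero.mp hz.1
    have e2 : V z.2 = -U z.1 := (sub_eq_zero.mp hz.2).symm
    have hc' : ∀ x, V (h x) + h (V x) = x := fun x => DFunLike.congr_fun hc x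
    have c1 : ∀ x, U (h x) = h (U x) := fun x => DFunLike.congr_fun hUh.eq x
    have c2 : ∀ x, (U ^ (p - 1)) (h x) = h ((U ^ (p - 1)) x) :=
      fun x => DFunLike.congr_fun (hUh.pow_left (p - 1)).eq x
    refine ⟨(h z.1, -h z.2), ?_⟩
    rw [mfDiff_apply]
    ext
    · simp only [map_neg, c2, ← e1, sub_neg_eq_add]
      exact hc' _
    · simp only [map_neg, c1]
      rw [← map_neg, ← e2, sub_neg_eq_add, add_comm]
      exact hc' _
  · rintro ⟨y, rfl⟩
    exact mfDiff_mfDiff hp hUV hrel y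

end Diff

/-! ### Polynomials with coefficients in a vector space -/

section Poly

variable {L : Type*} [Field L] {N N' W P Y : Type*} [AddCommGroup N] [Module L N]
  [AddCommGroup N'] [Module L N'] [AddCommGroup W] [Module L W] [AddCommGroup P] [Module L P]
  [AddCommGroup Y] [Module L Y]

/-- Multiplication by the variable `t` on the space `N[t]` of polynomials with coefficients
in `N`, realised as `ℕ →₀ N`. -/
def polyShift (L N : Type*) [Field L] [AddCommGroup N] [Module L N] : Module.End L (ℕ →₀ N) :=
  Finsupp.lmapDomain N L (· + 1)

theorem polyShift_single (n : ℕ) (x : N) :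
    polyShift L N (Finsupp.single n x) = Finsupp.single (n + 1) x :=
  Finsupp.mapDomain_single

theorem polyShift_apply_succ (z : ℕ →₀ N) (n : ℕ) : polyShift L N z (n + 1) = z n :=
  Finsupp.mapDomain_apply (add_left_injective 1) z n

theorem polyShift_injective : Function.Injective (polyShift L N) :=
  Finsupp.mapDomain_injective (add_left_injective 1)

/-- The coefficientwise extension of an endomorphism of `N` to `N[t]`. -/
def polyMap (f : Module.End L N) : Module.End L (ℕ →₀ N) := Finsupp.mapRange.linearMap f

theorem polyMap_single (f : Module.End L N) (n : ℕ) (x : N) :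
    polyMap f (Finsupp.single n x) = Finsupp.single n (f x) := by
  simp [polyMap]

theorem polyMap_apply (f : Module.End L N) (z : ℕ →₀ N) (n : ℕ) : polyMap f z n = f (z n) := by
  simp [polyMap]

theorem polyMap_mul (f g : Module.End L N) : polyMap (f * g) = polyMap f * polyMap g :=
  Finsupp.lhom_ext fun n x => by
    simp only [Module.End.mul_apply, polyMap_single]

theorem polyMap_one : polyMap (1 : Module.End L N) = 1 :=
  Finsupp.lhom_ext fun n x => by
    simp only [polyMap_single, Module.End.one_apply]

theorem polyMap_neg (f : Module.End L N) : polyMap (-f) = -polyMap f :=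
  Finsupp.lhom_ext fun n x => by
    simp only [polyMap_single, LinearMap.neg_apply, Finsupp.single_neg]

theorem polyMap_pow (f : Module.End L N) (n : ℕ) : polyMap (f ^ n) = polyMap f ^ n := by
  induction n with
  | zero => rw [pow_zero, pow_zero, polyMap_one]
  | succ n ih => rw [pow_succ, pow_succ, polyMap_mul, ih]

theorem commute_polyShift_polyMap (f : Module.End L N) : Commute (polyShift L N) (polyMap f) :=
  Finsupp.lhom_ext fun n x => by
    simp only [Module.End.mul_apply, polyShift_single, polyMap_single]

/-- The linear map `∑ x_n t ^ n ↦ ∑ T ^ n f(x_n)` on `N[t]`. -/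
def polyLift (T : Module.End L Y) (f : N →ₗ[L] Y) : (ℕ →₀ N) →ₗ[L] Y :=
  Finsupp.lsum L fun n => (T ^ n) ∘ₗ f

theorem polyLift_single (T : Module.End L Y) (f : N →ₗ[L] Y) (n : ℕ) (x : N) :
    polyLift T f (Finsupp.single n x) = (T ^ n) (f x) := by
  simp [polyLift]

theorem polyLift_polyShift (T : Module.End L Y) (f : N →ₗ[L] Y) :
    polyLift T f ∘ₗ polyShift L N = T ∘ₗ polyLift T f :=
  Finsupp.lhom_ext fun n x => by
    simp only [LinearMap.comp_apply, polyShift_single, polyLift_single, pow_succ',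
      Module.End.mul_apply]

/-- `P` is free as a module over `L[t]`, where `t` acts by the given endomorphism, with an
`L`-basis of `W`, placed in `P` by `j`, as a basis. This is encoded by the universal property of a
free module, tested on the modules of one universe. -/
structure IsFreeOver (t : Module.End L P) (j : W →ₗ[L] P) : Prop where
  lift : ∀ {Y : Type u} [AddCommGroup Y] [Module L Y] (T : Module.End L Y) (f : W →ₗ[L] Y),
    ∃ l : P →ₗ[L] Y, l ∘ₗ t = T ∘ₗ l ∧ l ∘ₗ j = f
  ext : ∀ {Y : Type u} [AddCommGroup Y] [Module L Y] (T : Module.End L Y) (l l' : P →ₗ[L] Y),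
    l ∘ₗ t = T ∘ₗ l → l' ∘ₗ t = T ∘ₗ l' → l ∘ₗ j = l' ∘ₗ j → l = l'

/-- Multiplication by `t` on `N[t] × N[t]`. -/
def pairShift (L N : Type*) [Field L] [AddCommGroup N] [Module L N] :
    Module.End L ((ℕ →₀ N) × (ℕ →₀ N)) :=
  (polyShift L N).prodMap (polyShift L N)

/-- The inclusion of `N × N` in `N[t] × N[t]` as the constants. -/
def pairConst (L N : Type*) [Field L] [AddCommGroup N] [Module L N] :
    N × N →ₗ[L] (ℕ →₀ N) × (ℕ →₀ N) :=
  (Finsupp.lsingle 0).prodMap (Finsupp.lsingle 0)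

theorem pairShift_apply (z : (ℕ →₀ N) × (ℕ →₀ N)) :
    pairShift L N z = (polyShift L N z.1, polyShift L N z.2) := rfl

theorem pairConst_apply (z : N × N) :
    pairConst L N z = (Finsupp.single 0 z.1, Finsupp.single 0 z.2) := rfl

theorem single_eq_shift_pow (n : ℕ) (x : N) :
    Finsupp.single n x = (polyShift L N ^ n) (Finsupp.single 0 x) := by
  induction n with
  | zero => rfl
  | succ n ih => rw [pow_succ', Module.End.mul_apply, ← ih, polyShift_single]

theorem pairShift_pow_apply (n : ℕ) (z : (ℕ →₀ N) × (ℕ →₀ N)) :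
    (pairShift L N ^ n) z = ((polyShift L N ^ n) z.1, (polyShift L N ^ n) z.2) := by
  induction n with
  | zero => rfl
  | succ n ih => rw [pow_succ', Module.End.mul_apply, ih, pairShift_apply, pow_succ']; rfl

theorem isFreeOver_pairShift : IsFreeOver.{u} (pairShift L N) (pairConst L N) where
  lift := fun {Y} _ _ T f => by
    refine ⟨LinearMap.coprod (polyLift T (f ∘ₗ LinearMap.inl L N N))
      (polyLift T (f ∘ₗ LinearMap.inr L N N)), ?_, ?_⟩
    · refine LinearMap.ext fun z => ?_
      simp only [LinearMap.comp_apply, pairShift_apply, LinearMap.coprod_apply, map_add]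
      exact congrArg₂ (· + ·) (DFunLike.congr_fun (polyLift_polyShift T _) z.1)
        (DFunLike.congr_fun (polyLift_polyShift T _) z.2)
    · refine LinearMap.ext fun z => ?_
      rw [LinearMap.comp_apply, pairConst_apply, LinearMap.coprod_apply, polyLift_single,
        polyLift_single, pow_zero, Module.End.one_apply, Module.End.one_apply,
        LinearMap.comp_apply, LinearMap.comp_apply, ← map_add]
      simp
  ext := fun {Y} _ _ T l l' hl hl' hj => by
    have key : ∀ m : (ℕ →₀ N) × (ℕ →₀ N) →ₗ[L] Y, m ∘ₗ pairShift L N = T ∘ₗ m →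
        ∀ n z, m ((pairShift L N ^ n) z) = (T ^ n) (m z) := by
      intro m hm n z
      induction n with
      | zero => rfl
      | succ n ih =>
        rw [pow_succ', pow_succ', Module.End.mul_apply, Module.End.mul_apply, ← ih]
        exact DFunLike.congr_fun hm _
    have hn : ∀ n z, l ((pairShift L N ^ n) (pairConst L N z)) =
        l' ((pairShift L N ^ n) (pairConst L N z)) := fun n z => by
      rw [key l hl, key l' hl']
      exact congrArg _ (DFunLike.congr_fun hj z)
    refine LinearMap.prod_ext (Finsupp.lhom_ext fun n x => ?_) (Finsupp.lhom_ext fun n x => ?_)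
    · have := hn n (x, 0)
      rwa [pairShift_pow_apply, pairConst_apply, ← single_eq_shift_pow, Finsupp.single_zero,
        map_zero] at this
    · have := hn n (0, x)
      rwa [pairShift_pow_apply, pairConst_apply, Finsupp.single_zero, map_zero,
        ← single_eq_shift_pow] at this

/-- An endomorphism with `w ^ 2 = -t ^ p` of an `L[t]`-free module has an `L[t]`-linear contraction
if it is contractible modulo `t`. -/
theorem IsFreeOver.exists_contraction {P : Type u} [AddCommGroup P] [Module L P]
    {t : Module.End L P} {j : W →ₗ[L] P} (hfree : IsFreeOver.{u} t j) (h2 : (2 : L) ≠ 0) {p : ℕ}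
    (hp : Odd p) (ht : Function.Injective t) {w V' : Module.End L P} (htw : Commute t w)
    (htV' : Commute t V') (hw : w * w = -t ^ p) {d h₀ : Module.End L W}
    (hd : d * h₀ + h₀ * d = 1) (hwj : ∀ y, w (j y) = j (d y) + t (V' (j y))) :
    ∃ h : Module.End L P, Commute t h ∧ w * h + h * w = 1 := by
  obtain ⟨h, hht, hhj⟩ := hfree.lift t (j ∘ₗ h₀)
  have hth : Commute t h := hht.symm
  have hhj' : ∀ y, h (j y) = j (h₀ y) := fun y => DFunLike.congr_fun hhj y
  have hht' : ∀ y, h (t y) = t (h y) := fun y => DFunLike.congr_fun hht y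
  have hd' : ∀ y, d (h₀ y) + h₀ (d y) = y := fun y => DFunLike.congr_fun hd y
  refine exists_contraction_of_contraction_mod h2 hp (g := V' * h + h * V') htw hth
    ((htV'.mul_right hth).add_right (hth.mul_right htV'))
    (fun a b hab => LinearMap.ext fun x => ht (DFunLike.congr_fun hab x)) hw ?_
  refine hfree.ext t _ _ ((htw.mul_right hth).add_right (hth.mul_right htw)).symm.eq
    ((Commute.one_right t).add_right ((Commute.refl t).mul_right
      ((htV'.mul_right hth).add_right (hth.mul_right htV')))).symm.eq ?_
  refine LinearMap.ext fun y => ?_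
  simp only [LinearMap.comp_apply, LinearMap.add_apply, Module.End.mul_apply,
    Module.End.one_apply, map_add, hhj', hwj, hht']
  have e : j y = j (d (h₀ y)) + j (h₀ (d y)) := by rw [← map_add, hd']
  generalize t (h (V' (j y))) = a
  rw [e]
  abel

end Poly

/-! ### The free cover over `L[u, v] / (u ^ p + v ^ 2)` and its kernel -/

section Resolution

variable {L N : Type*} [Field L] [AddCommGroup N] [Module L N] (p : ℕ) (U V : Module.End L N)

/-- The divided difference `∑ t ^ i U ^ (p - 1 - i)`, with `(t - U) * mfQuot = t ^ p - U ^ p`. -/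
def mfQuot : Module.End L (ℕ →₀ N) :=
  ∑ i ∈ Finset.range p, polyShift L N ^ i * polyMap U ^ (p - 1 - i)

/-- The action of `v` on the free module `N[t] × N[t]` that covers `N`; the pair `(a, b)` stands
for `a + v b`. -/
def coverV (L N : Type*) [Field L] [AddCommGroup N] [Module L N] (p : ℕ) :
    Module.End L ((ℕ →₀ N) × (ℕ →₀ N)) :=
  LinearMap.prod (-(polyShift L N ^ p) ∘ₗ LinearMap.snd L _ _) (LinearMap.fst L _ _)

/-- The covering `(a, b) ↦ a(U) + V b(U)` of `N` by the free module `N[t] × N[t]`. -/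
def coverProj : (ℕ →₀ N) × (ℕ →₀ N) →ₗ[L] N :=
  LinearMap.coprod (polyLift U LinearMap.id) (V ∘ₗ polyLift U LinearMap.id)

/-- The action of `v` on `N[t] × N[t]`, as the kernel of `coverProj`. -/
def kernelV : Module.End L ((ℕ →₀ N) × (ℕ →₀ N)) :=
  LinearMap.prod (polyMap V ∘ₗ LinearMap.fst L _ _ - mfQuot p U ∘ₗ LinearMap.snd L _ _)
    ((polyShift L N - polyMap U) ∘ₗ LinearMap.fst L _ _ - polyMap V ∘ₗ LinearMap.snd L _ _)

/-- The inclusion `(c, b) ↦ ((t - U) c - V b, b)` of the kernel of `coverProj`. -/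
def kernelIncl : (ℕ →₀ N) × (ℕ →₀ N) →ₗ[L] (ℕ →₀ N) × (ℕ →₀ N) :=
  LinearMap.prod
    ((polyShift L N - polyMap U) ∘ₗ LinearMap.fst L _ _ - polyMap V ∘ₗ LinearMap.snd L _ _)
    (LinearMap.snd L _ _)

theorem coverV_apply (z : (ℕ →₀ N) × (ℕ →₀ N)) :
    coverV L N p z = (-(polyShift L N ^ p) z.2, z.1) := rfl

theorem coverProj_apply (z : (ℕ →₀ N) × (ℕ →₀ N)) :
    coverProj U V z = polyLift U LinearMap.id z.1 + V (polyLift U LinearMap.id z.2) := rfl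

theorem kernelV_apply (z : (ℕ →₀ N) × (ℕ →₀ N)) :
    kernelV p U V z = (polyMap V z.1 - mfQuot p U z.2,
      (polyShift L N - polyMap U) z.1 - polyMap V z.2) := rfl

theorem kernelIncl_apply (z : (ℕ →₀ N) × (ℕ →₀ N)) :
    kernelIncl U V z = ((polyShift L N - polyMap U) z.1 - polyMap V z.2, z.2) := rfl

theorem mfQuot_spec (z : ℕ →₀ N) : (polyShift L N - polyMap U) (mfQuot p U z) =
    (polyShift L N ^ p) z - (polyMap U ^ p) z :=
  DFunLike.congr_fun ((commute_polyShift_polyMap U).mul_geom_sum₂ p) z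

theorem coverV_sq : coverV L N p * coverV L N p = -pairShift L N ^ p := by
  refine LinearMap.ext fun z => ?_
  rw [Module.End.mul_apply, LinearMap.neg_apply, coverV_apply, coverV_apply, pairShift_pow_apply,
    Prod.neg_mk]

theorem commute_pairShift_coverV : Commute (pairShift L N) (coverV L N p) := by
  refine LinearMap.ext fun z => ?_
  rw [Module.End.mul_apply, Module.End.mul_apply, coverV_apply, coverV_apply, pairShift_apply,
    pairShift_apply]
  have : polyShift L N ((polyShift L N ^ p) z.2) = (polyShift L N ^ p) (polyShift L N z.2) :=
    DFunLike.congr_fun ((Commute.refl (polyShift L N)).pow_right p).eq z.2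
  simp only [map_neg, this]

theorem exists_contraction_coverV :
    ∃ h : Module.End L ((ℕ →₀ N) × (ℕ →₀ N)), Commute (pairShift L N) h ∧
      coverV L N p * h + h * coverV L N p = 1 := by
  refine ⟨LinearMap.prod (LinearMap.snd L _ _) 0, LinearMap.ext fun z => ?_,
    LinearMap.ext fun z => ?_⟩
  · simp [pairShift_apply]
  · simp [coverV_apply]

theorem coverProj_surjective : Function.Surjective (coverProj U V) := fun x =>
  ⟨(Finsupp.single 0 x, 0), by
    rw [coverProj_apply, polyLift_single, map_zero, map_zero, add_zero]; rfl⟩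

theorem coverProj_pairShift (hUV : Commute U V) (z : (ℕ →₀ N) × (ℕ →₀ N)) :
    coverProj U V (pairShift L N z) = U (coverProj U V z) := by
  have h : ∀ a : ℕ →₀ N, polyLift U LinearMap.id (polyShift L N a) =
      U (polyLift U LinearMap.id a) := fun a => DFunLike.congr_fun (polyLift_polyShift U _) a
  have h' : ∀ x, U (V x) = V (U x) := fun x => DFunLike.congr_fun hUV.eq x
  rw [pairShift_apply, coverProj_apply, coverProj_apply, h, h, map_add, h']

theorem polyLift_polyShift_pow (n : ℕ) (a : ℕ →₀ N) :
    polyLift U LinearMap.id ((polyShift L N ^ n) a) = (U ^ n) (polyLift U LinearMap.id a) := by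
  induction n with
  | zero => rfl
  | succ n ih =>
    rw [pow_succ', pow_succ', Module.End.mul_apply, Module.End.mul_apply, ← ih]
    exact DFunLike.congr_fun (polyLift_polyShift U _) _

theorem polyLift_polyMap {W : Module.End L N} (hUW : Commute U W) (a : ℕ →₀ N) :
    polyLift U LinearMap.id (polyMap W a) = W (polyLift U LinearMap.id a) := by
  have : polyLift U LinearMap.id ∘ₗ polyMap W = W ∘ₗ polyLift U LinearMap.id :=
    Finsupp.lhom_ext fun n x => by
      simp only [LinearMap.comp_apply, polyMap_single, polyLift_single, LinearMap.id_apply]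
      exact DFunLike.congr_fun (hUW.pow_left n).eq x
  exact DFunLike.congr_fun this a

theorem polyShift_sub_injective : Function.Injective (polyShift L N - polyMap U) := by
  rw [injective_iff_map_eq_zero]
  intro z hz
  rw [LinearMap.sub_apply, sub_eq_zero] at hz
  by_contra hne
  -- comparison of the coefficients just above the degree of `z`
  obtain ⟨m, hm, hmax⟩ := z.support.exists_max_image id (Finsupp.support_nonempty_iff.mpr hne)
  have h0 : z (m + 1) = 0 := by
    by_contra h
    exact absurd (hmax _ (Finsupp.mem_support_iff.mpr h)) (by simp)
  have := DFunLike.congr_fun hz (m + 1)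
  rw [polyShift_apply_succ, polyMap_apply, h0, map_zero] at this
  exact Finsupp.mem_support_iff.mp hm this

theorem exists_sub_of_polyLift_eq_zero (a : ℕ →₀ N) (ha : polyLift U LinearMap.id a = 0) :
    ∃ c, (polyShift L N - polyMap U) c = a := by
  have key : ∀ a : ℕ →₀ N, ∃ c, (polyShift L N - polyMap U) c =
      a - Finsupp.single 0 (polyLift U LinearMap.id a) := by
    intro a
    induction a using Finsupp.induction_linear with
    | zero => exact ⟨0, by simp⟩
    | add a b ha hb =>
      obtain ⟨c, hc⟩ := ha
      obtain ⟨d, hd⟩ := hb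
      exact ⟨c + d, by rw [map_add, hc, hd, map_add, Finsupp.single_add]; abel⟩
    | single n x =>
      refine ⟨mfQuot n U (Finsupp.single 0 x), ?_⟩
      rw [mfQuot_spec, ← single_eq_shift_pow, ← polyMap_pow, polyMap_single, polyLift_single]
      rfl
  obtain ⟨c, hc⟩ := key a
  exact ⟨c, by rw [hc, ha, Finsupp.single_zero, sub_zero]⟩

theorem kernelIncl_injective : Function.Injective (kernelIncl U V) := by
  rw [injective_iff_map_eq_zero]
  rintro ⟨c, b⟩ h
  rw [kernelIncl_apply, Prod.mk_eq_zero] at h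
  obtain ⟨h1, h2⟩ := h
  simp only at h1 h2
  subst h2
  rw [map_zero, sub_zero] at h1
  rw [(injective_iff_map_eq_zero _).mp (polyShift_sub_injective U) c h1]
  rfl

theorem kernelIncl_exact (hUV : Commute U V) :
    Function.Exact (kernelIncl U V) (coverProj U V) := by
  have hs : ∀ c, polyLift U LinearMap.id ((polyShift L N - polyMap U) c) = 0 := fun c => by
    rw [LinearMap.sub_apply, map_sub, polyLift_polyMap U (Commute.refl U), sub_eq_zero]
    exact DFunLike.congr_fun (polyLift_polyShift U _) c
  rintro ⟨a, b⟩
  constructor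
  · intro h
    rw [coverProj_apply] at h
    obtain ⟨c, hc⟩ := exists_sub_of_polyLift_eq_zero U (a + polyMap V b) (by
      rw [map_add, polyLift_polyMap U hUV]; exact h)
    exact ⟨(c, b), by rw [kernelIncl_apply, hc]; simp⟩
  · rintro ⟨z, hz⟩
    rw [← hz, kernelIncl_apply, coverProj_apply]
    simp only [map_sub, hs, polyLift_polyMap U hUV]
    abel

theorem kernelIncl_pairShift (z : (ℕ →₀ N) × (ℕ →₀ N)) :
    kernelIncl U V (pairShift L N z) = pairShift L N (kernelIncl U V z) := by
  have h : ∀ (T : Module.End L N) a, polyMap T (polyShift L N a) = polyShift L N (polyMap T a) :=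
    fun T a => (DFunLike.congr_fun (commute_polyShift_polyMap T).eq a).symm
  simp only [kernelIncl_apply, pairShift_apply, LinearMap.sub_apply, map_sub, h]

variable {U V}

theorem commute_polyMap (hUV : Commute U V) : Commute (polyMap U) (polyMap V) := by
  rw [Commute, SemiconjBy, ← polyMap_mul, ← polyMap_mul, hUV.eq]

variable {p}

theorem coverProj_coverV (hrel : U ^ p + V * V = 0)
    (z : (ℕ →₀ N) × (ℕ →₀ N)) :
    coverProj U V (coverV L N p z) = V (coverProj U V z) := by
  have h : ∀ x, (U ^ p) x + V (V x) = 0 := fun x => DFunLike.congr_fun hrel x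
  rw [coverV_apply, coverProj_apply, coverProj_apply, map_neg, polyLift_polyShift_pow, map_add,
    neg_eq_of_add_eq_zero_right (h _)]
  abel

theorem polyMap_rel (hrel : U ^ p + V * V = 0) (z : ℕ →₀ N) :
    polyMap V (polyMap V z) = -(polyMap U ^ p) z := by
  have : polyMap (U ^ p) + polyMap V * polyMap V = 0 := by
    rw [← polyMap_mul, eq_neg_of_add_eq_zero_left hrel, polyMap_neg, neg_add_cancel]
  rw [← polyMap_pow]
  exact (neg_eq_of_add_eq_zero_right (DFunLike.congr_fun this z)).symm

theorem commute_polyShift_sub (hUV : Commute U V) :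
    Commute (polyMap V) (polyShift L N - polyMap U) :=
  (commute_polyShift_polyMap V).symm.sub_right (commute_polyMap hUV).symm

theorem kernelIncl_kernelV (hUV : Commute U V) (hrel : U ^ p + V * V = 0)
    (z : (ℕ →₀ N) × (ℕ →₀ N)) :
    kernelIncl U V (kernelV p U V z) = coverV L N p (kernelIncl U V z) := by
  have h : ∀ a, polyMap V ((polyShift L N - polyMap U) a) =
      (polyShift L N - polyMap U) (polyMap V a) :=
    fun a => DFunLike.congr_fun (commute_polyShift_sub hUV).eq a
  rw [kernelIncl_apply, kernelIncl_apply, kernelV_apply, coverV_apply]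
  simp only [map_sub, mfQuot_spec, h, polyMap_rel hrel]
  ext1
  · simp only
    abel
  · rfl

theorem kernelV_sq (hUV : Commute U V) (hrel : U ^ p + V * V = 0) :
    kernelV p U V * kernelV p U V = -pairShift L N ^ p := by
  refine LinearMap.ext fun z => kernelIncl_injective U V ?_
  have hpow : ∀ n, kernelIncl U V ((pairShift L N ^ n) z) =
      (pairShift L N ^ n) (kernelIncl U V z) := fun n => by
    induction n with
    | zero => rfl
    | succ n ih =>
      rw [pow_succ', Module.End.mul_apply, Module.End.mul_apply, kernelIncl_pairShift, ih]
  rw [Module.End.mul_apply, kernelIncl_kernelV hUV hrel, kernelIncl_kernelV hUV hrel,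
    LinearMap.neg_apply, map_neg, hpow]
  exact DFunLike.congr_fun (coverV_sq (L := L) (N := N) p) (kernelIncl U V z)

theorem commute_pairShift_kernelV (hUV : Commute U V) (hrel : U ^ p + V * V = 0) :
    Commute (pairShift L N) (kernelV p U V) := by
  refine LinearMap.ext fun z => kernelIncl_injective U V ?_
  rw [Module.End.mul_apply, Module.End.mul_apply, kernelIncl_pairShift,
    kernelIncl_kernelV hUV hrel, kernelIncl_kernelV hUV hrel, kernelIncl_pairShift]
  exact DFunLike.congr_fun (commute_pairShift_coverV (L := L) (N := N) p).eq (kernelIncl U V z)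

/-- Modulo `t`, the action of `v` on the kernel of `coverProj` is the differential `mfDiff`. -/
theorem exists_kernelV_const (hp : p ≠ 0) : ∃ V' : Module.End L ((ℕ →₀ N) × (ℕ →₀ N)),
    Commute (pairShift L N) V' ∧ ∀ y : N × N, kernelV p U V (pairConst L N y) =
      pairConst L N (mfDiff p U V y) + pairShift L N (V' (pairConst L N y)) := by
  obtain ⟨m, rfl⟩ := Nat.exists_eq_succ_of_ne_zero hp
  set τ : Module.End L (ℕ →₀ N) :=
    ∑ i ∈ Finset.range m, polyShift L N ^ i * polyMap U ^ (m - (i + 1)) with hτ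
  have hσ : mfQuot (m + 1) U = polyShift L N * τ + polyMap U ^ m := by
    rw [mfQuot, Finset.sum_range_succ', hτ, Finset.mul_sum]
    simp only [pow_succ', mul_assoc, pow_zero, one_mul, Nat.add_sub_cancel, Nat.sub_zero]
  have hτt : Commute (polyShift L N) τ :=
    Commute.sum_right _ _ _ fun i _ =>
      ((Commute.refl _).pow_right i).mul_right ((commute_polyShift_polyMap U).pow_right _)
  have hτt' : ∀ a, polyShift L N (τ a) = τ (polyShift L N a) :=
    fun a => DFunLike.congr_fun hτt.eq a
  refine ⟨LinearMap.prod (-τ ∘ₗ LinearMap.snd L _ _) (LinearMap.fst L _ _),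
    LinearMap.ext fun z => ?_, fun y => ?_⟩
  · simp [pairShift_apply, hτt']
  · have hV' : LinearMap.prod (-τ ∘ₗ LinearMap.snd L (ℕ →₀ N) (ℕ →₀ N)) (LinearMap.fst L _ _)
        (pairConst L N y) = (-τ (Finsupp.single 0 y.2), Finsupp.single 0 y.1) := rfl
    rw [hV', kernelV_apply, hσ, ← polyMap_pow]
    simp only [pairConst_apply, mfDiff_apply, pairShift_apply,
      LinearMap.add_apply, LinearMap.sub_apply, Module.End.mul_apply, polyMap_single,
      Finsupp.single_sub, Finsupp.single_neg, Prod.mk_add_mk, map_neg, Nat.succ_eq_add_one,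
      Nat.add_sub_cancel]
    ext1 <;> simp only <;> abel

end Resolution

/-! ### Parity involutions -/

section Sign

variable {L N : Type*} [Field L] [AddCommGroup N] [Module L N] (s : Module.End L N)

/-- The parity involution of `N[t] × N[t]`, where the second factor is shifted by one. -/
def pairSign : Module.End L ((ℕ →₀ N) × (ℕ →₀ N)) := (polyMap s).prodMap (-polyMap s)

theorem pairSign_apply (z : (ℕ →₀ N) × (ℕ →₀ N)) :
    pairSign s z = (polyMap s z.1, -polyMap s z.2) := rfl

variable {s}

theorem pairSign_sq (hs : s * s = 1) : pairSign s * pairSign s = 1 := by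
  have h : ∀ a, polyMap s (polyMap s a) = a := fun a => by
    rw [← Module.End.mul_apply, ← polyMap_mul, hs, polyMap_one, Module.End.one_apply]
  refine LinearMap.ext fun z => ?_
  simp [pairSign_apply, h]

theorem commute_pairSign_pairShift : Commute (pairSign s) (pairShift L N) := by
  have h : ∀ a, polyShift L N (polyMap s a) = polyMap s (polyShift L N a) :=
    fun a => DFunLike.congr_fun (commute_polyShift_polyMap s).eq a
  refine LinearMap.ext fun z => ?_
  simp [pairSign_apply, pairShift_apply, h]

theorem pairSign_coverV (p : ℕ) :
    pairSign s * coverV L N p = -(coverV L N p * pairSign s) := by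
  have h : ∀ a, (polyShift L N ^ p) (polyMap s a) = polyMap s ((polyShift L N ^ p) a) :=
    fun a => DFunLike.congr_fun ((commute_polyShift_polyMap s).pow_left p).eq a
  refine LinearMap.ext fun z => ?_
  simp [pairSign_apply, coverV_apply, h]

variable {p : ℕ} {U V : Module.End L N}

theorem coverProj_pairSign (hU : Commute s U) (hV : s * V = -(V * s))
    (z : (ℕ →₀ N) × (ℕ →₀ N)) :
    coverProj U V (pairSign s z) = s (coverProj U V z) := by
  have h : ∀ x, s (V x) = -V (s x) := fun x => DFunLike.congr_fun hV x
  rw [pairSign_apply, coverProj_apply, coverProj_apply, map_neg, polyLift_polyMap U hU.symm,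
    polyLift_polyMap U hU.symm, map_neg, map_add, h]

theorem kernelIncl_pairSign (hU : Commute s U) (hV : s * V = -(V * s))
    (z : (ℕ →₀ N) × (ℕ →₀ N)) :
    kernelIncl U V (pairSign s z) = pairSign s (kernelIncl U V z) := by
  have h1 : ∀ a, polyShift L N (polyMap s a) = polyMap s (polyShift L N a) :=
    fun a => DFunLike.congr_fun (commute_polyShift_polyMap s).eq a
  have h2 : ∀ a, polyMap U (polyMap s a) = polyMap s (polyMap U a) :=
    fun a => DFunLike.congr_fun (commute_polyMap hU.symm).eq a
  have h3 : ∀ a, polyMap V (polyMap s a) = -polyMap s (polyMap V a) := fun a => by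
    rw [← Module.End.mul_apply, ← Module.End.mul_apply, ← polyMap_mul, ← polyMap_mul, hV,
      polyMap_neg, LinearMap.neg_apply, neg_neg]
  simp only [pairSign_apply, kernelIncl_apply, LinearMap.sub_apply, map_sub, map_neg, h1, h2, h3,
    neg_neg]

theorem pairSign_kernelV (hU : Commute s U) (hV : s * V = -(V * s))
    (hUV : Commute U V) (hrel : U ^ p + V * V = 0) :
    pairSign s * kernelV p U V = -(kernelV p U V * pairSign s) := by
  refine LinearMap.ext fun z => kernelIncl_injective U V ?_
  rw [Module.End.mul_apply, kernelIncl_pairSign hU hV, kernelIncl_kernelV hUV hrel,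
    LinearMap.neg_apply, Module.End.mul_apply, map_neg, kernelIncl_kernelV hUV hrel,
    kernelIncl_pairSign hU hV]
  exact DFunLike.congr_fun (pairSign_coverV (s := s) p) _

end Sign

/-! ### Supermodules as spaces with operators -/

/-- The sign `(-1) ^ i` for `i : ZMod 2`, as an element of a field. -/
def paritySign (L : Type*) [Field L] (i : ZMod 2) : L := if i = 0 then 1 else -1

theorem paritySign_zero (L : Type*) [Field L] : paritySign L 0 = 1 := rfl

theorem paritySign_one (L : Type*) [Field L] : paritySign L 1 = -1 := rfl

theorem paritySign_add (L : Type*) [Field L] (i j : ZMod 2) :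
    paritySign L (i + j) = paritySign L i * paritySign L j := by
  have hz : ∀ x : ZMod 2, x = 0 ∨ x = 1 := by decide
  have h11 : (1 : ZMod 2) + 1 = 0 := by decide
  rcases hz i with rfl | rfl <;> rcases hz j with rfl | rfl <;>
    simp [h11, paritySign_zero, paritySign_one]

/-- The grading by the eigenspaces of an involution. -/
def signGrade {L N : Type*} [Field L] [AddCommGroup N] [Module L N] (s : Module.End L N)
    (i : ZMod 2) : Submodule L N := LinearMap.ker (s - paritySign L i • 1)

theorem mem_signGrade {L N : Type*} [Field L] [AddCommGroup N] [Module L N]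
    {s : Module.End L N} {i : ZMod 2} {x : N} :
    x ∈ signGrade s i ↔ s x = paritySign L i • x := by
  rw [signGrade, LinearMap.mem_ker, LinearMap.sub_apply, sub_eq_zero]
  rfl

theorem isCompl_signGrade {L N : Type*} [Field L] [AddCommGroup N] [Module L N]
    (h2 : (2 : L) ≠ 0) {s : Module.End L N} (hs : s * s = 1) :
    IsCompl (signGrade s 0) (signGrade s 1) := by
  have hs' : ∀ x, s (s x) = x := fun x => DFunLike.congr_fun hs x
  constructor
  · rw [Submodule.disjoint_def]
    intro x h0 h1
    rw [mem_signGrade, paritySign_zero, one_smul] at h0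
    rw [mem_signGrade, paritySign_one, neg_smul, one_smul, h0, eq_neg_iff_add_eq_zero,
      ← two_smul L] at h1
    exact (smul_eq_zero.mp h1).resolve_left h2
  · rw [codisjoint_iff, eq_top_iff]
    intro x _
    refine Submodule.mem_sup.mpr ⟨(2⁻¹ : L) • (x + s x), ?_, (2⁻¹ : L) • (x - s x), ?_, ?_⟩
    · rw [mem_signGrade, paritySign_zero, one_smul, map_smul, map_add, hs', add_comm]
    · rw [mem_signGrade, paritySign_one, neg_smul, one_smul, map_smul, map_sub, hs', ← smul_neg,
        neg_sub]
    · rw [← smul_add, add_add_sub_cancel, ← two_smul L, smul_smul, inv_mul_cancel₀ h2, one_smul]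

namespace SuperModule

section General

variable {K : Type u} [Field K] {S : Type u} [Ring S] [Algebra K S] {𝒮 : ZMod 2 → Submodule K S}
  (M N : SuperModule K 𝒮)

/-- The parity involution of a supermodule. -/
def sgn : Module.End K M.V :=
  (M.grade 0).projection (M.grade 1) M.isCompl -
    (M.grade 1).projection (M.grade 0) M.isCompl.symm

variable {M N}

theorem sgn_of_mem {i : ZMod 2} {x : M.V} (hx : x ∈ M.grade i) :
    M.sgn x = paritySign K i • x := by
  have hz : ∀ x : ZMod 2, x = 0 ∨ x = 1 := by decide
  rw [sgn, LinearMap.sub_apply]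
  rcases hz i with rfl | rfl
  · rw [Submodule.projection_apply_of_mem_left _ hx, Submodule.projection_apply_of_mem_right _ hx,
      paritySign_zero, sub_zero, one_smul]
  · rw [Submodule.projection_apply_of_mem_left _ hx, Submodule.projection_apply_of_mem_right _ hx,
      paritySign_one, zero_sub, neg_smul, one_smul]

theorem grade_induction {motive : M.V → Prop} (mem : ∀ i x, x ∈ M.grade i → motive x)
    (add : ∀ x y, motive x → motive y → motive (x + y)) (x : M.V) : motive x := by
  have hx : x ∈ M.grade 0 ⊔ M.grade 1 := by rw [M.isCompl.sup_eq_top]; trivial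
  obtain ⟨y, hy, z, hz, rfl⟩ := Submodule.mem_sup.mp hx
  exact add _ _ (mem 0 y hy) (mem 1 z hz)

theorem mem_grade_iff (h2 : (2 : K) ≠ 0) {i : ZMod 2} {x : M.V} :
    x ∈ M.grade i ↔ M.sgn x = paritySign K i • x := by
  refine ⟨sgn_of_mem, fun h => ?_⟩
  have hx : x ∈ M.grade 0 ⊔ M.grade 1 := by rw [M.isCompl.sup_eq_top]; trivial
  obtain ⟨y, hy, z, hz, rfl⟩ := Submodule.mem_sup.mp hx
  have hi : ∀ x : ZMod 2, x = 0 ∨ x = 1 := by decide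
  rw [map_add, sgn_of_mem hy, sgn_of_mem hz, paritySign_zero, paritySign_one, one_smul, neg_smul,
    one_smul] at h
  rcases hi i with rfl | rfl
  · rw [paritySign_zero, one_smul, add_right_inj, neg_eq_iff_add_eq_zero, ← two_smul K] at h
    rw [(smul_eq_zero.mp h).resolve_left h2, add_zero]
    exact hy
  · rw [paritySign_one, neg_smul, one_smul, neg_add, add_left_inj, eq_neg_iff_add_eq_zero,
      ← two_smul K] at h
    rw [(smul_eq_zero.mp h).resolve_left h2, zero_add]
    exact hz

theorem sgn_sgn (x : M.V) : M.sgn (M.sgn x) = x := by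
  have hi : ∀ x : ZMod 2, x = 0 ∨ x = 1 := by decide
  induction x using grade_induction with
  | mem i x hx =>
    rw [sgn_of_mem hx, map_smul, sgn_of_mem hx, smul_smul]
    rcases hi i with rfl | rfl <;> simp [paritySign_zero, paritySign_one]
  | add x y hx hy => rw [map_add, map_add, hx, hy]

theorem sgn_act {i : ZMod 2} {s : S} (hs : s ∈ 𝒮 i) (x : M.V) :
    M.sgn (M.act s x) = paritySign K i • M.act s (M.sgn x) := by
  induction x using grade_induction with
  | mem j x hx =>
    rw [sgn_of_mem hx, sgn_of_mem (M.act_mem i j s x hs hx), paritySign_add, map_smul, smul_smul]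
  | add x y hx hy => simp only [map_add, hx, hy, smul_add]

theorem Hom.map_sgn (g : Hom M N) (x : M.V) :
    g.toLinearMap (M.sgn x) = N.sgn (g.toLinearMap x) := by
  induction x using grade_induction with
  | mem j x hx => rw [sgn_of_mem hx, sgn_of_mem (g.map_grade j x hx), map_smul]
  | add x y hx hy => simp only [map_add, hx, hy]

end General

section P1Modules

variable {k : Type u} [Field k] {p : ℕ} {L : Type u} [Field L] [Algebra k L]

/-- Supermodules over `L ⊗ ℙ_1`. -/
abbrev Fiber (k : Type u) [Field k] (p : ℕ) (L : Type u) [Field L] [Algebra k L] : Type (u + 1) :=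
  SuperModule L (fun i => (Pr.parity k p 1 i).baseChange L)

variable (M N : Fiber k p L)

/-- The action of the even generator `u`. -/
def opU : Module.End L M.V := M.act (1 ⊗ₜ Pr.u k p 0)

/-- The action of the odd generator `v`. -/
def opV : Module.End L M.V := M.act (1 ⊗ₜ Pr.v k p 1)

theorem commute_opU_opV : Commute M.opU M.opV := by
  rw [Commute, SemiconjBy, opU, opV, ← map_mul, ← map_mul, Algebra.TensorProduct.tmul_mul_tmul,
    Algebra.TensorProduct.tmul_mul_tmul, mul_comm (Pr.u k p (0 : Fin 1))]

theorem opU_pow_add : M.opU ^ p + M.opV * M.opV = 0 := by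
  rw [opU, opV, ← map_pow, ← map_mul, ← map_add, Algebra.TensorProduct.tmul_pow,
    Algebra.TensorProduct.tmul_mul_tmul, one_pow, one_mul, ← TensorProduct.tmul_add, ← pow_two,
    Pr.u_pow_last _ rfl, TensorProduct.tmul_zero, map_zero]

theorem commute_sgn_opU : Commute M.sgn M.opU := LinearMap.ext fun x => by
  rw [Module.End.mul_apply, Module.End.mul_apply, opU,
    sgn_act (Submodule.tmul_mem_baseChange_of_mem 1 (Pr.u_mem k p 1 0)), paritySign_zero, one_smul]

theorem sgn_mul_opV : M.sgn * M.opV = -(M.opV * M.sgn) := LinearMap.ext fun x => by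
  rw [Module.End.mul_apply, LinearMap.neg_apply, Module.End.mul_apply, opV,
    sgn_act (Submodule.tmul_mem_baseChange_of_mem 1 (Pr.v_mem k p 1)), paritySign_one, neg_smul,
    one_smul]

variable {M N}

theorem act_tmul (c : L) (s : Pr k p 1) : M.act (c ⊗ₜ s) = c • M.act (1 ⊗ₜ s) := by
  rw [← map_smul, TensorProduct.smul_tmul', smul_eq_mul, mul_one]

/-- A linear map that commutes with the parity involutions and with the generators is an even
homomorphism. -/
def homOfOps (h2 : (2 : L) ≠ 0) (l : M.V →ₗ[L] N.V) (hs : ∀ x, l (M.sgn x) = N.sgn (l x))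
    (hU : ∀ x, l (M.opU x) = N.opU (l x)) (hV : ∀ x, l (M.opV x) = N.opV (l x)) : Hom M N where
  toLinearMap := l
  map_grade := fun i x hx => by
    rw [mem_grade_iff h2, ← hs, sgn_of_mem hx, map_smul]
  map_act := fun s => by
    induction s with
    | zero => intro x; simp
    | add s t hs ht => intro x; simp only [map_add, LinearMap.add_apply, hs, ht]
    | tmul c s =>
      intro x
      rw [act_tmul (M := M), act_tmul (M := N), LinearMap.smul_apply, LinearMap.smul_apply,
        map_smul]
      congr 1
      induction s using Pr.induction generalizing x with
      | one =>
        have h1 : (1 : L) ⊗ₜ[k] (1 : Pr k p 1) = 1 := rfl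
        rw [h1, map_one, map_one]
        rfl
      | mul_u s i h =>
        have h1 : (1 : L) ⊗ₜ[k] (s * Pr.u k p i) = (1 ⊗ₜ s) * (1 ⊗ₜ Pr.u k p 0) := by
          rw [Algebra.TensorProduct.tmul_mul_tmul, one_mul, Subsingleton.elim i 0]
        rw [h1, map_mul, map_mul, Module.End.mul_apply, Module.End.mul_apply, h]
        exact congrArg _ (hU x)
      | mul_v s h =>
        have h1 : (1 : L) ⊗ₜ[k] (s * Pr.v k p 1) = (1 ⊗ₜ s) * (1 ⊗ₜ Pr.v k p 1) := by
          rw [Algebra.TensorProduct.tmul_mul_tmul, one_mul]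
        rw [h1, map_mul, map_mul, Module.End.mul_apply, Module.End.mul_apply, h]
        exact congrArg _ (hV x)
      | add s t hs ht =>
        simp only [TensorProduct.tmul_add, map_add, LinearMap.add_apply, hs, ht]
      | smul a s hs =>
        rw [TensorProduct.tmul_smul, ← algebraMap_smul L a ((1 : L) ⊗ₜ[k] s), map_smul, map_smul,
          LinearMap.smul_apply, LinearMap.smul_apply, map_smul, hs]

theorem Hom.map_opU (g : Hom M N) (x : M.V) :
    g.toLinearMap (M.opU x) = N.opU (g.toLinearMap x) := g.map_act _ x

theorem Hom.map_opV (g : Hom M N) (x : M.V) :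
    g.toLinearMap (M.opV x) = N.opV (g.toLinearMap x) := g.map_act _ x

section OfOps

variable {X : Type u} [AddCommGroup X] [Module L X]

variable (k) in
/-- The `k`-algebra structure on the `L`-linear endomorphisms of an `L`-vector space. -/
abbrev endAlgebra (L : Type u) [Field L] [Algebra k L] (X : Type u) [AddCommGroup X] [Module L X] :
    Algebra k (Module.End L X) :=
  ((algebraMap L (Module.End L X)).comp (algebraMap k L)).toAlgebra'
    fun c x => Algebra.commutes (algebraMap k L c) x

variable {U V s : Module.End L X}

/-- The action of `L ⊗ ℙ_1` given by operators `U` and `V`. -/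
def opsAct (hUV : Commute U V) (hrel : U ^ p + V * V = 0) :
    L ⊗[k] Pr k p 1 →ₐ[L] Module.End L X :=
  letI := endAlgebra k L X
  haveI : IsScalarTower k L (Module.End L X) := IsScalarTower.of_algebraMap_eq fun _ => rfl
  Algebra.TensorProduct.lift (Algebra.ofId L (Module.End L X))
    (Pr.lift (fun c => match c with
      | some _ => U
      | none => V)
      (fun i j => by
        cases i <;> cases j
        · rfl
        · exact hUV.eq.symm
        · exact hUV.eq
        · rfl)
      (fun i hi => absurd i.2 (by omega))
      (fun i hi => by rw [pow_two]; exact hrel))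
    (fun a s => by rw [Algebra.ofId_apply]; exact Algebra.commute_algebraMap_left a _)

theorem opsAct_u (hUV : Commute U V) (hrel : U ^ p + V * V = 0) :
    opsAct (k := k) hUV hrel (1 ⊗ₜ Pr.u k p 0) = U := by
  let _ := endAlgebra k L X
  have : IsScalarTower k L (Module.End L X) := IsScalarTower.of_algebraMap_eq fun _ => rfl
  rw [opsAct, Algebra.TensorProduct.lift_tmul, map_one, one_mul]
  exact Pr.lift_u _ _ _ _ _

theorem opsAct_v (hUV : Commute U V) (hrel : U ^ p + V * V = 0) :
    opsAct (k := k) hUV hrel (1 ⊗ₜ Pr.v k p 1) = V := by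
  let _ := endAlgebra k L X
  have : IsScalarTower k L (Module.End L X) := IsScalarTower.of_algebraMap_eq fun _ => rfl
  rw [opsAct, Algebra.TensorProduct.lift_tmul, map_one, one_mul]
  exact Pr.lift_v _ _ _ _

theorem opsAct_sign (hUV : Commute U V) (hrel : U ^ p + V * V = 0) (hU : Commute s U)
    (hV : s * V = -(V * s)) (i : ZMod 2) (t : L ⊗[k] Pr k p 1)
    (ht : t ∈ (Pr.parity k p 1 i).baseChange L) :
    s * opsAct (k := k) hUV hrel t = paritySign L i • (opsAct (k := k) hUV hrel t * s) := by
  have hmon : ∀ d : Option (Fin 1) →₀ ℕ,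
      s * opsAct (k := k) hUV hrel (1 ⊗ₜ Pr.mk k p 1 (MvPolynomial.monomial d 1)) =
        paritySign L ((d none : ℕ) : ZMod 2) •
          (opsAct (k := k) hUV hrel (1 ⊗ₜ Pr.mk k p 1 (MvPolynomial.monomial d 1)) * s) := by
    intro d
    induction d using Finsupp.induction_linear with
    | zero =>
      have h1 : (1 : L) ⊗ₜ[k] Pr.mk k p 1 (MvPolynomial.monomial 0 1) = 1 := by
        rw [MvPolynomial.monomial_zero', map_one, map_one]
        rfl
      rw [h1, map_one, mul_one, one_mul]
      simp [paritySign_zero]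
    | add d e hd he =>
      have h1 : (1 : L) ⊗ₜ[k] Pr.mk k p 1 (MvPolynomial.monomial (d + e) 1) =
          (1 ⊗ₜ Pr.mk k p 1 (MvPolynomial.monomial d 1)) *
            (1 ⊗ₜ Pr.mk k p 1 (MvPolynomial.monomial e 1)) := by
        rw [Algebra.TensorProduct.tmul_mul_tmul, one_mul, ← map_mul, MvPolynomial.monomial_mul,
          one_mul]
      rw [h1, map_mul, ← mul_assoc, hd, smul_mul_assoc, mul_assoc, he, mul_smul_comm, smul_smul,
        Finsupp.add_apply, Nat.cast_add, paritySign_add, mul_assoc]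
    | single c n =>
      have h1 : (1 : L) ⊗ₜ[k] Pr.mk k p 1 (MvPolynomial.monomial (Finsupp.single c n) 1) =
          (1 ⊗ₜ Pr.mk k p 1 (MvPolynomial.X c)) ^ n := by
        rw [Algebra.TensorProduct.tmul_pow, one_pow, ← map_pow, MvPolynomial.X_pow_eq_monomial]
      rw [h1, map_pow]
      cases c with
      | none =>
        have h2 : opsAct (k := k) hUV hrel (1 ⊗ₜ Pr.mk k p 1 (MvPolynomial.X none)) = V :=
          opsAct_v hUV hrel
        rw [h2, Finsupp.single_eq_same]
        induction n with
        | zero => simp [paritySign_zero]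
        | succ n ih =>
          rw [pow_succ, ← mul_assoc, ih (by
            rw [Algebra.TensorProduct.tmul_pow, one_pow, ← map_pow,
              MvPolynomial.X_pow_eq_monomial]), smul_mul_assoc, mul_assoc, hV, Nat.cast_succ,
            paritySign_add, paritySign_one, mul_neg, smul_neg, mul_neg, mul_one, neg_smul,
            mul_assoc]
      | some i =>
        have h2 : opsAct (k := k) hUV hrel (1 ⊗ₜ Pr.mk k p 1 (MvPolynomial.X (some i))) = U := by
          rw [Subsingleton.elim i 0]
          exact opsAct_u hUV hrel
        rw [h2, (hU.pow_right n).eq]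
        simp [paritySign_zero]
  refine Pr.baseChange_induction (P := fun t => s * opsAct (k := k) hUV hrel t =
    paritySign L i • (opsAct (k := k) hUV hrel t * s)) (Pr.parity k p 1 i)
    (fun c y hy => ?_) (fun a b ha hb => ?_) t ht
  · have h1 : c ⊗ₜ[k] y = c • ((1 : L) ⊗ₜ[k] y) := by
      rw [TensorProduct.smul_tmul', smul_eq_mul, mul_one]
    rw [h1, map_smul, mul_smul_comm, smul_mul_assoc, smul_comm (paritySign L i)]
    congr 1
    clear h1
    rw [Pr.parity] at hy
    induction hy using Submodule.span_induction with
    | zero => simp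
    | add a b _ _ ha hb =>
      rw [TensorProduct.tmul_add, map_add, mul_add, ha, hb, add_mul, smul_add]
    | smul a b _ hb =>
      rw [TensorProduct.tmul_smul, ← algebraMap_smul L a ((1 : L) ⊗ₜ[k] b), map_smul,
        mul_smul_comm, hb, smul_mul_assoc, smul_comm]
    | mem x hx =>
      obtain ⟨d, rfl, rfl⟩ := hx
      exact hmon d
  · rw [map_add, mul_add, ha, hb, add_mul, smul_add]

/-- The supermodule given by an involution `s`, an operator `U` that commutes with `s` and an
operator `V` that anticommutes with `s`. -/
def ofOps (h2 : (2 : L) ≠ 0) (hs : s * s = 1) (hUV : Commute U V) (hrel : U ^ p + V * V = 0)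
    (hU : Commute s U) (hV : s * V = -(V * s)) : Fiber k p L where
  V := X
  grade := signGrade s
  isCompl := isCompl_signGrade h2 hs
  act := opsAct hUV hrel
  act_mem := fun i j t x ht hx => by
    rw [mem_signGrade] at hx ⊢
    have := DFunLike.congr_fun (opsAct_sign hUV hrel hU hV i t ht) x
    rw [Module.End.mul_apply, LinearMap.smul_apply, Module.End.mul_apply, hx, map_smul,
      smul_smul] at this
    rw [this, paritySign_add]

variable (h2 : (2 : L) ≠ 0) (hs : s * s = 1) (hUV : Commute U V) (hrel : U ^ p + V * V = 0)
  (hU : Commute s U) (hV : s * V = -(V * s))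

theorem ofOps_opU : (ofOps (k := k) h2 hs hUV hrel hU hV).opU = U := opsAct_u hUV hrel

theorem ofOps_opV : (ofOps (k := k) h2 hs hUV hrel hU hV).opV = V := opsAct_v hUV hrel

theorem ofOps_sgn : (ofOps (k := k) h2 hs hUV hrel hU hV).sgn = s := by
  refine LinearMap.ext fun x => ?_
  induction x using grade_induction with
  | mem i x hx => rw [sgn_of_mem hx]; exact (mem_signGrade.mp hx).symm
  | add x y hx hy => rw [map_add, hx, hy]; exact (map_add s x y).symm

end OfOps

end P1Modules

end SuperModule

end SuperSupport

namespace SuperSupport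
namespace SuperModule

/-! ### The criterion for infinite projective dimension -/

variable {k : Type u} [Field k] {p : ℕ} {L : Type u} [Field L] [Algebra k L] {M N P : Fiber k p L}

/-- A relative projectivity criterion in the style of Higman: a supermodule that is free over
`L[u]` and has an `L[u]`-linear contraction of `v` is projective. For an `L[u]`-linear lift `l`,
the map `v l h + l h v` is a lift that also commutes with `v`; its even part is the required even
homomorphism. -/
theorem isProjective_of_contraction (h2 : (2 : L) ≠ 0) {W : Type u} [AddCommGroup W] [Module L W]
    {j : W →ₗ[L] P.V} (hfree : IsFreeOver.{u} P.opU j) {h : Module.End L P.V}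
    (hUh : Commute P.opU h) (hc : P.opV * h + h * P.opV = 1) : P.IsProjective := by
  intro M N g f hg
  obtain ⟨r, hr⟩ := g.toLinearMap.exists_rightInverse_of_surjective (LinearMap.range_eq_top.mpr hg)
  obtain ⟨l₁, hl₁, hl₁j⟩ := hfree.lift M.opU (r ∘ₗ f.toLinearMap ∘ₗ j)
  have hgl₁ : g.toLinearMap ∘ₗ l₁ = f.toLinearMap := by
    refine hfree.ext N.opU _ _ (LinearMap.ext fun x => ?_) (LinearMap.ext fun x => f.map_opU x) ?_
    · have := DFunLike.congr_fun hl₁ x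
      simp only [LinearMap.comp_apply] at this ⊢
      rw [this, g.map_opU]
    · rw [LinearMap.comp_assoc, hl₁j, ← LinearMap.comp_assoc, hr, LinearMap.id_comp]
  have gl : ∀ x, g.toLinearMap (l₁ x) = f.toLinearMap x := DFunLike.congr_fun hgl₁
  have lU : ∀ x, l₁ (P.opU x) = M.opU (l₁ x) := DFunLike.congr_fun hl₁
  have hU : ∀ x, h (P.opU x) = P.opU (h x) := DFunLike.congr_fun hUh.symm.eq
  have hUp : ∀ x, h ((P.opU ^ p) x) = (P.opU ^ p) (h x) :=
    DFunLike.congr_fun (hUh.symm.pow_right p).eq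
  have lUp : ∀ x, l₁ ((P.opU ^ p) x) = (M.opU ^ p) (l₁ x) := by
    have : ∀ n x, l₁ ((P.opU ^ n) x) = (M.opU ^ n) (l₁ x) := fun n => by
      induction n with
      | zero => exact fun x => rfl
      | succ n ih =>
        intro x
        rw [pow_succ', pow_succ', Module.End.mul_apply, Module.End.mul_apply, lU, ih]
    exact this p
  have hc' : ∀ x, P.opV (h x) + h (P.opV x) = x := DFunLike.congr_fun hc
  have hM : ∀ x, M.opV (M.opV x) = -(M.opU ^ p) x := fun x =>
    (neg_eq_of_add_eq_zero_right (DFunLike.congr_fun M.opU_pow_add x)).symm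
  have hP : ∀ x, P.opV (P.opV x) = -(P.opU ^ p) x := fun x =>
    (neg_eq_of_add_eq_zero_right (DFunLike.congr_fun P.opU_pow_add x)).symm
  have hUV : ∀ (Q : Fiber k p L) x, Q.opU (Q.opV x) = Q.opV (Q.opU x) :=
    fun Q => DFunLike.congr_fun Q.commute_opU_opV.eq
  have hsU : ∀ (Q : Fiber k p L) x, Q.sgn (Q.opU x) = Q.opU (Q.sgn x) :=
    fun Q => DFunLike.congr_fun Q.commute_sgn_opU.eq
  have hsV : ∀ (Q : Fiber k p L) x, Q.sgn (Q.opV x) = -Q.opV (Q.sgn x) :=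
    fun Q => DFunLike.congr_fun Q.sgn_mul_opV
  set l : P.V →ₗ[L] M.V := M.opV ∘ₗ l₁ ∘ₗ h + l₁ ∘ₗ h ∘ₗ P.opV with hl
  have l_apply : ∀ x, l x = M.opV (l₁ (h x)) + l₁ (h (P.opV x)) := fun x => rfl
  have l_U : ∀ x, l (P.opU x) = M.opU (l x) := fun x => by
    rw [l_apply, l_apply, hU, lU, ← hUV, ← hUV, hU, lU, map_add]
  have l_V : ∀ x, l (P.opV x) = M.opV (l x) := fun x => by
    rw [l_apply, l_apply, map_add, hM, hP, map_neg, map_neg, hUp, lUp, add_comm]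
  have l_g : ∀ x, g.toLinearMap (l x) = f.toLinearMap x := fun x => by
    rw [l_apply, map_add, g.map_opV, gl, gl, ← f.map_opV, ← map_add, hc']
  refine ⟨homOfOps h2 ((2⁻¹ : L) • (l + M.sgn ∘ₗ l ∘ₗ P.sgn)) (fun x => ?_) (fun x => ?_)
    (fun x => ?_), fun x => ?_⟩
  · simp only [LinearMap.smul_apply, LinearMap.add_apply, LinearMap.comp_apply, map_smul, map_add,
      sgn_sgn]
    rw [add_comm]
  · simp only [LinearMap.smul_apply, LinearMap.add_apply, LinearMap.comp_apply, map_smul, map_add,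
      hsU, l_U]
  · simp only [LinearMap.smul_apply, LinearMap.add_apply, LinearMap.comp_apply, map_smul, map_add,
      hsV, l_V, map_neg, neg_neg]
  · change g.toLinearMap ((2⁻¹ : L) • (l x + M.sgn (l (P.sgn x)))) = _
    rw [map_smul, map_add, g.map_sgn, l_g, l_g, f.map_sgn, sgn_sgn, ← two_smul L, smul_smul,
      inv_mul_cancel₀ h2, one_smul]

variable (M) in
/-- The differential `mfDiff` of a supermodule over `L ⊗ ℙ_1`. -/
def diff : Module.End L (M.V × M.V) := mfDiff p M.opU M.opV

variable (M) in
/-- The free supermodule `N[u] ⊕ v N[u]` that covers `N`. -/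
def cover (h2 : (2 : L) ≠ 0) : Fiber k p L :=
  ofOps (k := k) (p := p) (s := pairSign M.sgn) (U := pairShift L M.V) (V := coverV L M.V p) h2
    (pairSign_sq (LinearMap.ext sgn_sgn)) (commute_pairShift_coverV p)
    (by rw [coverV_sq, add_neg_cancel]) commute_pairSign_pairShift
    (pairSign_coverV p)

variable (M) in
/-- The kernel of `cover M → M`. -/
def coverKernel (h2 : (2 : L) ≠ 0) : Fiber k p L :=
  ofOps (k := k) (p := p) (s := pairSign M.sgn) (U := pairShift L M.V)
    (V := kernelV p M.opU M.opV) h2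
    (pairSign_sq (LinearMap.ext sgn_sgn))
    (commute_pairShift_kernelV M.commute_opU_opV M.opU_pow_add)
    (by rw [kernelV_sq M.commute_opU_opV M.opU_pow_add, add_neg_cancel])
    commute_pairSign_pairShift
    (pairSign_kernelV M.commute_sgn_opU M.sgn_mul_opV M.commute_opU_opV M.opU_pow_add)

theorem cover_sgn_apply (h2 : (2 : L) ≠ 0) (x : (ℕ →₀ M.V) × (ℕ →₀ M.V)) :
    (M.cover h2).sgn x = pairSign M.sgn x := DFunLike.congr_fun (ofOps_sgn ..) x

theorem cover_opU_apply (h2 : (2 : L) ≠ 0) (x : (ℕ →₀ M.V) × (ℕ →₀ M.V)) :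
    (M.cover h2).opU x = pairShift L M.V x := DFunLike.congr_fun (ofOps_opU ..) x

theorem cover_opV_apply (h2 : (2 : L) ≠ 0) (x : (ℕ →₀ M.V) × (ℕ →₀ M.V)) :
    (M.cover h2).opV x = coverV L M.V p x := DFunLike.congr_fun (ofOps_opV ..) x

theorem coverKernel_sgn_apply (h2 : (2 : L) ≠ 0) (x : (ℕ →₀ M.V) × (ℕ →₀ M.V)) :
    (M.coverKernel h2).sgn x = pairSign M.sgn x := DFunLike.congr_fun (ofOps_sgn ..) x

theorem coverKernel_opU_apply (h2 : (2 : L) ≠ 0) (x : (ℕ →₀ M.V) × (ℕ →₀ M.V)) :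
    (M.coverKernel h2).opU x = pairShift L M.V x := DFunLike.congr_fun (ofOps_opU ..) x

theorem coverKernel_opV_apply (h2 : (2 : L) ≠ 0) (x : (ℕ →₀ M.V) × (ℕ →₀ M.V)) :
    (M.coverKernel h2).opV x = kernelV p M.opU M.opV x := DFunLike.congr_fun (ofOps_opV ..) x

variable (M) in
/-- The covering map. -/
def coverHom (h2 : (2 : L) ≠ 0) : Hom (M.cover h2) M :=
  homOfOps h2 (M := M.cover h2) (coverProj M.opU M.opV)
    (fun x => (congrArg (coverProj M.opU M.opV) (cover_sgn_apply h2 x)).trans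
      (coverProj_pairSign M.commute_sgn_opU M.sgn_mul_opV x))
    (fun x => (congrArg (coverProj M.opU M.opV) (cover_opU_apply h2 x)).trans
      (coverProj_pairShift _ _ M.commute_opU_opV x))
    (fun x => (congrArg (coverProj M.opU M.opV) (cover_opV_apply h2 x)).trans
      (coverProj_coverV M.opU_pow_add x))

variable (M) in
/-- The inclusion of the kernel of the covering map. -/
def coverKernelHom (h2 : (2 : L) ≠ 0) : Hom (M.coverKernel h2) (M.cover h2) :=
  homOfOps h2 (M := M.coverKernel h2) (N := M.cover h2) (kernelIncl M.opU M.opV)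
    (fun x => (congrArg (kernelIncl M.opU M.opV) (coverKernel_sgn_apply h2 x)).trans
      ((kernelIncl_pairSign M.commute_sgn_opU M.sgn_mul_opV x).trans
        (cover_sgn_apply h2 _).symm))
    (fun x => (congrArg (kernelIncl M.opU M.opV) (coverKernel_opU_apply h2 x)).trans
      ((kernelIncl_pairShift _ _ x).trans (cover_opU_apply h2 _).symm))
    (fun x => (congrArg (kernelIncl M.opU M.opV) (coverKernel_opV_apply h2 x)).trans
      ((kernelIncl_kernelV M.commute_opU_opV M.opU_pow_add x).trans (cover_opV_apply h2 _).symm))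

theorem ofOps_isProjective {X : Type u} [AddCommGroup X] [Module L X] {U V s : Module.End L X}
    (h2 : (2 : L) ≠ 0) (hs : s * s = 1) (hUV : Commute U V) (hrel : U ^ p + V * V = 0)
    (hU : Commute s U) (hV : s * V = -(V * s)) {W : Type u} [AddCommGroup W] [Module L W]
    {j : W →ₗ[L] X} (hfree : IsFreeOver.{u} U j) {h : Module.End L X} (hUh : Commute U h)
    (hc : V * h + h * V = 1) : (ofOps (k := k) h2 hs hUV hrel hU hV).IsProjective := by
  -- the operators of `ofOps` are `U` and `V` only up to a propositional equality
  -- the operators of `ofOps` are `U` and `V` only up to a propositional equality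
  have eU : ∀ T : Module.End L X, T = U → IsFreeOver.{u} T j ∧ Commute T h := by
    rintro T rfl
    exact ⟨hfree, hUh⟩
  have eV : ∀ T : Module.End L X, T = V → T * h + h * T = 1 := by
    rintro T rfl
    exact hc
  exact isProjective_of_contraction h2 (P := ofOps (k := k) h2 hs hUV hrel hU hV) (j := j) (h := h)
    (eU _ (ofOps_opU ..)).1 (eU _ (ofOps_opU ..)).2 (eV _ (ofOps_opV ..))

theorem cover_isProjective (h2 : (2 : L) ≠ 0) : (M.cover h2).IsProjective := by
  obtain ⟨h, hh, hc⟩ := exists_contraction_coverV (L := L) (N := M.V) p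
  exact ofOps_isProjective _ _ _ _ _ _ isFreeOver_pairShift hh hc

theorem coverKernel_isProjective (h2 : (2 : L) ≠ 0) (hp : Odd p)
    (hM : Function.Exact M.diff M.diff) : (M.coverKernel h2).IsProjective := by
  obtain ⟨h₀, hh₀⟩ := exists_contraction_of_exact M.diff hM
  obtain ⟨V', hV', hV'j⟩ := exists_kernelV_const (U := M.opU) (V := M.opV) hp.pos.ne'
  have hinj : Function.Injective (pairShift L M.V) :=
    (polyShift_injective (L := L)).prodMap (polyShift_injective (L := L))
  obtain ⟨h, hh, hc⟩ := (isFreeOver_pairShift (L := L) (N := M.V)).exists_contraction h2 hp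
    hinj (commute_pairShift_kernelV M.commute_opU_opV M.opU_pow_add) hV'
    (kernelV_sq M.commute_opU_opV M.opU_pow_add) hh₀ hV'j
  exact ofOps_isProjective _ _ _ _ _ _ isFreeOver_pairShift hh hc

theorem diff_exact_of_isProjective (h2 : (2 : L) ≠ 0) (hp : p ≠ 0) (hP : P.IsProjective) :
    Function.Exact P.diff P.diff := by
  obtain ⟨l, hl⟩ := hP (P.cover h2) P (P.coverHom h2)
    (homOfOps h2 LinearMap.id (fun _ => rfl) (fun _ => rfl) (fun _ => rfl))
    (coverProj_surjective _ _)
  obtain ⟨h, hh, hc⟩ := exists_contraction_coverV (L := L) (N := P.V) p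
  -- a retract of the free cover inherits the contraction
  let l' : P.V →ₗ[L] (ℕ →₀ P.V) × (ℕ →₀ P.V) := l.toLinearMap
  have hl' : ∀ x, coverProj P.opU P.opV (l' x) = x := hl
  have lU : ∀ x, l' (P.opU x) = pairShift L P.V (l' x) := fun x =>
    (l.map_opU x).trans (cover_opU_apply h2 _)
  have lV : ∀ x, l' (P.opV x) = coverV L P.V p (l' x) := fun x =>
    (l.map_opV x).trans (cover_opV_apply h2 _)
  have hh' : ∀ x, h (pairShift L P.V x) = pairShift L P.V (h x) := DFunLike.congr_fun hh.symm.eq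
  have hc' : ∀ x, coverV L P.V p (h x) + h (coverV L P.V p x) = x := DFunLike.congr_fun hc
  clear_value l'
  refine mfDiff_exact_of_contraction hp P.commute_opU_opV P.opU_pow_add
    (h := coverProj P.opU P.opV ∘ₗ h ∘ₗ l') (LinearMap.ext fun x => ?_) (LinearMap.ext fun x => ?_)
  · simp only [Module.End.mul_apply, LinearMap.comp_apply]
    rw [lU, hh', coverProj_pairShift _ _ P.commute_opU_opV]
  · simp only [Module.End.mul_apply, LinearMap.comp_apply, LinearMap.add_apply,
      Module.End.one_apply]
    rw [lV, ← coverProj_coverV P.opU_pow_add, ← map_add, hc', hl']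

theorem Hom.map_diff (g : Hom M N) (z : M.V × M.V) :
    Prod.map g.toLinearMap g.toLinearMap (M.diff z) =
      N.diff (Prod.map g.toLinearMap g.toLinearMap z) := by
  have hn : ∀ n x, g.toLinearMap ((M.opU ^ n) x) = (N.opU ^ n) (g.toLinearMap x) := fun n => by
    induction n with
    | zero => exact fun x => rfl
    | succ n ih =>
      intro x
      rw [pow_succ', pow_succ', Module.End.mul_apply, Module.End.mul_apply, g.map_opU, ih]
  simp only [diff, mfDiff_apply, Prod.map, map_sub, map_neg, g.map_opU, g.map_opV, hn]

theorem diff_diff (hp : p ≠ 0) (z : M.V × M.V) : M.diff (M.diff z) = 0 :=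
  mfDiff_mfDiff hp M.commute_opU_opV M.opU_pow_add z

/-- Exactness of `diff` passes to quotients in short exact sequences. -/
theorem diff_exact_of_shortExact (hp : p ≠ 0) (i : Hom N P) (q : Hom P M)
    (hi : Function.Injective i.toLinearMap) (hiq : Function.Exact i.toLinearMap q.toLinearMap)
    (hq : Function.Surjective q.toLinearMap) (hN : Function.Exact N.diff N.diff)
    (hP : Function.Exact P.diff P.diff) : Function.Exact M.diff M.diff := by
  have hi' : Function.Injective (Prod.map i.toLinearMap i.toLinearMap) := hi.prodMap hi
  have hex : ∀ y : P.V × P.V, Prod.map q.toLinearMap q.toLinearMap y = 0 →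
      ∃ z, Prod.map i.toLinearMap i.toLinearMap z = y := fun y hy => by
    obtain ⟨a, ha⟩ := (hiq y.1).mp (congrArg Prod.fst hy)
    obtain ⟨b, hb⟩ := (hiq y.2).mp (congrArg Prod.snd hy)
    exact ⟨(a, b), Prod.ext ha hb⟩
  have hqi : ∀ z, Prod.map q.toLinearMap q.toLinearMap
      (Prod.map i.toLinearMap i.toLinearMap z) = 0 := fun z =>
    Prod.ext (hiq.apply_apply_eq_zero z.1) (hiq.apply_apply_eq_zero z.2)
  have hsub : ∀ y z, Prod.map q.toLinearMap q.toLinearMap (y - z) =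
      Prod.map q.toLinearMap q.toLinearMap y - Prod.map q.toLinearMap q.toLinearMap z :=
    fun y z => Prod.ext (map_sub _ _ _) (map_sub _ _ _)
  intro x
  refine ⟨fun hx => ?_, ?_⟩
  · obtain ⟨y, rfl⟩ := (hq.prodMap hq) x
    rw [← q.map_diff] at hx
    obtain ⟨z, hz⟩ := hex _ hx
    have hdz : N.diff z = 0 := hi' (by
      rw [i.map_diff, hz, diff_diff hp]
      exact Prod.ext (map_zero _).symm (map_zero _).symm)
    obtain ⟨z', rfl⟩ := (hN z).mp hdz
    obtain ⟨y', hy'⟩ := (hP (y - Prod.map i.toLinearMap i.toLinearMap z')).mp (by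
      rw [map_sub, ← i.map_diff, hz, sub_self])
    refine ⟨Prod.map q.toLinearMap q.toLinearMap y', ?_⟩
    rw [← q.map_diff, hy', hsub, hqi, sub_zero]
  · rintro ⟨y, rfl⟩
    exact diff_diff hp y

theorem diff_exact_of_projDimLE (h2 : (2 : L) ≠ 0) (hp : p ≠ 0) (n : ℕ) :
    ∀ M : Fiber k p L, ProjDimLE n M → Function.Exact M.diff M.diff := by
  induction n with
  | zero => exact fun M hM => diff_exact_of_isProjective h2 hp hM
  | succ n ih =>
    rintro M ⟨N, P, i, q, hP, hi, hiq, hq, hN⟩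
    have hP' := diff_exact_of_isProjective h2 hp hP
    have hN' := ih N hN
    exact diff_exact_of_shortExact hp i q hi hiq hq hN' hP'

theorem projDimLE_one_of_diff_exact (h2 : (2 : L) ≠ 0) (hp : Odd p)
    (hM : Function.Exact M.diff M.diff) : ProjDimLE 1 M :=
  ⟨M.coverKernel h2, M.cover h2, M.coverKernelHom h2, M.coverHom h2, cover_isProjective h2,
    kernelIncl_injective _ _, kernelIncl_exact _ _ M.commute_opU_opV, coverProj_surjective _ _,
    coverKernel_isProjective h2 hp hM⟩

/-- A supermodule over `L ⊗ ℙ_1`, of any dimension, has infinite projective dimension if and only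
if the differential `diff` is not exact. -/
theorem projDim_eq_top_iff (h2 : (2 : L) ≠ 0) (hp : Odd p) :
    M.projDim = ⊤ ↔ ¬ Function.Exact M.diff M.diff := by
  constructor
  · intro h hM
    have h1 : ProjDimLE 1 M := projDimLE_one_of_diff_exact h2 hp hM
    have : M.projDim ≤ ((1 : ℕ) : ℕ∞) := iInf₂_le (f := fun n (_ : ProjDimLE n M) => (n : ℕ∞)) 1 h1
    rw [h, top_le_iff] at this
    exact ENat.natCast_ne_top 1 this
  · intro h
    rw [projDim, iInf₂_eq_top]
    exact fun n hn => absurd (diff_exact_of_projDimLE h2 hp.pos.ne' n M hn) h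

end SuperModule
/-! ### Field extensions -/

section Descent

theorem exact_iff_of_isBaseChange {K L : Type*} [Field K] [Field L] [Algebra K L] {N N' : Type*}
    [AddCommGroup N] [Module K N] [AddCommGroup N'] [Module K N'] [Module L N']
    [IsScalarTower K L N'] {j : N →ₗ[K] N'} (hj : IsBaseChange L j) (d : Module.End K N)
    (d' : Module.End L N') (hd : ∀ x, d' (j x) = j (d x)) :
    Function.Exact d' d' ↔ Function.Exact d d := by
  rw [← Module.FaithfullyFlat.lTensor_exact_iff_exact K L]
  let e := hj.equiv.restrictScalars K
  have he : ∀ z, d' (e z) = e (d.lTensor L z) := fun z => by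
    induction z with
    | zero => simp
    | add s t hs ht => simp only [map_add, hs, ht]
    | tmul c x =>
      change d' (hj.equiv (c ⊗ₜ x)) = hj.equiv (c ⊗ₜ d x)
      rw [hj.equiv_tmul, hj.equiv_tmul, map_smul, hd]
  exact Function.Exact.iff_of_ladder_linearEquiv (e₁ := e) (e₂ := e) (e₃ := e)
    (g₁₂ := d'.restrictScalars K) (g₂₃ := d'.restrictScalars K)
    (LinearMap.ext he) (LinearMap.ext he)

theorem mfDiff_exact_iff_of_isBaseChange {K L : Type*} [Field K] [Field L] [Algebra K L]
    {N N' : Type*} [AddCommGroup N] [Module K N] [AddCommGroup N'] [Module K N'] [Module L N']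
    [IsScalarTower K L N'] {j : N →ₗ[K] N'} (hj : IsBaseChange L j) (p : ℕ)
    {U V : Module.End K N} {U' V' : Module.End L N'} (hU : ∀ x, U' (j x) = j (U x))
    (hV : ∀ x, V' (j x) = j (V x)) :
    Function.Exact (mfDiff p U' V') (mfDiff p U' V') ↔
      Function.Exact (mfDiff p U V) (mfDiff p U V) := by
  have hn : ∀ n x, (U' ^ n) (j x) = j ((U ^ n) x) := fun n => by
    induction n with
    | zero => exact fun x => rfl
    | succ n ih =>
      intro x
      rw [pow_succ', pow_succ', Module.End.mul_apply, Module.End.mul_apply, ih, hU]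
  refine exact_iff_of_isBaseChange (hj.prodMap j j hj) _ _ fun x => ?_
  simp only [mfDiff_apply, LinearMap.prodMap_apply, hU, hV, hn, map_sub, map_neg]

variable {k K L W : Type u} [Field k] [Field K] [Field L] [Algebra k K] [Algebra k L]
  [AddCommGroup W] [Module k W]

/-- Exactness of `mfDiff` on `K ⊗ W` does not change under a field extension `κ : K → L`. -/
theorem mfDiff_exact_iff_of_push (κ : K →ₐ[k] L) (p : ℕ) {U V : Module.End K (K ⊗[k] W)}
    {U' V' : Module.End L (L ⊗[k] W)}
    (hU : ∀ x, U' (HopfHom.push κ W x) = HopfHom.push κ W (U x))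
    (hV : ∀ x, V' (HopfHom.push κ W x) = HopfHom.push κ W (V x)) :
    Function.Exact (mfDiff p U' V') (mfDiff p U' V') ↔
      Function.Exact (mfDiff p U V) (mfDiff p U V) := by
  let _ : Algebra K L := κ.toRingHom.toAlgebra
  have : IsScalarTower k K L := IsScalarTower.of_algebraMap_eq fun c => (κ.commutes c).symm
  let j : K ⊗[k] W →ₗ[K] L ⊗[k] W :=
    { HopfHom.push κ W with
      map_smul' := fun c x => by
        change HopfHom.push κ W (c • x) = c • HopfHom.push κ W x
        induction x with
        | zero => simp
        | add s t hs ht => simp only [smul_add, map_add, hs, ht]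
        | tmul a w =>
          rw [TensorProduct.smul_tmul', HopfHom.push_tmul, HopfHom.push_tmul,
            TensorProduct.smul_tmul', smul_eq_mul, map_mul, Algebra.smul_def]
          rfl }
  have hj : IsBaseChange L j := by
    refine IsBaseChange.of_comp (TensorProduct.isBaseChange k W K) ?_
    have h1 : (j.restrictScalars k) ∘ₗ TensorProduct.mk k K W 1 = TensorProduct.mk k L W 1 :=
      LinearMap.ext fun w => by
        change HopfHom.push κ W (1 ⊗ₜ w) = 1 ⊗ₜ w
        rw [HopfHom.push_tmul, map_one]
    rw [h1]
    exact TensorProduct.isBaseChange k W L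
  exact mfDiff_exact_iff_of_isBaseChange hj p hU hV

end Descent

/-! ### The fibers of the universal homomorphism -/

namespace HopfHom

section Coefficients

variable {k : Type u} [Field k] {A B : Type u} [CommRing A] [Algebra k A] [CommRing B]
  [Algebra k B] {Y Z : Type u} [Ring Y] [Algebra k Y] [Ring Z] [Algebra k Z]

theorem push_coeff (φ : A →ₐ[k] B) (f : Module.Dual k Y) (z : A ⊗[k] Y) :
    coeff f (push φ Y z) = φ (coeff f z) := by
  induction z with
  | zero => simp
  | add s t hs ht => simp only [map_add, hs, ht]
  | tmul a y => simp [coeff, push_tmul]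

theorem coeff_lTensor (g : Y →ₗ[k] Z) (f : Module.Dual k Z) (z : A ⊗[k] Y) :
    coeff f (g.lTensor A z) = coeff (f ∘ₗ g) z := by
  induction z with
  | zero => simp
  | add s t hs ht => simp only [map_add, hs, ht]
  | tmul a y => simp [coeff]

theorem coeff_smul (c : A) (f : Module.Dual k Y) (z : A ⊗[k] Y) :
    coeff f (c • z) = c * coeff f z := by
  induction z with
  | zero => simp
  | add s t hs ht => simp only [smul_add, map_add, hs, ht, mul_add]
  | tmul a y => simp [coeff, TensorProduct.smul_tmul']

end Coefficients

section

variable {k : Type u} [Field k] {A B C : Type u} [CommRing A] [Algebra k A] [CommRing B]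
  [Algebra k B] [CommRing C] [Algebra k C] {X Y Z : Type u} [Ring X] [Algebra k X]
  [CoalgebraStruct k X] [Ring Y] [Algebra k Y] [CoalgebraStruct k Y] [Ring Z] [Algebra k Z]
  [CoalgebraStruct k Z] {𝒳 : ZMod 2 → Submodule k X} {𝒴 : ZMod 2 → Submodule k Y}
  {𝒵 : ZMod 2 → Submodule k Z}

theorem push_push (φ : A →ₐ[k] B) (ψ : B →ₐ[k] C) {N : Type u} [AddCommGroup N] [Module k N]
    (z : A ⊗[k] N) : push ψ N (push φ N z) = push (ψ.comp φ) N z := by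
  induction z with
  | zero => simp
  | add s t hs ht => simp only [map_add, hs, ht]
  | tmul a n => rfl

theorem ofBialgHom_apply (f : X →ₐc[k] Y) (hf : ∀ (i : ZMod 2) (x : X), x ∈ 𝒳 i → f x ∈ 𝒴 i)
    (z : A ⊗[k] X) : (ofBialgHom (A := A) (𝒳 := 𝒳) (𝒴 := 𝒴) f hf).toBialgHom z =
      (f : X →ₗ[k] Y).lTensor A z := by
  induction z with
  | zero => simp
  | add s t hs ht => simp only [map_add, hs, ht]
  | tmul a x =>
    have h1 : (ofBialgHom (A := A) (𝒳 := 𝒳) (𝒴 := 𝒴) f hf).restr x = 1 ⊗ₜ f x :=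
      ofAlgHom_restr _ _ _ _ x
    rw [tmul_apply, h1, TensorProduct.smul_tmul', smul_eq_mul, mul_one]
    rfl

theorem ofBialgHom_comp_restr (f : Y →ₐc[k] Z)
    (hf : ∀ (i : ZMod 2) (x : Y), x ∈ 𝒴 i → f x ∈ 𝒵 i) (ρ : HopfHom A 𝒳 𝒴) (x : X) :
    ((ofBialgHom (𝒳 := 𝒴) (𝒴 := 𝒵) f hf).comp ρ).restr x =
      (f : Y →ₗ[k] Z).lTensor A (ρ.restr x) :=
  ofBialgHom_apply f hf _

/-- The matrix coefficients of the universal homomorphism are the generators of the representing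
algebra. -/
theorem coeff_universal_restr [Module.Finite k Y] (x : X) (f : Module.Dual k Y) :
    coeff f ((universal 𝒳 𝒴).restr x) = Ideal.Quotient.mk _ (MvPolynomial.X (x, f)) := by
  rw [← sub_eq_zero]
  refine rep_separated _ fun A _ _ σ => ?_
  rw [map_sub, classify_mk, evalPoly, MvPolynomial.aeval_X, ← push_coeff, universal,
    ofAlgHom_restr, push_universalAlgHom, sub_self]

theorem push_classify_universal_restr [Module.Finite k Y] (ρ : HopfHom A 𝒳 𝒴) (x : X) :
    push (classify ρ) Y ((universal 𝒳 𝒴).restr x) = ρ.restr x := by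
  rw [← baseChange_restr, universal_baseChange_classify]

end

end HopfHom

namespace SuperModule

variable {k : Type u} [Field k] {S : Type u} [Ring S] [Algebra k S] {𝒮 : ZMod 2 → Submodule k S}

theorem baseChangeAct_push {K L : Type u} [Field K] [Field L] [Algebra k K] [Algebra k L]
    (M : SuperModule k 𝒮) (κ : K →ₐ[k] L) (z : K ⊗[k] S) (m : K ⊗[k] M.V) :
    M.baseChangeAct L (HopfHom.push κ S z) (HopfHom.push κ M.V m) =
      HopfHom.push κ M.V (M.baseChangeAct K z m) := by
  induction z with
  | zero => simp
  | add s t hs ht => simp only [map_add, LinearMap.add_apply, hs, ht]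
  | tmul a s =>
    induction m with
    | zero => simp
    | add x y hx hy => simp only [map_add, hx, hy]
    | tmul b x =>
      rw [baseChangeAct_tmul, HopfHom.push_tmul, HopfHom.push_tmul, HopfHom.push_tmul,
        baseChangeAct_tmul, map_mul]

theorem baseChangeAct_restrict {S' : Type u} [Ring S'] [Algebra k S']
    {𝒮' : ZMod 2 → Submodule k S'} {K : Type u} [Field K] [Algebra k K] (φ : S →ₐ[k] S')
    (hφ : ∀ (i : ZMod 2) (s : S), s ∈ 𝒮 i → φ s ∈ 𝒮' i) (M : SuperModule k 𝒮') (z : K ⊗[k] S)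
    (m : K ⊗[k] M.V) :
    (M.restrict φ hφ).baseChangeAct K z m = M.baseChangeAct K (φ.toLinearMap.lTensor K z) m := by
  let F : K ⊗[k] S →ₐ[K] Module.End K (K ⊗[k] M.V) := (M.restrict φ hφ).baseChangeAct K
  have hF : ∀ a b s x, F (a ⊗ₜ s) (b ⊗ₜ x) = (a * b) ⊗ₜ M.act (φ s) x := fun a b s x =>
    baseChangeAct_tmul K (M.restrict φ hφ) a b s x
  change F z m = _
  clear_value F
  induction z with
  | zero => simp
  | add s t hs ht => simp only [map_add, LinearMap.add_apply, hs, ht]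
  | tmul a s =>
    induction m with
    | zero => simp
    | add x y hx hy => simp only [map_add, hx, hy]
    | tmul b x =>
      rw [hF, LinearMap.lTensor_tmul, baseChangeAct_tmul]
      rfl

end SuperModule

section Support

variable {k : Type u} [Field k] (p : ℕ) [Fact p.Prime] [CharP k p] (r : ℕ)

theorem residueHom_restr (G : FiniteSupergroupScheme k) (s : Vr p r G) (x : Pr k p r) :
    (residueHom p r G s).restr x =
      HopfHom.push (IsScalarTower.toAlgHom k (CoordVr p r G) s.asIdeal.ResidueField) _
        ((univHom p r G).restr x) :=
  HopfHom.baseChange_restr _ _ x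

variable {p r} in
/-- The inclusion of the residue field at `f_*(s)` in the residue field at `s`. -/
def residueMap {H G : FiniteSupergroupScheme k} (f : H.Hom G) (s : Vr p r H) :
    (pushforward p r f s).asIdeal.ResidueField →ₐ[k] s.asIdeal.ResidueField :=
  Ideal.ResidueField.mapₐ _ _ (pushforwardComorphism p r f) rfl

theorem residueMap_comp {H G : FiniteSupergroupScheme k} (f : H.Hom G) (s : Vr p r H) :
    (residueMap f s).comp (IsScalarTower.toAlgHom k (CoordVr p r G) _) =
      (IsScalarTower.toAlgHom k (CoordVr p r H) _).comp (pushforwardComorphism p r f) :=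
  AlgHom.ext fun z => Ideal.ResidueField.map_algebraMap (pushforward p r f s).asIdeal s.asIdeal
    (pushforwardComorphism p r f).toRingHom rfl z

theorem push_residueHom_restr {H G : FiniteSupergroupScheme k} (f : H.Hom G) (s : Vr p r H)
    (x : Pr k p r) :
    HopfHom.push (residueMap f s) _ ((residueHom p r G (pushforward p r f s)).restr x) =
      (f.groupAlgebra : H.GroupAlgebra →ₗ[k] G.GroupAlgebra).lTensor _
        ((residueHom p r H s).restr x) := by
  rw [residueHom_restr, HopfHom.push_push, residueMap_comp, ← HopfHom.push_push,
    pushforwardComorphism, HopfHom.push_classify_universal_restr, HopfHom.ofBialgHom_comp_restr,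
    HopfHom.push_lTensor, residueHom_restr]

variable [NeZero r] (G : FiniteSupergroupScheme k) (M : G.Supermodule)

theorem fiberHom_one_tmul (s : Vr p r G) (x : Pr k p 1) :
    fiberHom p r G s (1 ⊗ₜ x) = (residueHom p r G s).restr (Pr.ι k p r x) := by
  rw [fiberHom, AlgHom.comp_apply, Algebra.TensorProduct.map_tmul]
  rfl

theorem fiber_act_one_tmul (s : Vr p r G) (x : Pr k p 1) :
    (fiber p r G M s).act (1 ⊗ₜ x) =
      M.baseChangeAct s.asIdeal.ResidueField ((residueHom p r G s).restr (Pr.ι k p r x)) := by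
  change M.baseChangeAct s.asIdeal.ResidueField (fiberHom p r G s (1 ⊗ₜ x)) = _
  rw [fiberHom_one_tmul]

theorem fiber_diff_exact_iff {H G : FiniteSupergroupScheme k} (f : H.Hom G) (M : G.Supermodule)
    (s : Vr p r H) :
    Function.Exact (fiber p r H (f.pullback M) s).diff (fiber p r H (f.pullback M) s).diff ↔
      Function.Exact (fiber p r G M (pushforward p r f s)).diff
        (fiber p r G M (pushforward p r f s)).diff := by
  have key : ∀ (y : Pr k p 1) x, (fiber p r H (f.pullback M) s).act (1 ⊗ₜ y)
      (HopfHom.push (residueMap f s) M.V x) = HopfHom.push (residueMap f s) M.V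
        ((fiber p r G M (pushforward p r f s)).act (1 ⊗ₜ y) x) := fun y x => by
    have h1 := SuperModule.baseChangeAct_push M (residueMap f s)
      ((residueHom p r G (pushforward p r f s)).restr (Pr.ι k p r y)) x
    rw [push_residueHom_restr] at h1
    rw [fiber_act_one_tmul, fiber_act_one_tmul]
    refine Eq.trans ?_ h1
    exact SuperModule.baseChangeAct_restrict _ _ M _ _
  exact mfDiff_exact_iff_of_push (residueMap f s) p (key _) (key _)

end Support

/-! ### Exactness and minors -/

section Minors

theorem exists_linearIndependent_submatrix_col {K m q : Type*} [Field K] [Finite m] [Fintype q]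
    (A : Matrix m q K) {n : ℕ} (hn : n ≤ A.rank) :
    ∃ j : Fin n → q, LinearIndependent K (A.submatrix id j).col := by
  rw [Matrix.rank_eq_finrank_span_cols] at hn
  obtain ⟨f, hf, -, hli⟩ := Submodule.exists_fun_fin_finrank_span_eq K (Set.range A.col)
  choose j hj using hf
  refine ⟨fun i => j (Fin.castLE hn i), ?_⟩
  have : (A.submatrix id fun i => j (Fin.castLE hn i)).col = f ∘ Fin.castLE hn :=
    funext fun i => hj _
  rw [this]
  exact hli.comp _ (Fin.castLE_injective hn)

theorem exists_det_submatrix_ne_zero_iff {K m : Type*} [Field K] [Fintype m] (A : Matrix m m K)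
    (n : ℕ) : (∃ i j : Fin n → m, (A.submatrix i j).det ≠ 0) ↔ n ≤ A.rank := by
  constructor
  · rintro ⟨i, j, h⟩
    have h1 := Matrix.rank_of_isUnit _ ((Matrix.isUnit_iff_isUnit_det _).mpr h.isUnit)
    rw [Fintype.card_fin] at h1
    exact h1.symm.le.trans (A.rank_submatrix_le i j)
  · intro hn
    obtain ⟨j, hj⟩ := exists_linearIndependent_submatrix_col A hn
    have hr : (A.submatrix id j).rank = n := by
      rw [Matrix.rank_eq_finrank_span_cols, finrank_span_eq_card hj, Fintype.card_fin]
    rw [← Matrix.rank_transpose] at hr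
    obtain ⟨i, hi⟩ := exists_linearIndependent_submatrix_col _ hr.ge
    refine ⟨i, j, ?_⟩
    have h1 := (Matrix.isUnit_iff_isUnit_det _).mp
      (Matrix.linearIndependent_cols_iff_isUnit.mp hi)
    rw [← Matrix.det_transpose]
    exact h1.ne_zero

/-- A square-zero endomorphism of a space of dimension `2 n` is exact if and only if its rank is at
least `n`. -/
theorem exact_iff_le_finrank_range {K N : Type*} [Field K] [AddCommGroup N] [Module K N]
    [Module.Finite K N] {n : ℕ} (hn : Module.finrank K N = n + n) (d : Module.End K N)
    (hd : ∀ x, d (d x) = 0) :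
    Function.Exact d d ↔ n ≤ Module.finrank K (LinearMap.range d) := by
  have hle : LinearMap.range d ≤ LinearMap.ker d := by
    rintro _ ⟨x, rfl⟩
    exact hd x
  have hsum := d.finrank_range_add_finrank_ker
  rw [LinearMap.exact_iff]
  constructor
  · intro h
    rw [h] at hsum
    omega
  · intro h
    have := Submodule.finrank_mono hle
    exact (Submodule.eq_of_le_of_finrank_le hle (by omega)).symm

end Minors

/-! ### The matrix of the action -/

namespace SuperModule

variable {k : Type u} [Field k] {S : Type u} [Ring S] [Algebra k S] {𝒮 : ZMod 2 → Submodule k S}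
  (M : SuperModule k 𝒮) [Module.Finite k M.V]

/-- The functional on `S` that takes a matrix coefficient of the action on `M`. -/
def matrixCoeff (i j : Fin (Module.finrank k M.V)) : Module.Dual k S :=
  (Module.finBasis k M.V).coord i ∘ₗ LinearMap.applyₗ (Module.finBasis k M.V j) ∘ₗ
    M.act.toLinearMap

/-- The matrix of the action of an element of `A ⊗ S` on `A ⊗ M`. -/
def actMatrix {A : Type u} [CommRing A] [Algebra k A] (z : A ⊗[k] S) :
    Matrix (Fin (Module.finrank k M.V)) (Fin (Module.finrank k M.V)) A :=
  Matrix.of fun i j => HopfHom.coeff (M.matrixCoeff i j) z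

theorem actMatrix_push {A B : Type u} [CommRing A] [Algebra k A] [CommRing B] [Algebra k B]
    (φ : A →ₐ[k] B) (z : A ⊗[k] S) : M.actMatrix (HopfHom.push φ S z) = (M.actMatrix z).map φ :=
  Matrix.ext fun i j => HopfHom.push_coeff φ (M.matrixCoeff i j) z

theorem toMatrix_baseChangeAct {K : Type u} [Field K] [Algebra k K] (z : K ⊗[k] S) :
    LinearMap.toMatrix ((Module.finBasis k M.V).baseChange K) ((Module.finBasis k M.V).baseChange K)
      (M.baseChangeAct K z) = M.actMatrix z := by
  ext i j
  rw [LinearMap.toMatrix_apply, Module.Basis.baseChange_apply, actMatrix, Matrix.of_apply]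
  induction z with
  | zero => simp
  | add s t hs ht => simp only [map_add, LinearMap.add_apply, Finsupp.add_apply, hs, ht]
  | tmul a s =>
    rw [baseChangeAct_tmul, mul_one, Module.Basis.baseChange_repr_tmul, HopfHom.coeff,
      LinearMap.comp_apply, LinearMap.lTensor_tmul]
    simp [matrixCoeff]

/-- The matrix of `mfDiff`, for matrices of `U` and `V`. -/
def diffMatrix {A m : Type*} [CommRing A] [Fintype m] [DecidableEq m] (p : ℕ)
    (U V : Matrix m m A) : Matrix (m ⊕ m) (m ⊕ m) A :=
  Matrix.fromBlocks V (-U ^ (p - 1)) (-U) (-V)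

theorem diffMatrix_map {A B m : Type*} [CommRing A] [CommRing B] [Fintype m] [DecidableEq m]
    (p : ℕ) (U V : Matrix m m A) (φ : A →+* B) :
    (diffMatrix p U V).map φ = diffMatrix p (U.map φ) (V.map φ) := by
  have h := (φ.mapMatrix (m := m)).map_pow U (p - 1)
  rw [RingHom.mapMatrix_apply, RingHom.mapMatrix_apply] at h
  rw [diffMatrix, diffMatrix, Matrix.fromBlocks_map, ← h]
  congr 1 <;> ext <;> simp

theorem toMatrix_mfDiff {K N m : Type*} [Field K] [AddCommGroup N] [Module K N] [Fintype m]
    [DecidableEq m] (b : Module.Basis m K N) (p : ℕ) (U V : Module.End K N) :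
    LinearMap.toMatrix (b.prod b) (b.prod b) (mfDiff p U V) =
      diffMatrix p (LinearMap.toMatrix b b U) (LinearMap.toMatrix b b V) := by
  rw [diffMatrix, LinearMap.toMatrix_pow]
  ext (i | i) (j | j) <;> simp [LinearMap.toMatrix_apply, mfDiff_apply]

/-- The exactness of `diff` as a condition on the rank of a matrix. -/
theorem diff_exact_iff_le_rank {p : ℕ} {k L : Type u} [Field k] [Fact p.Prime] [CharP k p]
    [Field L] [Algebra k L] {M : Fiber k p L} (hp : p ≠ 0) {n : ℕ}
    (b : Module.Basis (Fin n) L M.V) : Function.Exact M.diff M.diff ↔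
      n ≤ (diffMatrix p (LinearMap.toMatrix b b M.opU) (LinearMap.toMatrix b b M.opV)).rank := by
  have : Module.Finite L M.V := Module.Finite.of_basis b
  have hn : Module.finrank L M.V = n := by
    rw [Module.finrank_eq_card_basis b, Fintype.card_fin]
  rw [exact_iff_le_finrank_range (by rw [Module.finrank_prod, hn]) M.diff (diff_diff hp),
    ← toMatrix_mfDiff, Matrix.rank_eq_finrank_range_toLin _ (b.prod b) (b.prod b),
    Matrix.toLin_toMatrix, diff]

theorem restrict_diff_exact_iff_le_rank {p : ℕ} [Fact p.Prime] [CharP k p] {K : Type u} [Field K]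
    [Algebra k K] (φ : K ⊗[k] Pr k p 1 →ₐ[K] K ⊗[k] S)
    (hφ : ∀ (i : ZMod 2) (x : K ⊗[k] Pr k p 1), x ∈ (Pr.parity k p 1 i).baseChange K →
      φ x ∈ (𝒮 i).baseChange K) :
    Function.Exact (diff (k := k) (p := p) ((M.baseChange K).restrict φ hφ))
      (diff (k := k) (p := p) ((M.baseChange K).restrict φ hφ)) ↔ Module.finrank k M.V ≤
        (diffMatrix p (M.actMatrix (φ (1 ⊗ₜ Pr.u k p 0)))
          (M.actMatrix (φ (1 ⊗ₜ Pr.v k p 1)))).rank := by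
  rw [← toMatrix_baseChangeAct, ← toMatrix_baseChangeAct]
  exact diff_exact_iff_le_rank (M := (M.baseChange K).restrict φ hφ) (Fact.out : p.Prime).ne_zero
    ((Module.finBasis k M.V).baseChange K)

end SuperModule

/-! ### Homogeneous minors -/

section Homogeneous

variable {k : Type u} [Field k] (p : ℕ) [Fact p.Prime] [CharP k p] (r : ℕ)
  (G : FiniteSupergroupScheme k)

theorem coaction_coeff (x : Pr k p r) (f : Module.Dual k G.GroupAlgebra) (b : ScaleAlg k p r)
    (h : Pr.scaleAlgHom (C := CoordVr p r G ⊗[k] ScaleAlg k p r) (1 ⊗ₜ[k] scaleY k p r)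
      (1 ⊗ₜ[k] scaleX k p r) (by rw [Algebra.TensorProduct.tmul_pow,
        Algebra.TensorProduct.tmul_pow, one_pow, one_pow, scaleX_pow]) x = (1 ⊗ₜ b) ⊗ₜ x) :
    coaction p r G (HopfHom.coeff f ((univHom p r G).restr x)) =
      HopfHom.coeff f ((univHom p r G).restr x) ⊗ₜ b := by
  refine (HopfHom.push_coeff (A := CoordVr p r G)
    (B := CoordVr p r G ⊗[k] ScaleAlg k p r) (coaction p r G) f _).symm.trans ?_
  rw [coaction, HopfHom.push_classify_universal_restr]
  have h1 : ∀ (A : Type u) [CommRing A] [Algebra k A]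
      (σ : HopfHom A (Pr.parity k p r) (FiniteSupergroupScheme.GroupAlgebra.parity G))
      (ρ : HopfHom A (Pr.parity k p r) (Pr.parity k p r)) (c : A), ρ.restr x = c ⊗ₜ x →
      (σ.comp ρ).restr x = c • σ.restr x := fun A _ _ σ ρ c hc => by
    rw [← HopfHom.tmul_apply, ← hc]
    rfl
  refine (congrArg _ (h1 _ _ _ (1 ⊗ₜ b) ((HopfHom.ofAlgHom_restr _ _ _ _ x).trans h))).trans ?_
  rw [HopfHom.coeff_smul, HopfHom.baseChange_restr, HopfHom.push_coeff,
    Algebra.TensorProduct.includeLeft_apply, Algebra.TensorProduct.tmul_mul_tmul, one_mul, mul_one]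

/-- The element `z` has weight `w`: it is zero, or its coaction is `z ⊗ x ^ i y ^ j` with
`2 i + p ^ r j = w`. The weight is twice the degree. -/
def IsWeighted (z : CoordVr p r G) (w : ℕ) : Prop :=
  z = 0 ∨ ∃ i j : ℕ, 2 * i + p ^ r * j = w ∧
    coaction p r G z = z ⊗ₜ[k] (scaleX k p r ^ i * scaleY k p r ^ j)

variable {p r G}

theorem scaleX_pow_mul_scaleY_pow (i j : ℕ) : scaleX k p r ^ i * scaleY k p r ^ j =
    scaleX k p r ^ (i + p ^ r * (j / 2)) * scaleY k p r ^ (j % 2) := by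
  conv_lhs => rw [← Nat.div_add_mod j 2]
  rw [pow_add, pow_mul, ← scaleX_pow, ← pow_mul, ← mul_assoc, ← pow_add]

/-- As `p` is odd, the monomial `x ^ i y ^ j` depends only on `2 i + p ^ r j`. -/
theorem scale_monomial_eq (hp : Odd p) {i j i' j' : ℕ}
    (h : 2 * i + p ^ r * j = 2 * i' + p ^ r * j') :
    scaleX k p r ^ i * scaleY k p r ^ j = scaleX k p r ^ i' * scaleY k p r ^ j' := by
  have hj : j % 2 = j' % 2 := by
    have := congrArg (· % 2) h
    have hq : p ^ r % 2 = 1 := Nat.odd_iff.mp hp.pow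
    simpa [Nat.add_mod, Nat.mul_mod, hq] using this
  have hi : i + p ^ r * (j / 2) = i' + p ^ r * (j' / 2) := by
    have e1 := Nat.div_add_mod j 2
    have e2 := Nat.div_add_mod j' 2
    rw [← e1, ← e2, hj, mul_add, mul_add, ← mul_assoc, ← mul_assoc, mul_comm (p ^ r) 2, mul_assoc,
      mul_assoc] at h
    omega
  rw [scaleX_pow_mul_scaleY_pow i j, scaleX_pow_mul_scaleY_pow i' j', hi, hj]

namespace IsWeighted

variable {z z' : CoordVr p r G} {w w' : ℕ}

theorem isHomogeneousElem (h : IsWeighted p r G z w) : IsHomogeneousElem p r G z := by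
  rcases h with rfl | ⟨i, j, -, h⟩
  · exact ⟨0, Or.inl (by rw [map_zero, TensorProduct.zero_tmul])⟩
  · rw [scaleX_pow_mul_scaleY_pow] at h
    refine ⟨i + p ^ r * (j / 2), ?_⟩
    rcases Nat.mod_two_eq_zero_or_one j with hj | hj <;> rw [hj] at h
    · rw [pow_zero, mul_one] at h
      exact Or.inl h
    · rw [pow_one] at h
      exact Or.inr h

theorem zero : IsWeighted p r G 0 w := Or.inl rfl

theorem one : IsWeighted p r G 1 0 :=
  Or.inr ⟨0, 0, rfl, by
    rw [pow_zero, pow_zero, one_mul]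
    exact (coaction p r G).map_one⟩

theorem neg (h : IsWeighted p r G z w) : IsWeighted p r G (-z) w := by
  rcases h with rfl | ⟨i, j, hw, h⟩
  · rw [neg_zero]
    exact zero
  · exact Or.inr ⟨i, j, hw, by rw [map_neg, h, TensorProduct.neg_tmul]⟩

theorem mul (h : IsWeighted p r G z w) (h' : IsWeighted p r G z' w') :
    IsWeighted p r G (z * z') (w + w') := by
  rcases h with rfl | ⟨i, j, rfl, h⟩
  · rw [zero_mul]
    exact zero
  rcases h' with rfl | ⟨i', j', rfl, h'⟩
  · rw [mul_zero]
    exact zero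
  · refine Or.inr ⟨i + i', j + j', by ring, ?_⟩
    rw [map_mul, h, h', Algebra.TensorProduct.tmul_mul_tmul, pow_add, pow_add, mul_mul_mul_comm]

theorem add (hp : Odd p) (h : IsWeighted p r G z w) (h' : IsWeighted p r G z' w) :
    IsWeighted p r G (z + z') w := by
  rcases h with rfl | ⟨i, j, hw, h⟩
  · rwa [zero_add]
  rcases h' with rfl | ⟨i', j', hw', h'⟩
  · rw [add_zero]
    exact Or.inr ⟨i, j, hw, h⟩
  · refine Or.inr ⟨i, j, hw, ?_⟩
    rw [map_add, h, h', TensorProduct.add_tmul, scale_monomial_eq hp (hw'.trans hw.symm)]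

theorem sum (hp : Odd p) {ι : Type*} (s : Finset ι) (f : ι → CoordVr p r G)
    (h : ∀ i ∈ s, IsWeighted p r G (f i) w) : IsWeighted p r G (∑ i ∈ s, f i) w :=
  Finset.sum_induction _ (IsWeighted p r G · w) (fun _ _ => add hp) zero h

theorem prod {ι : Type*} (s : Finset ι) (f : ι → CoordVr p r G) (d : ι → ℕ)
    (h : ∀ i ∈ s, IsWeighted p r G (f i) (d i)) :
    IsWeighted p r G (∏ i ∈ s, f i) (∑ i ∈ s, d i) := by
  classical
  induction s using Finset.induction_on with
  | empty => exact one
  | insert i s hi ih =>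
    rw [Finset.prod_insert hi, Finset.sum_insert hi]
    exact (h i (Finset.mem_insert_self i s)).mul
      (ih fun j hj => h j (Finset.mem_insert_of_mem hj))

theorem det (hp : Odd p) {m : Type*} [Fintype m] [DecidableEq m]
    {A : Matrix m m (CoordVr p r G)} (a b : m → ℕ)
    (h : ∀ i j, IsWeighted p r G (A i j) (a i + b j)) :
    IsWeighted p r G A.det (∑ i, a i + ∑ i, b i) := by
  rw [Matrix.det_apply]
  refine sum hp _ _ fun σ _ => ?_
  have h1 : IsWeighted p r G (∏ i, A (σ i) i) (∑ i, a i + ∑ i, b i) := by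
    rw [← Equiv.sum_comp σ a, ← Finset.sum_add_distrib]
    exact prod _ _ _ fun i _ => h _ _
  rcases Int.units_eq_one_or (Equiv.Perm.sign σ) with hσ | hσ <;> rw [hσ]
  · rwa [one_smul]
  · rw [Units.neg_smul, one_smul]
    exact h1.neg

theorem matrix_pow (hp : Odd p) {m : Type*} [Fintype m] [DecidableEq m]
    {A : Matrix m m (CoordVr p r G)} (h : ∀ i j, IsWeighted p r G (A i j) w) (n : ℕ) (i j : m) :
    IsWeighted p r G ((A ^ n) i j) (n * w) := by
  induction n generalizing i j with
  | zero =>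
    rw [pow_zero, Matrix.one_apply, zero_mul]
    split_ifs
    · exact one
    · exact zero
  | succ n ih =>
    rw [pow_succ, Matrix.mul_apply, add_mul, one_mul]
    exact sum hp _ _ fun l _ => (ih i l).mul (h l j)

end IsWeighted

end Homogeneous

section Support

open SuperModule

variable {k : Type u} [Field k] (p : ℕ) [Fact p.Prime] [CharP k p] (r : ℕ) [NeZero r]
  (G : FiniteSupergroupScheme k) (M : G.Supermodule)

theorem mem_support_iff (hp : 3 ≤ p) (s : Vr p r G) : s ∈ support p r G M ↔
    ¬ Function.Exact (fiber p r G M s).diff (fiber p r G M s).diff := by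
  have hodd : Odd p := (Fact.out : p.Prime).odd_of_ne_two (by omega)
  have h2 : (2 : s.asIdeal.ResidueField) ≠ 0 := by
    have hk : ((2 : ℕ) : k) ≠ 0 := by
      rw [Ne, CharP.cast_eq_zero_iff k p]
      exact fun h => absurd (Nat.le_of_dvd two_pos h) (by omega)
    have := (map_ne_zero (algebraMap k s.asIdeal.ResidueField)).mpr hk
    rwa [map_natCast] at this
  exact projDim_eq_top_iff h2 hodd

variable [Module.Finite k M.V]

/-- The matrix of the differential `diff` of the universal family over `V_r(G)`. -/
def univMatrix : Matrix (Fin (Module.finrank k M.V) ⊕ Fin (Module.finrank k M.V))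
    (Fin (Module.finrank k M.V) ⊕ Fin (Module.finrank k M.V)) (CoordVr p r G) :=
  diffMatrix p (M.actMatrix ((univHom p r G).restr (Pr.ι k p r (Pr.u k p 0))))
    (M.actMatrix ((univHom p r G).restr (Pr.ι k p r (Pr.v k p 1))))

theorem actMatrix_fiberHom (s : Vr p r G) (x : Pr k p 1) :
    M.actMatrix (fiberHom p r G s (1 ⊗ₜ x)) =
      (M.actMatrix ((univHom p r G).restr (Pr.ι k p r x))).map
        (algebraMap (CoordVr p r G) s.asIdeal.ResidueField) :=
  (congrArg M.actMatrix ((fiberHom_one_tmul p r G s x).trans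
    (residueHom_restr p r G s (Pr.ι k p r x)))).trans (M.actMatrix_push _ _)

theorem fiber_diff_exact_iff_le_rank (s : Vr p r G) :
    Function.Exact (fiber p r G M s).diff (fiber p r G M s).diff ↔ Module.finrank k M.V ≤
      ((univMatrix p r G M).map (algebraMap (CoordVr p r G) s.asIdeal.ResidueField)).rank := by
  have h : (diffMatrix p (M.actMatrix (fiberHom p r G s (1 ⊗ₜ Pr.u k p 0)))
      (M.actMatrix (fiberHom p r G s (1 ⊗ₜ Pr.v k p 1)))) =
      (univMatrix p r G M).map (algebraMap (CoordVr p r G) s.asIdeal.ResidueField) := by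
    rw [univMatrix, diffMatrix_map]
    exact congrArg₂ (diffMatrix p) (actMatrix_fiberHom p r G M s _)
      (actMatrix_fiberHom p r G M s _)
  rw [← h]
  exact M.restrict_diff_exact_iff_le_rank (fiberHom p r G s) (fiberHom_parity p r G s)

/-- The support of a finite-dimensional supermodule is defined by the minors of `univMatrix`. -/
theorem support_eq_zeroLocus (hp : 3 ≤ p) : support p r G M = PrimeSpectrum.zeroLocus
    (Set.range fun c : (Fin (Module.finrank k M.V) → _) × (Fin (Module.finrank k M.V) → _) =>
      ((univMatrix p r G M).submatrix c.1 c.2).det) := by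
  ext s
  rw [mem_support_iff p r G M hp, fiber_diff_exact_iff_le_rank, ← exists_det_submatrix_ne_zero_iff,
    PrimeSpectrum.mem_zeroLocus, Set.range_subset_iff]
  have h3 : ∀ i j : Fin (Module.finrank k M.V) → _, (((univMatrix p r G M).map (algebraMap
      (CoordVr p r G) s.asIdeal.ResidueField)).submatrix i j).det = algebraMap (CoordVr p r G)
        s.asIdeal.ResidueField ((univMatrix p r G M).submatrix i j).det := fun i j => by
    rw [RingHom.map_det, RingHom.mapMatrix_apply, Matrix.submatrix_map]
  simp only [h3, ne_eq, Ideal.algebraMap_residueField_eq_zero, Prod.forall, not_exists, not_not,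
    SetLike.mem_coe]

theorem isWeighted_actMatrix_u (i j : Fin (Module.finrank k M.V)) : IsWeighted p r G
    (M.actMatrix ((univHom p r G).restr (Pr.ι k p r (Pr.u k p 0))) i j) (2 * p ^ (r - 1)) := by
  have hu : Pr.ι k p r (Pr.u k p 0) =
      Pr.u k p ⟨r - 1, Nat.sub_lt (Nat.pos_of_ne_zero (NeZero.ne r)) one_pos⟩ :=
    Pr.lift_u _ _ _ _ _
  refine Or.inr ⟨p ^ (r - 1), 0, by rw [mul_zero, add_zero], coaction_coeff p r G _ _ _ ?_⟩
  rw [hu, Pr.scaleAlgHom_u, Algebra.TensorProduct.tmul_pow, one_pow, pow_zero, mul_one]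

theorem isWeighted_actMatrix_v (i j : Fin (Module.finrank k M.V)) : IsWeighted p r G
    (M.actMatrix ((univHom p r G).restr (Pr.ι k p r (Pr.v k p 1))) i j) (p ^ r) := by
  have hv : Pr.ι k p r (Pr.v k p 1) = Pr.v k p r := Pr.lift_v _ _ _ _
  refine Or.inr ⟨0, 1, by rw [mul_zero, zero_add, mul_one], coaction_coeff p r G _ _ _ ?_⟩
  rw [hv, Pr.scaleAlgHom_v, pow_zero, one_mul, pow_one]

/-- The weight of the entry `(a, b)` of `univMatrix` is the sum of a weight of the row `a` and a
weight of the column `b`. -/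
theorem isWeighted_univMatrix (hp : 3 ≤ p)
    (a b : Fin (Module.finrank k M.V) ⊕ Fin (Module.finrank k M.V)) :
    IsWeighted p r G (univMatrix p r G M a b)
      (Sum.elim (fun _ => (p - 2) * p ^ (r - 1)) (fun _ => 0) a +
        Sum.elim (fun _ => 2 * p ^ (r - 1)) (fun _ => p ^ r) b) := by
  have hodd : Odd p := (Fact.out : p.Prime).odd_of_ne_two (by omega)
  have hr : p ^ r = p * p ^ (r - 1) := by
    rw [← pow_succ', Nat.sub_add_cancel (Nat.pos_of_ne_zero (NeZero.ne r))]
  have e1 : (p - 2) * p ^ (r - 1) + 2 * p ^ (r - 1) = p ^ r := by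
    rw [← add_mul, Nat.sub_add_cancel (by omega), hr]
  have e2 : (p - 2) * p ^ (r - 1) + p ^ r = (p - 1) * (2 * p ^ (r - 1)) := by
    obtain ⟨m, rfl⟩ := Nat.exists_eq_add_of_le (show 2 ≤ p by omega)
    rw [hr, Nat.add_sub_cancel_left, show 2 + m - 1 = m + 1 by omega]
    ring
  rcases a with a | a <;> rcases b with b | b
  · change IsWeighted p r G (M.actMatrix _ a b) ((p - 2) * p ^ (r - 1) + 2 * p ^ (r - 1))
    rw [e1]
    exact isWeighted_actMatrix_v p r G M a b
  · change IsWeighted p r G (-(M.actMatrix _ ^ (p - 1)) a b) ((p - 2) * p ^ (r - 1) + p ^ r)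
    rw [e2]
    exact (IsWeighted.matrix_pow hodd (isWeighted_actMatrix_u p r G M) (p - 1) a b).neg
  · change IsWeighted p r G (-(M.actMatrix _ a b)) (0 + 2 * p ^ (r - 1))
    rw [zero_add]
    exact (isWeighted_actMatrix_u p r G M a b).neg
  · change IsWeighted p r G (-(M.actMatrix _ a b)) (0 + p ^ r)
    rw [zero_add]
    exact (isWeighted_actMatrix_v p r G M a b).neg

theorem support_isConical (hp : 3 ≤ p) : IsConical p r G (support p r G M) := by
  have hodd : Odd p := (Fact.out : p.Prime).odd_of_ne_two (by omega)
  refine ⟨Ideal.span (Set.range fun c : (Fin (Module.finrank k M.V) → _) ×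
    (Fin (Module.finrank k M.V) → _) => ((univMatrix p r G M).submatrix c.1 c.2).det), ?_, ?_⟩
  · refine le_antisymm (Ideal.span_le.mpr ?_) (Ideal.span_le.mpr fun z hz => hz.1)
    rintro _ ⟨c, rfl⟩
    exact Ideal.subset_span ⟨Ideal.subset_span ⟨c, rfl⟩,
      (IsWeighted.det hodd _ _ fun i j =>
        isWeighted_univMatrix p r G M hp (c.1 i) (c.2 j)).isHomogeneousElem⟩
  · rw [PrimeSpectrum.zeroLocus_span]
    exact support_eq_zeroLocus p r G M hp

end Support

/-! ### Functoriality in the supergroup scheme -/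

section Functoriality

variable {k : Type u} [Field k] (p : ℕ) [Fact p.Prime] [CharP k p] (r : ℕ)

theorem preimage_support [NeZero r] (hp : 3 ≤ p) {H G : FiniteSupergroupScheme k} (f : H.Hom G)
    (M : G.Supermodule) :
    pushforward p r f ⁻¹' support p r G M = support p r H (f.pullback M) := by
  ext s
  rw [Set.mem_preimage, mem_support_iff p r G M hp, mem_support_iff p r H _ hp,
    fiber_diff_exact_iff p r f M s]

theorem groupAlgebra_injective {H G : FiniteSupergroupScheme k} {f : H.Hom G}
    (hf : f.IsClosedEmbedding) : Function.Injective f.groupAlgebraLinear := fun x y h => by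
  apply FiniteSupergroupScheme.GroupAlgebra.toDual.injective
  refine LinearMap.ext fun a => ?_
  obtain ⟨b, rfl⟩ := hf a
  exact DFunLike.congr_fun (congrArg FiniteSupergroupScheme.GroupAlgebra.toDual h) b

/-- A closed embedding `H → G` gives an injection `kH → kG`. Every functional on `kH` therefore
extends to `kG`, so that every generator of `k[V_r(H)]` lies in the image. -/
theorem pushforwardComorphism_surjective {H G : FiniteSupergroupScheme k} (f : H.Hom G)
    (hf : f.IsClosedEmbedding) : Function.Surjective (pushforwardComorphism p r f) := by
  obtain ⟨g, hg⟩ := f.groupAlgebraLinear.exists_leftInverse_of_injective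
    (LinearMap.ker_eq_bot.mpr (groupAlgebra_injective hf))
  rw [← AlgHom.range_eq_top, eq_top_iff]
  rintro z -
  obtain ⟨t, rfl⟩ := Ideal.Quotient.mk_surjective z
  induction t using MvPolynomial.induction_on with
  | C a => exact (pushforwardComorphism p r f).range.algebraMap_mem a
  | add s t hs ht => rw [map_add]; exact add_mem hs ht
  | mul_X s c hs =>
    rw [map_mul]
    refine mul_mem hs ⟨HopfHom.coeff (c.2 ∘ₗ g) ((univHom p r G).restr c.1), ?_⟩
    change pushforwardComorphism p r f _ = _
    rw [← HopfHom.push_coeff, pushforwardComorphism, HopfHom.push_classify_universal_restr,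
      HopfHom.ofBialgHom_comp_restr, HopfHom.coeff_lTensor, LinearMap.comp_assoc]
    have h1 : g ∘ₗ (f.groupAlgebra : H.GroupAlgebra →ₗ[k] G.GroupAlgebra) = LinearMap.id := hg
    rw [h1, LinearMap.comp_id]
    exact HopfHom.coeff_universal_restr _ _

end Functoriality

end SuperSupport

end

theorem proposition3 {k : Type u} [Field k] (p : ℕ) [Fact p.Prime] [CharP k p] (hp : 3 ≤ p)
    (r : ℕ) [NeZero r] (G : FiniteSupergroupScheme k) (M : G.Supermodule) :
    (Module.Finite k M.V →
      IsClosed (support p r G M) ∧ IsConical p r G (support p r G M)) ∧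
    ∀ (H : FiniteSupergroupScheme k) (f : H.Hom G),
      pushforward p r f ⁻¹' support p r G M = support p r H (f.pullback M) ∧
      (f.IsClosedEmbedding →
        Function.Surjective (pushforwardComorphism p r f) ∧
        pushforward p r f '' support p r H (f.pullback M) =
          Set.range (pushforward p r f) ∩ support p r G M) := by
  refine ⟨fun _ => ⟨?_, support_isConical p r G M hp⟩, fun H f =>
    ⟨preimage_support p r hp f M, fun hf => ⟨pushforwardComorphism_surjective p r f hf, ?_⟩⟩⟩
  · rw [support_eq_zeroLocus p r G M hp]
    exact PrimeSpectrum.isClosed_zeroLocus _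
  · rw [← preimage_support p r hp f M, Set.image_preimage_eq_range_inter]
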